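/- **Setting.** For $t>0$ put $\langle x\rangle=(x^2+t^{2/3})^{1/2}$, and for $u:\mathbb R\to\mathbb R$ let $L^{NL}u = x u-3t\,u_{xx}+9t\,u^2$ (in the sense of distributions). $\dot H^{1/2}$ and $\dot B^{-1/2}_{2,\infty}$ are the homogeneous Sobolev and Besov spaces on $\mathbb R$, whose norms are computed from the Fourier transform away from the zero frequency. For $\epsilon>0$ let $B^{-1/2,\epsilon}_{2,\infty}=\dot B^{-1/2}_{2,\infty}+\epsilon^{1/2}L^2$, with norm $$\|u\|_{B^{-1/2,\epsilon}_{2,\infty}}=\inf_{w\in L^2}\big(\|u-w\|_{\dot B^{-1/2}_{2,\infty}}+\epsilon^{-1/2}\|w\|_{L^2}\big)\ \le\ \|u\|_{\dot B^{-1/2}_{2,\infty}}.$$ **Proposition (nonlinear Klainerman–Sobolev inequality).** For all $K>0$ and $\kappa>0$ there is $C>0$ such that for every $M>0$ there is $c>0$ with the following property. Let $\epsilon>0$, $0<t\le c\,\epsilon^{-3}$, and let $u:\mathbb R\to\mathbb R$ be a differentiable function satisfying, for all $x\in\mathbb R$, $$|u(x)|\le M\epsilon\, t^{-1/4}\langle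 x\rangle^{-1/4},\qquad |u_x(x)|\le M\epsilon\, t^{-3/4}\langle x\rangle^{1/4},$$ and $$\|u\|_{B^{-1/2,\epsilon}_{2,\infty}}+\|L^{NL}u\|_{\dot H^{1/2}}\le K\epsilon .$$ Then: a) for all $x\in\mathbb R$, $$t^{1/4}\langle x\rangle^{1/4}|u(x)|+t^{3/4}\langle x\rangle^{-1/4}|u_x(x)|\le C\epsilon;$$ b) in the elliptic region, that is, for all $x\ge\kappa t^{1/3}$, $$\langle x\rangle|u(x)|+t^{1/2}\langle x\rangle^{1/2}|u_x(x)|\le C\epsilon\,\ln\big(t^{-1/3}\langle x\rangle\big).$$ The constant $C$ does not depend on $M$, $\epsilon$, $t$ or $u$; the constant $c$ does not depend on $\epsilon$, $t$ or $u$. -/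

import Mathlib

open MeasureTheory SchwartzMap FourierTransform
open scoped ENNReal

noncomputable section

namespace KdV

/-- The time-dependent bracket `⟨x⟩ = (x² + |t|^{2/3})^{1/2}`. -/
def bracket (t x : ℝ) : ℝ := Real.sqrt (x ^ 2 + |t| ^ (2 / 3 : ℝ))

open Classical in
/-- The tempered distribution `φ ↦ ∫ φ g` attached to a bounded measurable function `g`
(see `toDist_apply`); it is `0` when `g` is not essentially bounded or not measurable. -/
def toDist (g : ℝ → ℂ) : 𝓢'(ℝ, ℂ) :=
  if h : MemLp g ∞ (volume : Measure ℝ) then Lp.toTemperedDistribution (h.toLp g) else 0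

/-- On bounded measurable functions `toDist` is integration against the function. -/
theorem toDist_apply {g : ℝ → ℂ} (h : MemLp g ∞ (volume : Measure ℝ)) (φ : 𝓢(ℝ, ℂ)) :
    toDist g φ = ∫ x, φ x * g x := by
  rw [toDist, dif_pos h, Lp.toTemperedDistribution_apply]
  refine integral_congr_ae ?_
  filter_upwards [h.coeFn_toLp] with x hx
  rw [hx, smul_eq_mul]

/-- The nonlinear operator `L^{NL} u = x u - 3 t u_xx + 9 t u²` at time `t`, as a tempered
distribution (the second derivative is the distributional one). -/
def LNL (t : ℝ) (u : ℝ → ℝ) : 𝓢'(ℝ, ℂ) :=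
  TemperedDistribution.smulLeftCLM ℂ (fun x : ℝ => (x : ℂ)) (toDist fun x => (u x : ℂ))
    - ((3 * t : ℝ) : ℂ) • TemperedDistribution.derivCLM ℂ
        (TemperedDistribution.derivCLM ℂ (toDist fun x => (u x : ℂ)))
    + ((9 * t : ℝ) : ℂ) • toDist fun x => ((u x ^ 2 : ℝ) : ℂ)

/-- The Fourier transform of the tempered distribution `T` is, away from the zero frequency, the
locally integrable function `F`. The zero frequency is left out because homogeneous norms do not
see constants (or polynomials). The variable `ξ` of Mathlib's Fourier transform corresponds to the
frequency `2πξ`. -/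
def IsFourierOffZero (T : 𝓢'(ℝ, ℂ)) (F : ℝ → ℂ) : Prop :=
  LocallyIntegrableOn F {0}ᶜ volume ∧
    ∀ φ : 𝓢(ℝ, ℂ), HasCompactSupport φ → (0 : ℝ) ∉ tsupport φ →
      (𝓕 T) φ = ∫ ξ, φ ξ * F ξ

/-- The homogeneous Sobolev norm `‖T‖_{Ḣ^s} = ‖ |D|^s T ‖_{L²}`, computed on the Fourier side. The
function `F` is unique up to null sets when it exists; otherwise the norm is `∞`. -/
def homSobolevNorm (s : ℝ) (T : 𝓢'(ℝ, ℂ)) : ℝ≥0∞ :=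
  ⨅ (F : ℝ → ℂ) (_ : IsFourierOffZero T F),
    (∫⁻ ξ, ENNReal.ofReal (|2 * Real.pi * ξ| ^ (2 * s)) * ‖F ξ‖ₑ ^ 2) ^ (1 / 2 : ℝ)

/-- The homogeneous Besov norm `‖T‖_{Ḃ^s_{2,∞}} = sup_k 2^{sk} ‖P_k T‖_{L²}`, where `P_k` is the
projection to the dyadic frequencies `2^k ≤ |2πξ| < 2^{k+1}`. -/
def homBesovNorm (s : ℝ) (T : 𝓢'(ℝ, ℂ)) : ℝ≥0∞ :=
  ⨅ (F : ℝ → ℂ) (_ : IsFourierOffZero T F),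
    ⨆ k : ℤ, ENNReal.ofReal ((2 : ℝ) ^ (s * (k : ℝ))) *
      (∫⁻ ξ in {ξ : ℝ | (2 : ℝ) ^ k ≤ |2 * Real.pi * ξ| ∧ |2 * Real.pi * ξ| < (2 : ℝ) ^ (k + 1)},
        ‖F ξ‖ₑ ^ 2) ^ (1 / 2 : ℝ)

/-- The norm of the sum space `B^{-1/2,ε}_{2,∞} = Ḃ^{-1/2}_{2,∞} + ε^{1/2} L²`: the infimum of
`‖T - w‖_{Ḃ^{-1/2}_{2,∞}} + ε^{-1/2} ‖w‖_{L²}` over `w ∈ L²`. -/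
def besovSumNorm (ε : ℝ) (T : 𝓢'(ℝ, ℂ)) : ℝ≥0∞ :=
  ⨅ w : Lp ℂ 2 (volume : Measure ℝ),
    homBesovNorm (-1 / 2) (T - Lp.toTemperedDistribution w)
      + ENNReal.ofReal (ε ^ (-1 / 2 : ℝ)) * ‖w‖ₑ

end KdV

end

/-! Put `τ = t ^ (1/3)` and `v y = τ ^ 2 * u (τ * y)`. Time becomes one, the equation reads `y v - 3
v'' + 9 v² = f`, the energy bounds have size `D ~ K ε τ` and the bootstrap bounds size `A₀ = M ε τ`.
The restriction on `t` says that `ε τ` is small depending on `M`; it serves only to make `A₀` small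
and `A₀² ≲ D`. What has to be shown is that the best `A` in `|v| ≤ A ⟨y⟩^(-1/4)`, `|v'| ≤ A
⟨y⟩^(1/4)` is at most a multiple of `D` not depending on `M`.

The norms enter only by duality. If `φ` and `φ'` have `L²` norms at most `a` and `b`, then `|∫ φ v|
≤ D (√(ab) + a)` and `|∫ φ' f| ≤ D √(ab)`: this is `WeakTests`, from `norm_apply_lp_le` and
`norm_apply_lp_deriv_le`. As the norms do not see the zero frequency, they are first paired with
test functions cut off in frequency; the decay of `u` allows the cutoff to be removed by dominated
convergence. Then `v` is mollified to a `C²` function `w` with almost the same bounds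
(`exists_tested`), for which the equation can be used pointwise on a large window.

The force is controlled on zero-mean functions only, so its averages over intervals need a separate
argument. Averages over comparable intervals differ by `O(D)`, and near the origin the average is
tied to `w` itself by integrating by parts (`exists_hump_le`). This gives a crude bound
(`exists_avg_le`) and, by passing through dyadic intervals, a logarithmic one (`exists_avg_le_log`),
the source of the logarithm in the elliptic region.

On the oscillatory side `y < 0`, pairing `w` with a cutoff of itself bounds `∫ w²` locally, pairing
the equation with the same function bounds `∫ w'²`, and the energy `3/2 w'² - y/2 w² - 3 w³`, with
derivative `-f w' - w²/2`, turns this into a pointwise bound (`exists_hyperbolic`). Each pairing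
pays one factor `D` and one factor `A`, so `w` is bounded by `√(D A)`. The same works at bounded `y`
(`exists_middle`). For large `y > 0` the operator is close to `-3 (∂ - k)(∂ + k)` with `3 k² = y`,
and the two first-order factors are integrated with exponentials; the contribution of `A` gains a
factor `1 / y` (`exists_elliptic`).

Together (`exists_improve`) `A` may be replaced by `C (√(D A) + D) + A/8`. The first term is
sublinear in `A` and the last is a contraction, so the infimum of the admissible `A` is `O(D)`
(`exists_bootstrap`). Inserting this in the elliptic estimate once more gives the second bound. -/

noncomputable section

namespace KdV

open Filter Topology

/-! ### Frequency cutoffs away from zero and infinity -/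

/-- A smooth bump function on the frequency line. -/
def bump : ContDiffBump (0 : ℝ) := ⟨1, 2, one_pos, one_lt_two⟩

lemma bump_contDiff : ContDiff ℝ (⊤ : ℕ∞) (bump : ℝ → ℝ) := bump.contDiff

lemma bump_hasCompactSupport : HasCompactSupport (bump : ℝ → ℝ) := bump.hasCompactSupport

/-- Smooth cutoff to the frequencies `1 / N ≲ |ξ| ≲ N`. -/
def annulus (N ξ : ℝ) : ℝ := bump (N⁻¹ * ξ) - bump (N * ξ)

lemma annulus_contDiff (N : ℝ) : ContDiff ℝ (⊤ : ℕ∞) (annulus N) :=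
  (bump_contDiff.comp (contDiff_const.mul contDiff_id)).sub
    (bump_contDiff.comp (contDiff_const.mul contDiff_id))

lemma abs_annulus_le (N ξ : ℝ) : |annulus N ξ| ≤ 1 := by
  have h1 := bump.nonneg (x := N⁻¹ * ξ)
  have h2 := bump.nonneg (x := N * ξ)
  have h3 := bump.le_one (x := N⁻¹ * ξ)
  have h4 := bump.le_one (x := N * ξ)
  rw [abs_le]; unfold annulus; constructor <;> linarith

lemma bump_eq_one {x : ℝ} (h : |x| ≤ 1) : bump x = 1 :=
  bump.one_of_mem_closedBall (by simpa [bump, Real.dist_eq] using h)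

lemma bump_eq_zero {x : ℝ} (h : 2 ≤ |x|) : bump x = 0 :=
  bump.zero_of_le_dist (by simpa [bump, Real.dist_eq] using h)

lemma annulus_eq_zero_of_small {N ξ : ℝ} (hN : 1 ≤ N) (h : |ξ| < N⁻¹) : annulus N ξ = 0 := by
  have hN0 : 0 < N := by linarith
  have h1 : |N * ξ| ≤ 1 := by
    rw [abs_mul, abs_of_pos hN0]
    have := mul_lt_mul_of_pos_left h hN0
    rw [mul_inv_cancel₀ hN0.ne'] at this; exact this.le
  have h2 : |N⁻¹ * ξ| ≤ 1 := by
    rw [abs_mul, abs_of_pos (inv_pos.2 hN0)]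
    have h3 : N⁻¹ ≤ 1 := inv_le_one_of_one_le₀ hN
    have : |ξ| ≤ 1 := h.le.trans h3
    have h4 := abs_nonneg ξ
    have := inv_pos.2 hN0
    nlinarith
  simp [annulus, bump_eq_one h1, bump_eq_one h2]

lemma annulus_eq_zero_of_large {N ξ : ℝ} (hN : 1 ≤ N) (h : 2 * N ≤ |ξ|) : annulus N ξ = 0 := by
  have hN0 : 0 < N := by linarith
  have h1 : 2 ≤ |N * ξ| := by
    rw [abs_mul, abs_of_pos hN0]; nlinarith
  have h2 : 2 ≤ |N⁻¹ * ξ| := by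
    rw [abs_mul, abs_of_pos (inv_pos.2 hN0), ← div_eq_inv_mul, le_div_iff₀ hN0]; exact h
  simp [annulus, bump_eq_zero h1, bump_eq_zero h2]

lemma annulus_hasCompactSupport {N : ℝ} (hN : 1 ≤ N) : HasCompactSupport (annulus N) := by
  refine HasCompactSupport.of_support_subset_isCompact (isCompact_closedBall (0 : ℝ) (2 * N)) ?_
  intro ξ hξ
  by_contra h
  refine hξ (annulus_eq_zero_of_large hN ?_)
  simp only [Metric.mem_closedBall, dist_zero_right, Real.norm_eq_abs, not_le] at h
  exact h.le

/-- Multiplication of a Schwartz function with `annulus N`; it is `0` for `N < 1`. -/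
def cut (N : ℝ) (H : 𝓢(ℝ, ℂ)) : 𝓢(ℝ, ℂ) :=
  if hN : 1 ≤ N then
    HasCompactSupport.toSchwartzMap (f := fun ξ => (annulus N ξ : ℂ) * H ξ)
      (((annulus_hasCompactSupport hN).comp_left Complex.ofReal_zero).mul_right)
      ((Complex.ofRealCLM.contDiff.comp (annulus_contDiff N)).mul (H.smooth ⊤))
  else 0

lemma cut_apply {N : ℝ} (hN : 1 ≤ N) (H : 𝓢(ℝ, ℂ)) (ξ : ℝ) :
    cut N H ξ = (annulus N ξ : ℂ) * H ξ := by
  simp only [cut, hN, dite_true]; rfl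

lemma cut_hasCompactSupport {N : ℝ} (hN : 1 ≤ N) (H : 𝓢(ℝ, ℂ)) :
    HasCompactSupport (cut N H) := by
  have : (cut N H : ℝ → ℂ) = fun ξ => (annulus N ξ : ℂ) * H ξ := funext (cut_apply hN H)
  rw [this]
  exact ((annulus_hasCompactSupport hN).comp_left Complex.ofReal_zero).mul_right

lemma zero_notMem_tsupport_cut {N : ℝ} (hN : 1 ≤ N) (H : 𝓢(ℝ, ℂ)) :
    (0 : ℝ) ∉ tsupport (cut N H) := by
  rw [notMem_tsupport_iff_eventuallyEq]
  have : Metric.ball (0 : ℝ) N⁻¹ ∈ 𝓝 (0 : ℝ) := Metric.ball_mem_nhds _ (inv_pos.2 (by linarith))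
  filter_upwards [this] with ξ hξ
  rw [cut_apply hN, annulus_eq_zero_of_small hN (by simpa using hξ)]; simp

lemma norm_cut_le {N : ℝ} (hN : 1 ≤ N) (H : 𝓢(ℝ, ℂ)) (ξ : ℝ) : ‖cut N H ξ‖ ≤ ‖H ξ‖ := by
  rw [cut_apply hN, norm_mul, Complex.norm_real, Real.norm_eq_abs]
  exact mul_le_of_le_one_left (norm_nonneg _) (abs_annulus_le N ξ)

lemma norm_fourier_le (G : 𝓢(ℝ, ℂ)) (x : ℝ) : ‖𝓕 G x‖ ≤ ∫ ξ, ‖G ξ‖ := by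
  rw [fourier_coe]
  exact VectorFourier.norm_fourierIntegral_le_integral_norm _ _ _ _ _

lemma norm_fourier_deriv (G : 𝓢(ℝ, ℂ)) (x : ℝ) :
    ‖𝓕 (derivCLM ℂ ℂ G) x‖ = 2 * Real.pi * |x| * ‖𝓕 G x‖ := by
  have h := congrFun (Real.fourier_deriv (f := (G : ℝ → ℂ)) G.integrable G.differentiable
    (derivCLM ℂ ℂ G).integrable) x
  have h2 : 𝓕 (derivCLM ℂ ℂ G) x = 𝓕 (deriv (G : ℝ → ℂ)) x := rfl
  rw [h2, h, norm_smul]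
  simp [fourier_coe, abs_of_pos Real.pi_pos]

/-- The cutoffs tend to one off the null set `{0}` and are dominated, so convergence holds in `L¹`
of the frequency, hence uniformly after the Fourier transform. -/
lemma tendsto_fourier_cut (H : 𝓢(ℝ, ℂ)) (x : ℝ) :
    Tendsto (fun n : ℕ => 𝓕 (cut (n + 1) H) x) atTop (𝓝 (𝓕 H x)) := by
  rw [tendsto_iff_norm_sub_tendsto_zero]
  have h1 : ∀ n : ℕ, ‖𝓕 (cut (n + 1) H) x - 𝓕 H x‖ ≤ ∫ ξ, ‖(cut (n + 1) H - H) ξ‖ := by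
    intro n
    have : 𝓕 (cut (n + 1) H) x - 𝓕 H x = 𝓕 (cut (n + 1) H - H) x := by
      have e : 𝓕 (cut (n + 1) H - H) = 𝓕 (cut (n + 1) H) - 𝓕 H := by
        rw [sub_eq_add_neg, FourierTransform.fourier_add, FourierTransform.fourier_neg,
          ← sub_eq_add_neg]
      rw [e]; rfl
    rw [this]; exact norm_fourier_le _ _
  refine squeeze_zero (fun _ => norm_nonneg _) h1 ?_
  have : (0 : ℝ) = ∫ _ξ : ℝ, (0 : ℝ) := by simp
  rw [this]
  refine tendsto_integral_of_dominated_convergence (fun ξ => 2 * ‖H ξ‖)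
    (fun n => ((cut (n + 1) H - H).continuous.norm).aestronglyMeasurable)
    (H.integrable.norm.const_mul 2) ?_ ?_
  · intro n
    refine Eventually.of_forall fun ξ => ?_
    rw [norm_norm, sub_apply]
    have := norm_sub_le (cut (n + 1) H ξ) (H ξ)
    have h2 := norm_cut_le (N := n + 1) (by simp) H ξ
    linarith
  · have : ∀ᵐ ξ : ℝ, ξ ≠ 0 := by simp [ae_iff]
    filter_upwards [this] with ξ hξ
    refine tendsto_const_nhds.congr' ?_
    have ht : Tendsto (fun n : ℕ => (n : ℝ) + 1) atTop atTop :=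
      tendsto_atTop_add_const_right _ _ tendsto_natCast_atTop_atTop
    filter_upwards [ht.eventually_ge_atTop |ξ|, ht.eventually_ge_atTop (2 * |ξ|⁻¹)] with n h1 h2
    have hn : (1 : ℝ) ≤ n + 1 := by simp
    have hn0 : (0 : ℝ) < n + 1 := by positivity
    have e1 : bump (((n : ℝ) + 1)⁻¹ * ξ) = 1 := by
      apply bump_eq_one
      rw [abs_mul, abs_of_pos (inv_pos.2 hn0), ← div_eq_inv_mul, div_le_one hn0]; exact h1
    have e2 : bump (((n : ℝ) + 1) * ξ) = 0 := by
      apply bump_eq_zero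
      rw [abs_mul, abs_of_pos hn0]
      rwa [← div_eq_mul_inv, div_le_iff₀ (abs_pos.2 hξ)] at h2
    rw [sub_apply, cut_apply hn, annulus, e1, e2]; simp

/-! ### Decay of the cut-off test functions, uniformly in the cutoff -/

/-- The first two derivatives of the cutoff. -/
def bump₁ : ℝ → ℝ := deriv bump
def bump₂ : ℝ → ℝ := deriv bump₁

lemma bump_hasDerivAt (x : ℝ) : HasDerivAt bump (bump₁ x) x :=
  (bump_contDiff.differentiable (by simp) x).hasDerivAt

lemma bump₁_contDiff : ContDiff ℝ (⊤ : ℕ∞) bump₁ := by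
  have : ContDiff ℝ ((⊤ : ℕ∞) + 1) (bump : ℝ → ℝ) := bump_contDiff
  exact (contDiff_succ_iff_deriv.1 this).2.2

lemma bump₁_hasDerivAt (x : ℝ) : HasDerivAt bump₁ (bump₂ x) x :=
  (bump₁_contDiff.differentiable (by simp) x).hasDerivAt

lemma bump₂_continuous : Continuous bump₂ := bump₁_contDiff.continuous_deriv (by simp)

lemma bump₁_hasCompactSupport : HasCompactSupport bump₁ := bump_hasCompactSupport.deriv

lemma bump₂_hasCompactSupport : HasCompactSupport bump₂ := bump₁_hasCompactSupport.deriv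

def annulus₁ (N ξ : ℝ) : ℝ := N⁻¹ * bump₁ (N⁻¹ * ξ) - N * bump₁ (N * ξ)
def annulus₂ (N ξ : ℝ) : ℝ := N⁻¹ * (N⁻¹ * bump₂ (N⁻¹ * ξ)) - N * (N * bump₂ (N * ξ))

lemma annulus_hasDerivAt (N ξ : ℝ) : HasDerivAt (annulus N) (annulus₁ N ξ) ξ := by
  have h : ∀ c : ℝ, HasDerivAt (fun ξ => bump (c * ξ)) (c * bump₁ (c * ξ)) ξ := fun c => by
    have := (bump_hasDerivAt (c * ξ)).comp ξ ((hasDerivAt_id ξ).const_mul c)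
    simpa [mul_comm, Function.comp_def] using this
  exact (h N⁻¹).sub (h N)

lemma annulus₁_hasDerivAt (N ξ : ℝ) : HasDerivAt (annulus₁ N) (annulus₂ N ξ) ξ := by
  have h : ∀ c : ℝ, HasDerivAt (fun ξ => c * bump₁ (c * ξ)) (c * (c * bump₂ (c * ξ))) ξ := fun c => by
    have := (bump₁_hasDerivAt (c * ξ)).comp ξ ((hasDerivAt_id ξ).const_mul c)
    simpa [mul_comm, Function.comp_def] using this.const_mul c
  exact (h N⁻¹).sub (h N)

lemma derivCLM_cut {N : ℝ} (hN : 1 ≤ N) (H : 𝓢(ℝ, ℂ)) (ξ : ℝ) :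
    derivCLM ℂ ℂ (cut N H) ξ
      = (annulus₁ N ξ : ℂ) * H ξ + (annulus N ξ : ℂ) * derivCLM ℂ ℂ H ξ := by
  rw [derivCLM_apply, derivCLM_apply]
  have : (cut N H : ℝ → ℂ) = fun ξ => (annulus N ξ : ℂ) * H ξ := funext (cut_apply hN H)
  rw [this]
  exact (((annulus_hasDerivAt N ξ).ofReal_comp).mul (H.hasDerivAt ξ)).deriv

lemma derivCLM_derivCLM_cut {N : ℝ} (hN : 1 ≤ N) (H : 𝓢(ℝ, ℂ)) (ξ : ℝ) :
    derivCLM ℂ ℂ (derivCLM ℂ ℂ (cut N H)) ξ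
      = (annulus₂ N ξ : ℂ) * H ξ + 2 * ((annulus₁ N ξ : ℂ) * derivCLM ℂ ℂ H ξ)
        + (annulus N ξ : ℂ) * derivCLM ℂ ℂ (derivCLM ℂ ℂ H) ξ := by
  rw [derivCLM_apply]
  have : (derivCLM ℂ ℂ (cut N H) : ℝ → ℂ) = fun ξ => (annulus₁ N ξ : ℂ) * H ξ
      + (annulus N ξ : ℂ) * derivCLM ℂ ℂ H ξ := funext (derivCLM_cut hN H)
  rw [this]
  have h1 := (((annulus₁_hasDerivAt N ξ).ofReal_comp).mul (H.hasDerivAt ξ))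
  have h2 := (((annulus_hasDerivAt N ξ).ofReal_comp).mul ((derivCLM ℂ ℂ H).hasDerivAt ξ))
  have h3 := (h1.add h2).deriv
  refine Eq.trans h3 ?_
  rw [derivCLM_apply, derivCLM_apply]; ring

/-- Mass of the low-frequency part of the derivatives of the cutoff. -/
lemma integral_scaled {κ : ℝ → ℝ} {N : ℝ} (hN : 1 ≤ N) :
    ∫ ξ, N * |κ (N * ξ)| = ∫ s, |κ s| := by
  rw [integral_const_mul, Measure.integral_comp_mul_left (fun s => |κ s|) N,
    abs_of_pos (by positivity), smul_eq_mul, ← mul_assoc, mul_inv_cancel₀ (by linarith), one_mul]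

lemma integrable_scaled {κ : ℝ → ℝ} (hκ : Continuous κ) (hs : HasCompactSupport κ)
    {N : ℝ} (hN : 1 ≤ N) : Integrable fun ξ => N * |κ (N * ξ)| := by
  have : Integrable κ := hκ.integrable_of_hasCompactSupport hs
  exact ((this.comp_mul_left' (by linarith)).norm).const_mul N

/-- At the low-frequency edge the derivative of the cutoff has size `N` on a set of length `1 / N`,
so its mass does not grow with `N`. -/
lemma exists_integral_annulus₁_le (H : 𝓢(ℝ, ℂ)) :
    ∃ C, ∀ N : ℝ, 1 ≤ N → Integrable (fun ξ => ‖(annulus₁ N ξ : ℂ) * H ξ‖) ∧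
      ∫ ξ, ‖(annulus₁ N ξ : ℂ) * H ξ‖ ≤ C := by
  obtain ⟨c, hc⟩ := bump₁_contDiff.continuous.bounded_above_of_compact_support
    bump₁_hasCompactSupport
  set S := SchwartzMap.seminorm ℂ 0 0 H
  have hS : ∀ ξ, ‖H ξ‖ ≤ S := fun ξ => H.norm_le_seminorm ℂ ξ
  refine ⟨c * (∫ ξ, ‖H ξ‖) + S * ∫ s, |bump₁ s|, fun N hN => ?_⟩
  have hN0 : 0 < N := by linarith
  have hle : ∀ ξ, ‖(annulus₁ N ξ : ℂ) * H ξ‖ ≤ c * ‖H ξ‖ + S * (N * |bump₁ (N * ξ)|) := by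
    intro ξ
    rw [norm_mul, Complex.norm_real, Real.norm_eq_abs]
    have h1 : |annulus₁ N ξ| ≤ c + N * |bump₁ (N * ξ)| := by
      unfold annulus₁
      refine (abs_sub _ _).trans ?_
      rw [abs_mul, abs_mul, abs_of_pos hN0, abs_of_pos (inv_pos.2 hN0)]
      have h2 := hc (N⁻¹ * ξ)
      rw [Real.norm_eq_abs] at h2
      have h3 : N⁻¹ ≤ 1 := inv_le_one_of_one_le₀ hN
      have h4 := abs_nonneg (bump₁ (N⁻¹ * ξ))
      have := mul_le_mul_of_nonneg_right h3 h4
      linarith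
    have h5 := mul_le_mul_of_nonneg_right h1 (norm_nonneg (H ξ))
    have h6 := mul_le_mul_of_nonneg_left (hS ξ) (by positivity : 0 ≤ N * |bump₁ (N * ξ)|)
    linarith
  have hint : Integrable fun ξ => c * ‖H ξ‖ + S * (N * |bump₁ (N * ξ)|) :=
    (H.integrable.norm.const_mul c).add ((integrable_scaled bump₁_contDiff.continuous
      bump₁_hasCompactSupport hN).const_mul S)
  have hcont : Continuous fun ξ => ‖(annulus₁ N ξ : ℂ) * H ξ‖ := by
    have : Continuous (annulus₁ N) := by
      have := bump₁_contDiff.continuous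
      unfold annulus₁; fun_prop
    have := H.continuous
    fun_prop
  have hint' := hint.mono' hcont.aestronglyMeasurable
    (Eventually.of_forall fun ξ => by rw [norm_norm]; exact hle ξ)
  refine ⟨hint', (integral_mono hint' hint hle).trans_eq ?_⟩
  rw [integral_add (H.integrable.norm.const_mul c) ((integrable_scaled bump₁_contDiff.continuous
      bump₁_hasCompactSupport hN).const_mul S), integral_const_mul, integral_const_mul,
      integral_scaled hN]

/-- The second derivative has size `N ^ 2` on a set of length `1 / N`. The surplus factor `N` is
absorbed by the zero of `H` at the origin, which gives `|H ξ| ≤ S |ξ|`. -/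
lemma exists_integral_annulus₂_le (H : 𝓢(ℝ, ℂ)) (h0 : H 0 = 0) :
    ∃ C, ∀ N : ℝ, 1 ≤ N → Integrable (fun ξ => ‖(annulus₂ N ξ : ℂ) * H ξ‖) ∧
      ∫ ξ, ‖(annulus₂ N ξ : ℂ) * H ξ‖ ≤ C := by
  obtain ⟨c, hc⟩ := bump₂_continuous.bounded_above_of_compact_support bump₂_hasCompactSupport
  set S := SchwartzMap.seminorm ℂ 0 0 (derivCLM ℂ ℂ H)
  have hS : ∀ ξ, ‖H ξ‖ ≤ S * |ξ| := fun ξ => by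
    have := Convex.norm_image_sub_le_of_norm_deriv_le (f := (H : ℝ → ℂ)) (C := S) (s := Set.univ)
      (x := 0) (y := ξ) (fun x _ => H.differentiableAt)
      (fun x _ => by rw [← derivCLM_apply ℂ H x]; exact norm_le_seminorm ℂ _ x) convex_univ trivial trivial
    simpa [h0] using this
  have hκ : Continuous fun s : ℝ => bump₂ s * s := bump₂_continuous.mul continuous_id
  have hκs : HasCompactSupport fun s : ℝ => bump₂ s * s := bump₂_hasCompactSupport.mul_right
  refine ⟨c * (∫ ξ, ‖H ξ‖) + S * ∫ s, |bump₂ s * s|, fun N hN => ?_⟩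
  have hN0 : 0 < N := by linarith
  have hle : ∀ ξ, ‖(annulus₂ N ξ : ℂ) * H ξ‖
      ≤ c * ‖H ξ‖ + S * (N * |bump₂ (N * ξ) * (N * ξ)|) := by
    intro ξ
    rw [norm_mul, Complex.norm_real, Real.norm_eq_abs]
    have h1 : |annulus₂ N ξ| ≤ c + N * (N * |bump₂ (N * ξ)|) := by
      unfold annulus₂
      refine (abs_sub _ _).trans ?_
      rw [abs_mul, abs_mul, abs_mul, abs_mul, abs_of_pos hN0, abs_of_pos (inv_pos.2 hN0)]
      have h2 := hc (N⁻¹ * ξ)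
      rw [Real.norm_eq_abs] at h2
      have h3 : N⁻¹ ≤ 1 := inv_le_one_of_one_le₀ hN
      have h4 := abs_nonneg (bump₂ (N⁻¹ * ξ))
      have h5 := mul_le_mul_of_nonneg_right h3 h4
      have h6 := mul_le_mul_of_nonneg_right h3 (by positivity : 0 ≤ N⁻¹ * |bump₂ (N⁻¹ * ξ)|)
      linarith
    have h5 := mul_le_mul_of_nonneg_right h1 (norm_nonneg (H ξ))
    have h6 := mul_le_mul_of_nonneg_left (hS ξ) (by positivity : 0 ≤ N * (N * |bump₂ (N * ξ)|))
    have h7 : N * |bump₂ (N * ξ) * (N * ξ)| = N * (N * |bump₂ (N * ξ)|) * |ξ| := by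
      rw [abs_mul, abs_mul, abs_of_pos hN0]; ring
    rw [h7]
    linarith
  have hint : Integrable fun ξ => c * ‖H ξ‖ + S * (N * |bump₂ (N * ξ) * (N * ξ)|) :=
    (H.integrable.norm.const_mul c).add ((integrable_scaled hκ hκs hN).const_mul S)
  have hcont : Continuous fun ξ => ‖(annulus₂ N ξ : ℂ) * H ξ‖ := by
    have : Continuous (annulus₂ N) := by
      have := bump₂_continuous
      unfold annulus₂; fun_prop
    have := H.continuous
    fun_prop
  have hint' := hint.mono' hcont.aestronglyMeasurable
    (Eventually.of_forall fun ξ => by rw [norm_norm]; exact hle ξ)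
  refine ⟨hint', (integral_mono hint' hint hle).trans_eq ?_⟩
  rw [integral_add (H.integrable.norm.const_mul c) ((integrable_scaled hκ hκs hN).const_mul S),
    integral_const_mul, integral_const_mul, integral_scaled (κ := fun s => bump₂ s * s) hN]

lemma norm_annulus_mul_le (N : ℝ) (H : 𝓢(ℝ, ℂ)) (ξ : ℝ) :
    ‖(annulus N ξ : ℂ) * H ξ‖ ≤ ‖H ξ‖ := by
  rw [norm_mul, Complex.norm_real, Real.norm_eq_abs]
  exact mul_le_of_le_one_left (norm_nonneg _) (abs_annulus_le N ξ)

/-- One frequency derivative is bounded in `L¹` uniformly in `N`, which is worth one power of `|x|`.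
A second power needs the vanishing of `H` at zero. -/
lemma exists_fourier_cut_le (H : 𝓢(ℝ, ℂ)) :
    ∃ C, ∀ N : ℝ, 1 ≤ N → ∀ x, ‖𝓕 (cut N H) x‖ ≤ C * (1 + |x|)⁻¹ := by
  obtain ⟨C1, h1⟩ := exists_integral_annulus₁_le H
  refine ⟨(∫ ξ, ‖H ξ‖) + (C1 + ∫ ξ, ‖derivCLM ℂ ℂ H ξ‖), fun N hN x => ?_⟩
  have a0 : ‖𝓕 (cut N H) x‖ ≤ ∫ ξ, ‖H ξ‖ := (norm_fourier_le _ _).trans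
    (integral_mono (cut N H).integrable.norm H.integrable.norm (norm_cut_le hN H))
  have a1 : |x| * ‖𝓕 (cut N H) x‖ ≤ C1 + ∫ ξ, ‖derivCLM ℂ ℂ H ξ‖ := by
    have e := norm_fourier_deriv (cut N H) x
    have b := norm_fourier_le (derivCLM ℂ ℂ (cut N H)) x
    have c : ∫ ξ, ‖derivCLM ℂ ℂ (cut N H) ξ‖ ≤ C1 + ∫ ξ, ‖derivCLM ℂ ℂ H ξ‖ := by
      have hi := (h1 N hN).1.add (derivCLM ℂ ℂ H).integrable.norm
      refine (integral_mono (derivCLM ℂ ℂ (cut N H)).integrable.norm hi fun ξ => ?_).trans ?_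
      · simp only [Pi.add_apply]
        rw [derivCLM_cut hN]
        exact (norm_add_le _ _).trans (add_le_add le_rfl (norm_annulus_mul_le N _ ξ))
      · simp only [Pi.add_apply]
        rw [integral_add (h1 N hN).1 (derivCLM ℂ ℂ H).integrable.norm]
        exact add_le_add (h1 N hN).2 le_rfl
    have := mul_nonneg (abs_nonneg x) (norm_nonneg (𝓕 (cut N H) x))
    have := Real.pi_gt_three
    nlinarith
  rw [← div_eq_mul_inv, le_div_iff₀ (by positivity)]
  linarith

lemma exists_fourier_cut_le_sq (H : 𝓢(ℝ, ℂ)) (h0 : H 0 = 0) :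
    ∃ C, ∀ N : ℝ, 1 ≤ N → ∀ x, ‖𝓕 (cut N H) x‖ ≤ C * (1 + x ^ 2)⁻¹ := by
  obtain ⟨C1, h1⟩ := exists_integral_annulus₁_le (derivCLM ℂ ℂ H)
  obtain ⟨C2, h2⟩ := exists_integral_annulus₂_le H h0
  refine ⟨(∫ ξ, ‖H ξ‖) + (C2 + 2 * C1 + ∫ ξ, ‖derivCLM ℂ ℂ (derivCLM ℂ ℂ H) ξ‖), fun N hN x => ?_⟩
  have a0 : ‖𝓕 (cut N H) x‖ ≤ ∫ ξ, ‖H ξ‖ := (norm_fourier_le _ _).trans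
    (integral_mono (cut N H).integrable.norm H.integrable.norm (norm_cut_le hN H))
  have a1 : x ^ 2 * ‖𝓕 (cut N H) x‖
      ≤ C2 + 2 * C1 + ∫ ξ, ‖derivCLM ℂ ℂ (derivCLM ℂ ℂ H) ξ‖ := by
    have e := norm_fourier_deriv (cut N H) x
    have e2 := norm_fourier_deriv (derivCLM ℂ ℂ (cut N H)) x
    have b := norm_fourier_le (derivCLM ℂ ℂ (derivCLM ℂ ℂ (cut N H))) x
    have c : ∫ ξ, ‖derivCLM ℂ ℂ (derivCLM ℂ ℂ (cut N H)) ξ‖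
        ≤ C2 + 2 * C1 + ∫ ξ, ‖derivCLM ℂ ℂ (derivCLM ℂ ℂ H) ξ‖ := by
      have hi12 := (h2 N hN).1.add ((h1 N hN).1.const_mul 2)
      have hi := hi12.add (derivCLM ℂ ℂ (derivCLM ℂ ℂ H)).integrable.norm
      refine (integral_mono (derivCLM ℂ ℂ (derivCLM ℂ ℂ (cut N H))).integrable.norm hi
        fun ξ => ?_).trans ?_
      · simp only [Pi.add_apply]
        rw [derivCLM_derivCLM_cut hN]
        refine (norm_add_le _ _).trans (add_le_add ((norm_add_le _ _).trans
          (add_le_add le_rfl ?_)) (norm_annulus_mul_le N _ ξ))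
        rw [norm_mul]; simp
      · rw [integral_add' hi12 (derivCLM ℂ ℂ (derivCLM ℂ ℂ H)).integrable.norm,
          integral_add' (h2 N hN).1 ((h1 N hN).1.const_mul 2), integral_const_mul]
        have := (h1 N hN).2
        have := (h2 N hN).2
        linarith
    rw [e2, e] at b
    have hx : 2 * Real.pi * |x| * (2 * Real.pi * |x| * ‖𝓕 (cut N H) x‖)
        = (2 * Real.pi) ^ 2 * (x ^ 2 * ‖𝓕 (cut N H) x‖) := by
      rw [← sq_abs x]; ring
    rw [hx] at b
    have := mul_nonneg (sq_nonneg x) (norm_nonneg (𝓕 (cut N H) x))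
    have hp := Real.pi_gt_three
    have : (1 : ℝ) ≤ (2 * Real.pi) ^ 2 := by nlinarith
    nlinarith
  rw [← div_eq_mul_inv, le_div_iff₀ (by positivity)]
  linarith

/-! ### Duality with the homogeneous norms -/

section

open LineDeriv

/-- Restriction of a Schwartz function to frequencies in a compact set away from zero. -/
def lp (N : ℝ) (Θ : 𝓢(ℝ, ℂ)) : 𝓢(ℝ, ℂ) := 𝓕 (cut N (𝓕⁻ Θ))

lemma derivCLM_eq_lineDeriv (f : 𝓢(ℝ, ℂ)) : derivCLM ℂ ℂ f = ∂_{(1 : ℝ)} f := by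
  ext x
  rw [derivCLM_apply, lineDerivOp_apply_eq_fderiv]; simp

lemma fourierInv_derivCLM (Θ : 𝓢(ℝ, ℂ)) (ξ : ℝ) :
    𝓕⁻ (derivCLM ℂ ℂ Θ) ξ = -(2 * Real.pi * Complex.I) * (ξ * 𝓕⁻ Θ ξ) := by
  have : (inner ℝ · (1 : ℝ)).HasTemperateGrowth := by fun_prop
  rw [derivCLM_eq_lineDeriv, fourierInv_lineDerivOp_eq, smul_apply, smulLeftCLM_apply_apply this]
  simp

/-- Both operations are Fourier multipliers. -/
lemma derivCLM_lp {N : ℝ} (hN : 1 ≤ N) (Θ : 𝓢(ℝ, ℂ)) :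
    derivCLM ℂ ℂ (lp N Θ) = lp N (derivCLM ℂ ℂ Θ) := by
  have : (inner ℝ · (1 : ℝ)).HasTemperateGrowth := by fun_prop
  unfold lp
  rw [derivCLM_eq_lineDeriv, lineDerivOp_fourier_eq]
  congr 1
  ext ξ
  rw [smul_apply, smulLeftCLM_apply_apply this, cut_apply hN, cut_apply hN, fourierInv_derivCLM]
  simp; ring

lemma tendsto_lp (Θ : 𝓢(ℝ, ℂ)) (x : ℝ) :
    Tendsto (fun n : ℕ => lp (n + 1) Θ x) atTop (𝓝 (Θ x)) := by
  have := tendsto_fourier_cut (𝓕⁻ Θ) x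
  rwa [FourierTransform.fourier_fourierInv_eq] at this

lemma integral_norm_sq_fourierInv (Θ : 𝓢(ℝ, ℂ)) : ∫ ξ, ‖𝓕⁻ Θ ξ‖ ^ 2 = ∫ x, ‖Θ x‖ ^ 2 := by
  have := integral_norm_sq_fourier (𝓕⁻ Θ)
  rw [FourierTransform.fourier_fourierInv_eq] at this
  exact this.symm

lemma integrable_norm_sq (Θ : 𝓢(ℝ, ℂ)) : Integrable fun x => ‖Θ x‖ ^ 2 :=
  (memLp_two_iff_integrable_sq_norm Θ.continuous.aestronglyMeasurable).1 (Θ.memLp 2)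

lemma integral_norm_sq_lp_le {N : ℝ} (hN : 1 ≤ N) (Θ : 𝓢(ℝ, ℂ)) :
    ∫ x, ‖lp N Θ x‖ ^ 2 ≤ ∫ x, ‖Θ x‖ ^ 2 := by
  unfold lp
  rw [integral_norm_sq_fourier, ← integral_norm_sq_fourierInv Θ]
  exact integral_mono (integrable_norm_sq _) (integrable_norm_sq _)
    fun ξ => pow_le_pow_left₀ (norm_nonneg _) (norm_cut_le hN _ ξ) 2

lemma integrable_one_add_abs {r : ℝ} (hr : 1 < r) : Integrable fun x : ℝ => (1 + |x|) ^ (-r) := by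
  simpa using integrable_one_add_norm (E := ℝ) (μ := volume) (r := r) (by simpa using hr)

/-- Pairing with a slowly decaying function passes to the limit. -/
lemma tendsto_integral_lp (Θ : 𝓢(ℝ, ℂ)) {g : ℝ → ℂ} (hg : AEStronglyMeasurable g) {M : ℝ}
    (hM : ∀ x, ‖g x‖ ≤ M * (1 + |x|) ^ (-1 / 4 : ℝ)) :
    Tendsto (fun n : ℕ => ∫ x, lp (n + 1) Θ x * g x) atTop (𝓝 (∫ x, Θ x * g x)) := by
  obtain ⟨C, hC⟩ := exists_fourier_cut_le (𝓕⁻ Θ)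
  -- The uniform kernel bound `1 / (1 + |x|)` alone is not integrable; the decay of `g` brings the
  -- exponent to `-5/4`.
  refine tendsto_integral_of_dominated_convergence (fun x => C * M * (1 + |x|) ^ (-(5 / 4) : ℝ))
    (fun n => (lp (n + 1) Θ).continuous.aestronglyMeasurable.mul hg)
    ((integrable_one_add_abs (by norm_num)).const_mul _) (fun n => Eventually.of_forall fun x => ?_)
    (Eventually.of_forall fun x => (tendsto_lp Θ x).mul_const _)
  rw [norm_mul]
  have h1 := hC (n + 1) (by simp) x
  have h2 := mul_le_mul h1 (hM x) (norm_nonneg _) ((norm_nonneg _).trans h1)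
  refine h2.trans_eq ?_
  have hx : (0 : ℝ) < 1 + |x| := by positivity
  have : (1 + |x|) ^ (-(5 / 4) : ℝ) = (1 + |x|)⁻¹ * (1 + |x|) ^ (-1 / 4 : ℝ) := by
    rw [← Real.rpow_neg_one, ← Real.rpow_add hx]; norm_num
  rw [this]; ring

/-- Pairing of a derivative with a growing function passes to the limit. -/
lemma tendsto_integral_lp_deriv (Θ : 𝓢(ℝ, ℂ)) {g : ℝ → ℂ} (hg : AEStronglyMeasurable g) {M : ℝ}
    (hM : ∀ x, ‖g x‖ ≤ M * (1 + |x|) ^ (3 / 4 : ℝ)) :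
    Tendsto (fun n : ℕ => ∫ x, lp (n + 1) (derivCLM ℂ ℂ Θ) x * g x) atTop
      (𝓝 (∫ x, derivCLM ℂ ℂ Θ x * g x)) := by
  -- A derivative has no zero frequency, so the decay is quadratic, and the growth `3/4` of `g`
  -- again leaves the exponent `-5/4`.
  obtain ⟨C, hC⟩ := exists_fourier_cut_le_sq (𝓕⁻ (derivCLM ℂ ℂ Θ)) (by rw [fourierInv_derivCLM]; simp)
  refine tendsto_integral_of_dominated_convergence
    (fun x => C * 2 * M * (1 + |x|) ^ (-(5 / 4) : ℝ))
    (fun n => (lp (n + 1) _).continuous.aestronglyMeasurable.mul hg)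
    ((integrable_one_add_abs (by norm_num)).const_mul _) (fun n => Eventually.of_forall fun x => ?_)
    (Eventually.of_forall fun x => (tendsto_lp _ x).mul_const _)
  rw [norm_mul]
  have h1 := hC (n + 1) (by simp) x
  have hx : (0 : ℝ) < 1 + |x| := by positivity
  have hC0 : 0 ≤ C := by
    have h3 := (norm_nonneg _).trans h1
    exact nonneg_of_mul_nonneg_left h3 (by positivity)
  have h3 : (1 + x ^ 2)⁻¹ ≤ 2 * ((1 + |x|) ^ 2)⁻¹ := by
    rw [← div_eq_mul_inv, inv_eq_one_div, div_le_div_iff₀ (by positivity) (by positivity)]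
    have := sq_abs x
    nlinarith [sq_nonneg (1 - |x|)]
  have h4 := h1.trans (mul_le_mul_of_nonneg_left h3 hC0)
  have h2 := mul_le_mul h4 (hM x) (norm_nonneg _) ((norm_nonneg _).trans h4)
  refine h2.trans_eq ?_
  have : (1 + |x|) ^ (-(5 / 4) : ℝ) = ((1 + |x|) ^ 2)⁻¹ * (1 + |x|) ^ (3 / 4 : ℝ) := by
    rw [← Real.rpow_natCast, ← Real.rpow_neg hx.le, ← Real.rpow_add hx]; norm_num
  rw [this]; ring

/-- The cutoff makes the frequency-side test function compactly supported away from zero, which is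
all that `IsFourierOffZero` can be tested with. -/
lemma apply_lp {T : 𝓢'(ℝ, ℂ)} {F : ℝ → ℂ} (hF : IsFourierOffZero T F) {N : ℝ} (hN : 1 ≤ N)
    (Θ : 𝓢(ℝ, ℂ)) : T (lp N Θ) = ∫ ξ, cut N (𝓕⁻ Θ) ξ * F ξ := by
  rw [← hF.2 _ (cut_hasCompactSupport hN _) (zero_notMem_tsupport_cut hN _)]
  rfl

lemma IsFourierOffZero.aemeasurable {T : 𝓢'(ℝ, ℂ)} {F : ℝ → ℂ} (hF : IsFourierOffZero T F) :
    AEMeasurable F := by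
  have := hF.1.aestronglyMeasurable
  rw [restrict_compl_singleton] at this
  exact this.aemeasurable

lemma enorm_apply_lp_le {T : 𝓢'(ℝ, ℂ)} {F : ℝ → ℂ} (hF : IsFourierOffZero T F) {N : ℝ}
    (hN : 1 ≤ N) (Θ : 𝓢(ℝ, ℂ)) : ‖T (lp N Θ)‖ₑ ≤ ∫⁻ ξ, ‖F ξ‖ₑ * ‖𝓕⁻ Θ ξ‖ₑ := by
  rw [apply_lp hF hN]
  refine (enorm_integral_le_lintegral_enorm _).trans (lintegral_mono fun ξ => ?_)
  rw [enorm_mul, mul_comm]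
  gcongr
  rw [← ofReal_norm, ← ofReal_norm]
  exact ENNReal.ofReal_le_ofReal (norm_cut_le hN _ ξ)

lemma lintegral_enorm_sq_fourierInv (Θ : 𝓢(ℝ, ℂ)) :
    ∫⁻ ξ, ‖𝓕⁻ Θ ξ‖ₑ ^ 2 = ENNReal.ofReal (∫ x, ‖Θ x‖ ^ 2) := by
  rw [← integral_norm_sq_fourierInv, ofReal_integral_eq_lintegral_ofReal (integrable_norm_sq _)
    (Eventually.of_forall fun _ => by positivity)]
  refine lintegral_congr fun ξ => ?_
  rw [ENNReal.ofReal_pow (norm_nonneg _), ofReal_norm]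

lemma lintegral_sq_rpow_le {Θ : 𝓢(ℝ, ℂ)} {a : ℝ} (ha : 0 ≤ a) (h : ∫ x, ‖Θ x‖ ^ 2 ≤ a ^ 2) :
    (∫⁻ ξ, ‖𝓕⁻ Θ ξ‖ₑ ^ 2) ^ (1 / 2 : ℝ) ≤ ENNReal.ofReal a := by
  rw [lintegral_enorm_sq_fourierInv, ENNReal.ofReal_rpow_of_nonneg (by positivity) (by norm_num)]
  refine ENNReal.ofReal_le_ofReal ?_
  rw [← Real.sqrt_eq_rpow, ← Real.sqrt_sq ha]
  exact Real.sqrt_le_sqrt h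

lemma lintegral_mul_le_sqrt {α : Type*} [MeasurableSpace α] {μ : Measure α} {f g : α → ℝ≥0∞}
    (hf : AEMeasurable f μ) (hg : AEMeasurable g μ) :
    ∫⁻ x, f x * g x ∂μ ≤ (∫⁻ x, f x ^ 2 ∂μ) ^ (1 / 2 : ℝ) * (∫⁻ x, g x ^ 2 ∂μ) ^ (1 / 2 : ℝ) := by
  have := ENNReal.lintegral_mul_le_Lp_mul_Lq μ Real.HolderConjugate.two_two hf hg
  simpa using this

lemma enorm_fourierInv_derivCLM (Θ : 𝓢(ℝ, ℂ)) (ξ : ℝ) :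
    ‖𝓕⁻ (derivCLM ℂ ℂ Θ) ξ‖ₑ = ENNReal.ofReal |2 * Real.pi * ξ| * ‖𝓕⁻ Θ ξ‖ₑ := by
  rw [fourierInv_derivCLM, ← ofReal_norm, ← ofReal_norm,
    ← ENNReal.ofReal_mul (abs_nonneg _)]
  congr 1
  simp [abs_mul]; ring

/-- Duality between `Ḣ^{1/2}` and derivatives. -/
lemma norm_apply_lp_deriv_le {T : 𝓢'(ℝ, ℂ)} {B a b : ℝ} (hT : homSobolevNorm (1 / 2) T < ENNReal.ofReal B)
    (hB : 0 ≤ B) (ha : 0 < a) (hb : 0 < b) {Θ : 𝓢(ℝ, ℂ)} (h1 : ∫ x, ‖Θ x‖ ^ 2 ≤ a ^ 2)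
    (h2 : ∫ x, ‖derivCLM ℂ ℂ Θ x‖ ^ 2 ≤ b ^ 2) {N : ℝ} (hN : 1 ≤ N) :
    ‖T (lp N (derivCLM ℂ ℂ Θ))‖ ≤ B * Real.sqrt (a * b) := by
  unfold homSobolevNorm at hT
  simp only [iInf_lt_iff] at hT
  obtain ⟨F, hF, hFB⟩ := hT
  set W : ℝ → ℝ≥0∞ := fun ξ => ENNReal.ofReal |2 * Real.pi * ξ|
  have hW : Measurable W := by fun_prop
  have hΨ : Measurable fun ξ => ‖𝓕⁻ Θ ξ‖ₑ := (𝓕⁻ Θ).continuous.measurable.enorm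
  have key : ∫⁻ ξ, ‖F ξ‖ₑ * ‖𝓕⁻ (derivCLM ℂ ℂ Θ) ξ‖ₑ ≤ ENNReal.ofReal (B * Real.sqrt (a * b)) := by
    -- The derivative contributes the weight `|2πξ|`; half of it goes to `F`, as the norm requires,
    -- and half to the test function.
    have e1 : ∫⁻ ξ, ‖F ξ‖ₑ * ‖𝓕⁻ (derivCLM ℂ ℂ Θ) ξ‖ₑ
        = ∫⁻ ξ, (W ξ ^ (1 / 2 : ℝ) * ‖F ξ‖ₑ) * (W ξ ^ (1 / 2 : ℝ) * ‖𝓕⁻ Θ ξ‖ₑ) := by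
      refine lintegral_congr fun ξ => ?_
      rw [enorm_fourierInv_derivCLM]
      have : W ξ = W ξ ^ (1 / 2 : ℝ) * W ξ ^ (1 / 2 : ℝ) := by
        rw [← ENNReal.rpow_add_of_nonneg _ _ (by norm_num) (by norm_num)]; norm_num
      change _ * (W ξ * _) = _
      nth_rw 1 [this]; ring
    have hsq : ∀ ξ, ∀ c : ℝ≥0∞, (W ξ ^ (1 / 2 : ℝ) * c) ^ 2 = W ξ * c ^ 2 := by
      intro ξ c
      rw [mul_pow, ← ENNReal.rpow_natCast (W ξ ^ (1 / 2 : ℝ)), ← ENNReal.rpow_mul]; norm_num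
    rw [e1]
    refine (lintegral_mul_le_sqrt ((hW.pow_const _).aemeasurable.mul hF.aemeasurable.enorm)
      ((hW.pow_const _).aemeasurable.mul hΨ.aemeasurable)).trans ?_
    simp only [Pi.mul_apply, hsq]
    rw [ENNReal.ofReal_mul hB]
    refine mul_le_mul' ?_ ?_
    · refine le_trans (le_of_eq ?_) hFB.le
      congr 1
      refine lintegral_congr fun ξ => ?_
      norm_num [W]
    -- The `Ḣ^{1/2}` norm of the test function is interpolated between `L²` and `Ḣ¹` by
    -- Cauchy–Schwarz.
    · have e2 : ∫⁻ ξ, W ξ * ‖𝓕⁻ Θ ξ‖ₑ ^ 2 = ∫⁻ ξ, ‖𝓕⁻ Θ ξ‖ₑ * ‖𝓕⁻ (derivCLM ℂ ℂ Θ) ξ‖ₑ := by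
        refine lintegral_congr fun ξ => ?_
        rw [enorm_fourierInv_derivCLM]; ring
      rw [e2]
      have := (lintegral_mul_le_sqrt hΨ.aemeasurable
        (𝓕⁻ (derivCLM ℂ ℂ Θ)).continuous.measurable.enorm.aemeasurable).trans
        (mul_le_mul' (lintegral_sq_rpow_le ha.le h1) (lintegral_sq_rpow_le hb.le h2))
      rw [Real.sqrt_eq_rpow, ← ENNReal.ofReal_rpow_of_nonneg (by positivity) (by norm_num),
        ENNReal.ofReal_mul ha.le]
      exact ENNReal.rpow_le_rpow this (by norm_num)
  have := (enorm_apply_lp_le hF hN (derivCLM ℂ ℂ Θ)).trans key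
  rwa [← ofReal_norm, ENNReal.ofReal_le_ofReal_iff (by positivity)] at this

/-- The dyadic frequency shells. -/
def shell (k : ℤ) : Set ℝ :=
  {ξ : ℝ | (2 : ℝ) ^ k ≤ |2 * Real.pi * ξ| ∧ |2 * Real.pi * ξ| < (2 : ℝ) ^ (k + 1)}

lemma measurableSet_shell (k : ℤ) : MeasurableSet (shell k) :=
  (measurableSet_le (f := fun _ : ℝ => (2 : ℝ) ^ k) (g := fun ξ : ℝ => |2 * Real.pi * ξ|)
    measurable_const (by fun_prop)).inter (measurableSet_lt (f := fun ξ : ℝ => |2 * Real.pi * ξ|)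
    (g := fun _ : ℝ => (2 : ℝ) ^ (k + 1)) (by fun_prop) measurable_const)

lemma iUnion_shell : ⋃ k, shell k = {0}ᶜ := by
  ext ξ
  simp only [Set.mem_iUnion, Set.mem_compl_iff, Set.mem_singleton_iff]
  constructor
  · rintro ⟨k, hk, -⟩ rfl
    have : (0 : ℝ) < 2 ^ k := by positivity
    simp at hk; linarith
  · intro h
    have : 0 < |2 * Real.pi * ξ| := by have := Real.pi_pos; positivity
    obtain ⟨k, hk⟩ := exists_mem_Ico_zpow this one_lt_two
    exact ⟨k, hk⟩

lemma summable_two_rpow_abs : Summable fun k : ℤ => (2 : ℝ) ^ (-(|(k : ℝ)| / 2)) := by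
  have h : Summable fun n : ℕ => (2 : ℝ) ^ (-((n : ℝ) / 2)) := by
    have : (fun n : ℕ => (2 : ℝ) ^ (-((n : ℝ) / 2))) = fun n : ℕ => ((2 : ℝ) ^ (-(1 / 2) : ℝ)) ^ n := by
      ext n
      rw [← Real.rpow_natCast, ← Real.rpow_mul (by norm_num)]; ring_nf
    rw [this]
    exact summable_geometric_of_lt_one (by positivity)
      (Real.rpow_lt_one_of_one_lt_of_neg one_lt_two (by norm_num))
  refine Summable.of_nat_of_neg ?_ ?_ <;> simpa using h

/-- Sum of the weights of the dyadic shells. -/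
def shellSum : ℝ := ∑' k : ℤ, (2 : ℝ) ^ (-(|(k : ℝ)| / 2))

lemma shellSum_nonneg : 0 ≤ shellSum := tsum_nonneg fun _ => by positivity

lemma tsum_shell_weight (j : ℤ) {c : ℝ} (hc : 0 ≤ c) :
    ∑' k : ℤ, ENNReal.ofReal (c * (2 : ℝ) ^ (-(|((k - j : ℤ) : ℝ)| / 2)))
      = ENNReal.ofReal (c * shellSum) := by
  refine ((Equiv.subRight j).tsum_eq
    (fun k : ℤ => ENNReal.ofReal (c * (2 : ℝ) ^ (-(|(k : ℝ)| / 2))))).trans ?_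
  rw [← ENNReal.ofReal_tsum_of_nonneg (fun _ => by positivity) (summable_two_rpow_abs.mul_left c),
    tsum_mul_left]
  rfl

/-- The two entries balance at `2 ^ k ≈ b / a`, where both are about `√(ab)`; away from there the
first decays for small `k` and the second for large `k`. The factor `√2` pays for rounding `b / a`
to a power of two. -/
lemma min_weight_le {a b : ℝ} (ha : 0 < a) (hb : 0 < b) {j k : ℤ} (h1 : (2 : ℝ) ^ j ≤ b / a)
    (h2 : b / a < (2 : ℝ) ^ (j + 1)) :
    min ((2 : ℝ) ^ ((k : ℝ) / 2) * a) ((2 : ℝ) ^ (-((k : ℝ) / 2)) * b)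
      ≤ Real.sqrt 2 * Real.sqrt (a * b) * (2 : ℝ) ^ (-(|((k - j : ℤ) : ℝ)| / 2)) := by
  have hs2 : Real.sqrt 2 = (2 : ℝ) ^ (1 / 2 : ℝ) := Real.sqrt_eq_rpow 2
  have hs : 1 ≤ Real.sqrt 2 := Real.one_le_sqrt.2 one_le_two
  have hab := Real.sqrt_nonneg (a * b)
  rcases le_or_gt k j with hk | hk
  · refine (min_le_left _ _).trans ?_
    have hkj : |((k - j : ℤ) : ℝ)| = (j : ℝ) - k := by
      push_cast; rw [abs_of_nonpos] <;> [skip; (have : (k : ℝ) ≤ j := by exact_mod_cast hk)] <;>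
        [ring; linarith]
    have e : (2 : ℝ) ^ ((k : ℝ) / 2) = (2 : ℝ) ^ ((j : ℝ) / 2) * (2 : ℝ) ^ (-(((j : ℝ) - k) / 2)) := by
      rw [← Real.rpow_add two_pos]; ring_nf
    have f : (2 : ℝ) ^ ((j : ℝ) / 2) * a ≤ Real.sqrt (a * b) := by
      refine Real.le_sqrt_of_sq_le ?_
      have : ((2 : ℝ) ^ ((j : ℝ) / 2)) ^ 2 = (2 : ℝ) ^ j := by
        rw [← Real.rpow_natCast, ← Real.rpow_mul (by norm_num), ← Real.rpow_intCast]; norm_num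
      rw [mul_pow, this]
      rw [le_div_iff₀ ha] at h1
      nlinarith
    rw [hkj, e]
    have hp : 0 ≤ (2 : ℝ) ^ (-(((j : ℝ) - k) / 2)) := by positivity
    have f2 : (2 : ℝ) ^ ((j : ℝ) / 2) * a ≤ Real.sqrt 2 * Real.sqrt (a * b) := by nlinarith
    have := mul_le_mul_of_nonneg_right f2 hp
    linarith
  · refine (min_le_right _ _).trans ?_
    have hkj : |((k - j : ℤ) : ℝ)| = (k : ℝ) - j := by
      push_cast; rw [abs_of_nonneg]; have : (j : ℝ) < k := by exact_mod_cast hk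
      linarith
    have e : (2 : ℝ) ^ (-((k : ℝ) / 2))
        = (2 : ℝ) ^ (-((j : ℝ) / 2)) * (2 : ℝ) ^ (-(((k : ℝ) - j) / 2)) := by
      rw [← Real.rpow_add two_pos]; ring_nf
    have f : (2 : ℝ) ^ (-((j : ℝ) / 2)) * b ≤ Real.sqrt 2 * Real.sqrt (a * b) := by
      rw [← Real.sqrt_mul two_pos.le]
      refine Real.le_sqrt_of_sq_le ?_
      have : ((2 : ℝ) ^ (-((j : ℝ) / 2))) ^ 2 = ((2 : ℝ) ^ j)⁻¹ := by
        rw [← Real.rpow_natCast, ← Real.rpow_mul (by norm_num), ← Real.rpow_intCast,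
          ← Real.rpow_neg two_pos.le]; norm_num
      rw [mul_pow, this, inv_mul_le_iff₀ (by positivity)]
      rw [div_lt_iff₀ ha, zpow_add_one₀ two_ne_zero] at h2
      nlinarith
    rw [hkj, e]
    have hp : 0 ≤ (2 : ℝ) ^ (-(((k : ℝ) - j) / 2)) := by positivity
    have := mul_le_mul_of_nonneg_right f hp
    linarith

/-- Duality between `Ḃ^{-1/2}_{2,∞}` and `(L², Ḣ¹)_{1/2,1}`. -/
lemma norm_apply_lp_le {T : 𝓢'(ℝ, ℂ)} {B a b : ℝ} (hT : homBesovNorm (-1 / 2) T < ENNReal.ofReal B)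
    (hB : 0 ≤ B) (ha : 0 < a) (hb : 0 < b) {Θ : 𝓢(ℝ, ℂ)} (h1 : ∫ x, ‖Θ x‖ ^ 2 ≤ a ^ 2)
    (h2 : ∫ x, ‖derivCLM ℂ ℂ Θ x‖ ^ 2 ≤ b ^ 2) {N : ℝ} (hN : 1 ≤ N) :
    ‖T (lp N Θ)‖ ≤ B * (Real.sqrt 2 * shellSum) * Real.sqrt (a * b) := by
  unfold homBesovNorm at hT
  simp only [iInf_lt_iff] at hT
  obtain ⟨F, hF, hFB⟩ := hT
  have hshell : ∀ k : ℤ, (∫⁻ ξ in shell k, ‖F ξ‖ₑ ^ 2) ^ (1 / 2 : ℝ)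
      ≤ ENNReal.ofReal ((2 : ℝ) ^ ((k : ℝ) / 2) * B) := by
    intro k
    have := (le_iSup (fun k : ℤ => ENNReal.ofReal ((2 : ℝ) ^ ((-1 / 2) * (k : ℝ))) *
      (∫⁻ ξ in shell k, ‖F ξ‖ₑ ^ 2) ^ (1 / 2 : ℝ)) k).trans hFB.le
    have h3 := mul_le_mul_right this (ENNReal.ofReal ((2 : ℝ) ^ ((k : ℝ) / 2)))
    rw [← mul_assoc, ← ENNReal.ofReal_mul (by positivity), ← ENNReal.ofReal_mul (by positivity),
      ← Real.rpow_add two_pos] at h3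
    ring_nf at h3 ⊢
    simpa using h3
  have hΨ : Measurable fun ξ => ‖𝓕⁻ Θ ξ‖ₑ := (𝓕⁻ Θ).continuous.measurable.enorm
  have hΨa : ∀ k, (∫⁻ ξ in shell k, ‖𝓕⁻ Θ ξ‖ₑ ^ 2) ^ (1 / 2 : ℝ) ≤ ENNReal.ofReal a := fun k =>
    (ENNReal.rpow_le_rpow (setLIntegral_le_lintegral _ _) (by norm_num)).trans
      (lintegral_sq_rpow_le ha.le h1)
  have hΨb : ∀ k : ℤ, (∫⁻ ξ in shell k, ‖𝓕⁻ Θ ξ‖ₑ ^ 2) ^ (1 / 2 : ℝ)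
      ≤ ENNReal.ofReal ((2 : ℝ) ^ (-k) * b) := fun k => by
    rw [ENNReal.ofReal_mul (by positivity)]
    have h3 : ∫⁻ ξ in shell k, ‖𝓕⁻ Θ ξ‖ₑ ^ 2
        ≤ ENNReal.ofReal ((2 : ℝ) ^ (-k)) ^ 2 * ∫⁻ ξ, ‖𝓕⁻ (derivCLM ℂ ℂ Θ) ξ‖ₑ ^ 2 := by
      rw [← lintegral_const_mul _ (by
        exact ((𝓕⁻ (derivCLM ℂ ℂ Θ)).continuous.measurable.enorm.pow_const 2))]
      refine (setLIntegral_mono_ae' (measurableSet_shell k) (Eventually.of_forall ?_)).trans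
        (setLIntegral_le_lintegral _ _)
      intro ξ hξ
      rw [← mul_pow, enorm_fourierInv_derivCLM, ← mul_assoc, ← ENNReal.ofReal_mul (by positivity)]
      gcongr
      refine le_mul_of_one_le_left' ?_
      rw [← ENNReal.ofReal_one]
      refine ENNReal.ofReal_le_ofReal ?_
      rw [zpow_neg, ← div_eq_inv_mul, le_div_iff₀ (by positivity), one_mul]
      exact hξ.1
    refine (ENNReal.rpow_le_rpow h3 (by norm_num)).trans ?_
    rw [ENNReal.mul_rpow_of_nonneg _ _ (by norm_num), ← ENNReal.rpow_natCast, ← ENNReal.rpow_mul]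
    refine mul_le_mul' (by norm_num) (lintegral_sq_rpow_le hb.le h2)
  -- On each shell the test function is bounded by the better of its `L²` and `Ḣ¹` norms. The shell
  -- of frequency `b / a` dominates, and the sum over the others is geometric.
  obtain ⟨j, hj1, hj2⟩ := exists_mem_Ico_zpow (div_pos hb ha) one_lt_two
  have key : ∫⁻ ξ, ‖F ξ‖ₑ * ‖𝓕⁻ Θ ξ‖ₑ
      ≤ ENNReal.ofReal (B * (Real.sqrt 2 * shellSum) * Real.sqrt (a * b)) := by
    rw [← restrict_compl_singleton (μ := volume) (0 : ℝ), ← iUnion_shell]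
    refine (lintegral_iUnion_le _ _).trans ?_
    have e : B * (Real.sqrt 2 * shellSum) * Real.sqrt (a * b)
        = (B * (Real.sqrt 2 * Real.sqrt (a * b))) * shellSum := by ring
    rw [e, ← tsum_shell_weight j (by positivity)]
    refine ENNReal.tsum_le_tsum fun k => ?_
    refine (lintegral_mul_le_sqrt hF.aemeasurable.enorm.restrict hΨ.aemeasurable).trans ?_
    have h5 : (∫⁻ ξ in shell k, ‖𝓕⁻ Θ ξ‖ₑ ^ 2) ^ (1 / 2 : ℝ)
        ≤ ENNReal.ofReal (min a ((2 : ℝ) ^ (-k) * b)) := by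
      rcases min_choice a ((2 : ℝ) ^ (-k) * b) with h | h <;> rw [h]
      exacts [hΨa k, hΨb k]
    refine (mul_le_mul' (hshell k) h5).trans ?_
    rw [← ENNReal.ofReal_mul (by positivity)]
    refine ENNReal.ofReal_le_ofReal ?_
    have h6 := min_weight_le (k := k) ha hb hj1 hj2
    have h7 : (2 : ℝ) ^ ((k : ℝ) / 2) * min a ((2 : ℝ) ^ (-k) * b)
        = min ((2 : ℝ) ^ ((k : ℝ) / 2) * a) ((2 : ℝ) ^ (-((k : ℝ) / 2)) * b) := by
      rw [mul_min_of_nonneg _ _ (by positivity), ← mul_assoc, ← Real.rpow_intCast,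
        ← Real.rpow_add two_pos]
      congr 3; push_cast; ring
    have h8 := mul_le_mul_of_nonneg_left (h7.trans_le h6) hB
    linarith
  have := (enorm_apply_lp_le hF hN Θ).trans key
  have hs := shellSum_nonneg
  rwa [← ofReal_norm, ENNReal.ofReal_le_ofReal_iff (by positivity)] at this

end

/-! ### The energy bounds on real test functions -/

/-- A real test function as a complex Schwartz function. -/
def toC {φ : ℝ → ℝ} (h : ContDiff ℝ (⊤ : ℕ∞) φ) (hs : HasCompactSupport φ) : 𝓢(ℝ, ℂ) :=
  HasCompactSupport.toSchwartzMap (f := fun x => (φ x : ℂ))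
    (hs.comp_left Complex.ofReal_zero) (Complex.ofRealCLM.contDiff.comp h)

lemma toC_apply {φ : ℝ → ℝ} (h : ContDiff ℝ (⊤ : ℕ∞) φ) (hs : HasCompactSupport φ) (x : ℝ) :
    toC h hs x = (φ x : ℂ) := rfl

lemma contDiff_deriv {φ : ℝ → ℝ} (h : ContDiff ℝ (⊤ : ℕ∞) φ) :
    ContDiff ℝ (⊤ : ℕ∞) (deriv φ) := by
  have : ContDiff ℝ ((⊤ : ℕ∞) + 1) φ := h
  exact (contDiff_succ_iff_deriv.1 this).2.2

lemma derivCLM_toC {φ : ℝ → ℝ} (h : ContDiff ℝ (⊤ : ℕ∞) φ) (hs : HasCompactSupport φ) :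
    derivCLM ℂ ℂ (toC h hs) = toC (contDiff_deriv h) hs.deriv := by
  ext x
  rw [derivCLM_apply, toC_apply]
  exact ((h.differentiable (by simp) x).hasDerivAt.ofReal_comp).deriv

lemma integral_norm_sq_toC {φ : ℝ → ℝ} (h : ContDiff ℝ (⊤ : ℕ∞) φ) (hs : HasCompactSupport φ) :
    ∫ x, ‖toC h hs x‖ ^ 2 = ∫ x, φ x ^ 2 := by
  simp [toC_apply]

lemma integral_toC_mul {φ : ℝ → ℝ} (h : ContDiff ℝ (⊤ : ℕ∞) φ) (hs : HasCompactSupport φ)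
    (g : ℝ → ℝ) : ∫ x, toC h hs x * (g x : ℂ) = ((∫ x, φ x * g x : ℝ) : ℂ) := by
  rw [← integral_complex_ofReal]; simp [toC_apply]

lemma one_add_abs_rpow_le_one (x : ℝ) : (1 + |x|) ^ (-1 / 4 : ℝ) ≤ 1 :=
  Real.rpow_le_one_of_one_le_of_nonpos (by linarith [abs_nonneg x]) (by norm_num)

lemma memLp_top_of_decay {g : ℝ → ℂ} (hg : AEStronglyMeasurable g) {M : ℝ}
    (hM : ∀ x, ‖g x‖ ≤ M * (1 + |x|) ^ (-1 / 4 : ℝ)) : MemLp g ∞ := by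
  have hM0 : 0 ≤ M := by simpa using (norm_nonneg _).trans (hM 0)
  exact memLp_top_of_bound hg M (Eventually.of_forall fun x =>
    (hM x).trans (mul_le_of_le_one_right hM0 (one_add_abs_rpow_le_one x)))

lemma norm_integral_mul_le (ψ : 𝓢(ℝ, ℂ)) (w : Lp ℂ 2 (volume : Measure ℝ)) {a : ℝ} (ha : 0 ≤ a)
    (h : ∫ x, ‖ψ x‖ ^ 2 ≤ a ^ 2) : ‖∫ x, ψ x * w x‖ ≤ a * ‖w‖ := by
  have h1 : ‖∫ x, ψ x * w x‖ₑ ≤ ENNReal.ofReal a * ‖w‖ₑ := by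
    refine (enorm_integral_le_lintegral_enorm _).trans ?_
    simp_rw [enorm_mul]
    refine (lintegral_mul_le_sqrt ψ.continuous.measurable.enorm.aemeasurable
      (Lp.aestronglyMeasurable w).enorm).trans (mul_le_mul' ?_ (le_of_eq ?_))
    · have e : ∫⁻ x, ‖ψ x‖ₑ ^ 2 = ENNReal.ofReal (∫ x, ‖ψ x‖ ^ 2) := by
        rw [ofReal_integral_eq_lintegral_ofReal (integrable_norm_sq _)
          (Eventually.of_forall fun _ => by positivity)]
        refine lintegral_congr fun ξ => ?_
        rw [ENNReal.ofReal_pow (norm_nonneg _), ofReal_norm]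
      rw [e, ENNReal.ofReal_rpow_of_nonneg (by positivity) (by norm_num)]
      refine ENNReal.ofReal_le_ofReal ?_
      rw [← Real.sqrt_eq_rpow, ← Real.sqrt_sq ha]
      exact Real.sqrt_le_sqrt h
    · rw [Lp.enorm_def, eLpNorm_eq_lintegral_rpow_enorm_toReal (by simp) (by simp)]
      norm_num
  rwa [← ofReal_norm, ← ofReal_norm, ← ENNReal.ofReal_mul ha,
    ENNReal.ofReal_le_ofReal_iff (by positivity)] at h1

/-- The Besov bound, tested against real test functions. -/
lemma abs_integral_mul_le_of_besov {ε B M : ℝ} (hε : 0 < ε) (hB : 0 ≤ B) {u : ℝ → ℝ}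
    (hu : Measurable u) (hM : ∀ x, |u x| ≤ M * (1 + |x|) ^ (-1 / 4 : ℝ))
    (hT : besovSumNorm ε (toDist fun x => (u x : ℂ)) < ENNReal.ofReal B)
    {φ : ℝ → ℝ} (h : ContDiff ℝ (⊤ : ℕ∞) φ) (hs : HasCompactSupport φ) {a b : ℝ} (ha : 0 < a)
    (hb : 0 < b) (h1 : ∫ x, φ x ^ 2 ≤ a ^ 2) (h2 : ∫ x, deriv φ x ^ 2 ≤ b ^ 2) :
    |∫ x, φ x * u x|
      ≤ B * (Real.sqrt 2 * shellSum) * Real.sqrt (a * b) + B * ε ^ (1 / 2 : ℝ) * a := by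
  have hum : AEStronglyMeasurable (fun x => (u x : ℂ)) :=
    (Complex.measurable_ofReal.comp hu).aestronglyMeasurable
  have hM' : ∀ x, ‖(u x : ℂ)‖ ≤ M * (1 + |x|) ^ (-1 / 4 : ℝ) := fun x => by
    rw [Complex.norm_real]; exact hM x
  unfold besovSumNorm at hT
  rw [iInf_lt_iff] at hT
  obtain ⟨w, hw⟩ := hT
  have hw1 := (le_self_add).trans_lt hw
  have hw2 : ‖w‖ ≤ B * ε ^ (1 / 2 : ℝ) := by
    have := (le_add_self).trans hw.le
    rw [← ofReal_norm, ← ENNReal.ofReal_mul (by positivity),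
      ENNReal.ofReal_le_ofReal_iff hB] at this
    have h3 := mul_le_mul_of_nonneg_right this (by positivity : 0 ≤ ε ^ (1 / 2 : ℝ))
    have h4 : ε ^ (-1 / 2 : ℝ) * ‖w‖ * ε ^ (1 / 2 : ℝ) = ‖w‖ := by
      rw [mul_right_comm, ← Real.rpow_add hε]; norm_num
    rwa [h4] at h3
  set Θ := toC h hs
  have hΘ1 : ∫ x, ‖Θ x‖ ^ 2 ≤ a ^ 2 := by rwa [integral_norm_sq_toC]
  have hΘ2 : ∫ x, ‖derivCLM ℂ ℂ Θ x‖ ^ 2 ≤ b ^ 2 := by rwa [derivCLM_toC, integral_norm_sq_toC]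
  have key : ∀ n : ℕ, ‖∫ x, lp (n + 1) Θ x * (u x : ℂ)‖
      ≤ B * (Real.sqrt 2 * shellSum) * Real.sqrt (a * b) + B * ε ^ (1 / 2 : ℝ) * a := by
    intro n
    have hn : (1 : ℝ) ≤ n + 1 := by simp
    have e1 := norm_apply_lp_le hw1 hB ha hb hΘ1 hΘ2 hn
    have e2 := norm_integral_mul_le (lp (n + 1) Θ) w ha.le
      ((integral_norm_sq_lp_le hn Θ).trans hΘ1)
    have e3 : (toDist (fun x => (u x : ℂ)) - Lp.toTemperedDistribution w) (lp (n + 1) Θ)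
        = (∫ x, lp (n + 1) Θ x * (u x : ℂ)) - ∫ x, lp (n + 1) Θ x * w x := by
      have : (toDist (fun x => (u x : ℂ)) - Lp.toTemperedDistribution w) (lp (n + 1) Θ)
        = toDist (fun x => (u x : ℂ)) (lp (n + 1) Θ) - Lp.toTemperedDistribution w (lp (n + 1) Θ) := rfl
      rw [this, toDist_apply (memLp_top_of_decay hum hM'), Lp.toTemperedDistribution_apply]
      simp only [smul_eq_mul]
    rw [e3] at e1
    have e4 := norm_sub_norm_le (∫ x, lp (n + 1) Θ x * (u x : ℂ)) (∫ x, lp (n + 1) Θ x * w x)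
    have e5 := mul_le_mul_of_nonneg_left hw2 ha.le
    linarith
  have := le_of_tendsto (tendsto_integral_lp Θ hum hM').norm (Eventually.of_forall key)
  rwa [integral_toC_mul, Complex.norm_real] at this

lemma LNL_apply {t M : ℝ} {u : ℝ → ℝ} (hu : Measurable u)
    (hM : ∀ x, |u x| ≤ M * (1 + |x|) ^ (-1 / 4 : ℝ)) (ψ : 𝓢(ℝ, ℂ)) :
    LNL t u ψ = (∫ x, ψ x * ((x * u x : ℝ) : ℂ))
      - ((3 * t : ℝ) : ℂ) * (∫ x, derivCLM ℂ ℂ (derivCLM ℂ ℂ ψ) x * (u x : ℂ))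
      + ((9 * t : ℝ) : ℂ) * ∫ x, ψ x * ((u x ^ 2 : ℝ) : ℂ) := by
  have hum : AEStronglyMeasurable (fun x => (u x : ℂ)) :=
    (Complex.measurable_ofReal.comp hu).aestronglyMeasurable
  have hum2 : AEStronglyMeasurable (fun x => ((u x ^ 2 : ℝ) : ℂ)) :=
    (Complex.measurable_ofReal.comp (hu.pow_const 2)).aestronglyMeasurable
  have hM' : ∀ x, ‖(u x : ℂ)‖ ≤ M * (1 + |x|) ^ (-1 / 4 : ℝ) := fun x => by
    rw [Complex.norm_real]; exact hM x
  have hM0 : 0 ≤ M := by simpa using (abs_nonneg _).trans (hM 0)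
  have hM2 : ∀ x, ‖((u x ^ 2 : ℝ) : ℂ)‖ ≤ M ^ 2 * (1 + |x|) ^ (-1 / 4 : ℝ) := fun x => by
    rw [Complex.norm_real, Real.norm_eq_abs, abs_pow]
    have h1 := one_add_abs_rpow_le_one x
    have h0 : 0 ≤ (1 + |x|) ^ (-1 / 4 : ℝ) := by positivity
    have := mul_le_mul (hM x) ((hM x).trans (mul_le_of_le_one_right hM0 h1)) (abs_nonneg _) (by positivity)
    nlinarith
  have hx : (fun x : ℝ => (x : ℂ)).HasTemperateGrowth := by fun_prop
  have e1 : TemperedDistribution.smulLeftCLM ℂ (fun x : ℝ => (x : ℂ)) (toDist fun x => (u x : ℂ)) ψ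
      = ∫ x, ψ x * ((x * u x : ℝ) : ℂ) := by
    rw [TemperedDistribution.smulLeftCLM_apply_apply, toDist_apply (memLp_top_of_decay hum hM')]
    refine integral_congr_ae (Eventually.of_forall fun x => ?_)
    simp only [smulLeftCLM_apply_apply hx, smul_eq_mul]
    push_cast; ring
  have e2 : TemperedDistribution.derivCLM ℂ (TemperedDistribution.derivCLM ℂ
      (toDist fun x => (u x : ℂ))) ψ
      = ∫ x, derivCLM ℂ ℂ (derivCLM ℂ ℂ ψ) x * (u x : ℂ) := by
    rw [TemperedDistribution.derivCLM_apply_apply, TemperedDistribution.derivCLM_apply_apply,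
      map_neg, map_neg, map_neg, neg_neg, toDist_apply (memLp_top_of_decay hum hM')]
  rw [← e1, ← e2, ← toDist_apply (memLp_top_of_decay hum2 hM2)]
  rfl

/-- The Sobolev bound, tested against derivatives of real test functions. -/
lemma abs_integral_mul_le_of_sobolev {t B M : ℝ} (hB : 0 ≤ B) {u : ℝ → ℝ}
    (hu : Measurable u) (hM : ∀ x, |u x| ≤ M * (1 + |x|) ^ (-1 / 4 : ℝ))
    (hT : homSobolevNorm (1 / 2) (LNL t u) < ENNReal.ofReal B)
    {φ : ℝ → ℝ} (h : ContDiff ℝ (⊤ : ℕ∞) φ) (hs : HasCompactSupport φ) {a b : ℝ} (ha : 0 < a)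
    (hb : 0 < b) (h1 : ∫ x, φ x ^ 2 ≤ a ^ 2) (h2 : ∫ x, deriv φ x ^ 2 ≤ b ^ 2) :
    |(∫ x, deriv φ x * (x * u x)) - 3 * t * (∫ x, deriv (deriv (deriv φ)) x * u x)
      + 9 * t * ∫ x, deriv φ x * u x ^ 2| ≤ B * Real.sqrt (a * b) := by
  have hum : AEStronglyMeasurable (fun x => (u x : ℂ)) :=
    (Complex.measurable_ofReal.comp hu).aestronglyMeasurable
  have hum1 : AEStronglyMeasurable (fun x => ((x * u x : ℝ) : ℂ)) :=
    (Complex.measurable_ofReal.comp (measurable_id.mul hu)).aestronglyMeasurable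
  have hum2 : AEStronglyMeasurable (fun x => ((u x ^ 2 : ℝ) : ℂ)) :=
    (Complex.measurable_ofReal.comp (hu.pow_const 2)).aestronglyMeasurable
  have hM' : ∀ x, ‖(u x : ℂ)‖ ≤ M * (1 + |x|) ^ (-1 / 4 : ℝ) := fun x => by
    rw [Complex.norm_real]; exact hM x
  have hM0 : 0 ≤ M := by simpa using (abs_nonneg _).trans (hM 0)
  have hM2 : ∀ x, ‖((u x ^ 2 : ℝ) : ℂ)‖ ≤ M ^ 2 * (1 + |x|) ^ (-1 / 4 : ℝ) := fun x => by
    rw [Complex.norm_real, Real.norm_eq_abs, abs_pow]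
    have h1 := one_add_abs_rpow_le_one x
    have h0 : 0 ≤ (1 + |x|) ^ (-1 / 4 : ℝ) := by positivity
    have := mul_le_mul (hM x) ((hM x).trans (mul_le_of_le_one_right hM0 h1)) (abs_nonneg _) (by positivity)
    nlinarith
  have hM1 : ∀ x, ‖((x * u x : ℝ) : ℂ)‖ ≤ M * (1 + |x|) ^ (3 / 4 : ℝ) := fun x => by
    rw [Complex.norm_real, Real.norm_eq_abs, abs_mul]
    have hx : (0 : ℝ) < 1 + |x| := by positivity
    have e : (1 + |x|) ^ (3 / 4 : ℝ) = (1 + |x|) * (1 + |x|) ^ (-1 / 4 : ℝ) := by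
      nth_rw 2 [← Real.rpow_one (1 + |x|)]
      rw [← Real.rpow_add hx]; norm_num
    rw [e]
    have := mul_le_mul (by linarith : |x| ≤ 1 + |x|) (hM x) (abs_nonneg _) hx.le
    linarith
  set Θ := toC h hs
  have hΘ1 : ∫ x, ‖Θ x‖ ^ 2 ≤ a ^ 2 := by rwa [integral_norm_sq_toC]
  have hΘ2 : ∫ x, ‖derivCLM ℂ ℂ Θ x‖ ^ 2 ≤ b ^ 2 := by rwa [derivCLM_toC, integral_norm_sq_toC]
  have key : ∀ n : ℕ, ‖(∫ x, lp (n + 1) (derivCLM ℂ ℂ Θ) x * ((x * u x : ℝ) : ℂ))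
      - ((3 * t : ℝ) : ℂ) * (∫ x, lp (n + 1)
          (derivCLM ℂ ℂ (derivCLM ℂ ℂ (derivCLM ℂ ℂ Θ))) x * (u x : ℂ))
      + ((9 * t : ℝ) : ℂ) * ∫ x, lp (n + 1) (derivCLM ℂ ℂ Θ) x * ((u x ^ 2 : ℝ) : ℂ)‖
      ≤ B * Real.sqrt (a * b) := by
    intro n
    have hn : (1 : ℝ) ≤ n + 1 := by simp
    have e1 := norm_apply_lp_deriv_le hT hB ha hb hΘ1 hΘ2 hn
    -- The derivatives in the operator pass through the frequency cutoff, so that each of the three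
    -- terms is again a cut-off test function paired with a fixed function.
    rwa [LNL_apply hu hM, derivCLM_lp hn, derivCLM_lp hn] at e1
  have lim := (((tendsto_integral_lp_deriv Θ hum1 hM1).sub
    ((tendsto_integral_lp (derivCLM ℂ ℂ (derivCLM ℂ ℂ (derivCLM ℂ ℂ Θ))) hum hM').const_mul
      ((3 * t : ℝ) : ℂ))).add
    ((tendsto_integral_lp (derivCLM ℂ ℂ Θ) hum2 hM2).const_mul ((9 * t : ℝ) : ℂ))).norm
  have := le_of_tendsto lim (Eventually.of_forall key)
  simp only [Θ, derivCLM_toC, integral_toC_mul] at this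
  rw [← Complex.ofReal_mul, ← Complex.ofReal_mul, ← Complex.ofReal_sub, ← Complex.ofReal_add,
    Complex.norm_real] at this
  exact this

/-! ### Convolution with a smooth kernel -/

/-- Convolution of real functions on the line. -/
def conv (κ V : ℝ → ℝ) (x : ℝ) : ℝ := ∫ s, κ s * V (x - s)

lemma conv_eq_convolution (κ V : ℝ → ℝ) :
    conv κ V = convolution κ V (ContinuousLinearMap.mul ℝ ℝ) volume := rfl

lemma conv_hasDerivAt {κ V : ℝ → ℝ} (hκ : ContDiff ℝ (⊤ : ℕ∞) κ) (hs : HasCompactSupport κ)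
    (hV : LocallyIntegrable V) (x : ℝ) : HasDerivAt (conv κ V) (conv (deriv κ) V x) x :=
  hs.hasDerivAt_convolution_left (ContinuousLinearMap.mul ℝ ℝ) (hκ.of_le (by exact_mod_cast le_top)) hV x

lemma conv_contDiff {κ V : ℝ → ℝ} (hκ : ContDiff ℝ (⊤ : ℕ∞) κ) (hs : HasCompactSupport κ)
    (hV : LocallyIntegrable V) : ContDiff ℝ (⊤ : ℕ∞) (conv κ V) :=
  hs.contDiff_convolution_left (ContinuousLinearMap.mul ℝ ℝ) hκ hV

lemma deriv_conv {κ V : ℝ → ℝ} (hκ : ContDiff ℝ (⊤ : ℕ∞) κ) (hs : HasCompactSupport κ)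
    (hV : LocallyIntegrable V) : deriv (conv κ V) = conv (deriv κ) V :=
  funext fun x => (conv_hasDerivAt hκ hs hV x).deriv

lemma conv_eq_integral_sub (κ V : ℝ → ℝ) (x : ℝ) : conv κ V x = ∫ y, κ (x - y) * V y := by
  have := integral_sub_left_eq_self (fun s => κ s * V (x - s)) volume x
  simpa [conv] using this.symm

/-- Fubini and the parity `σ` of the kernel. Since `F` and `κ` have bounded support, only values of
`V` on a compact set matter and no growth condition is needed. -/
lemma integral_conv_mul {κ F V : ℝ → ℝ} (hκ : Continuous κ) (hs : HasCompactSupport κ) {σ : ℝ}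
    (hσ : ∀ s, κ (-s) = σ * κ s) (hF : Integrable F) {R : ℝ} (hR : ∀ x, R < |x| → F x = 0)
    (hV : Continuous V) : ∫ x, conv κ F x * V x = σ * ∫ x, F x * conv κ V x := by
  obtain ⟨r, hr⟩ := hs.isCompact.isBounded.subset_closedBall (0 : ℝ)
  have hr' : ∀ s, r < |s| → κ s = 0 := fun s h => by
    by_contra h2
    have := hr (subset_tsupport _ h2)
    simp at this; linarith
  obtain ⟨C, hC⟩ := (isCompact_closedBall (0 : ℝ) (R + r)).exists_bound_of_continuousOn
    hV.continuousOn
  have hint0 : Integrable (fun p : ℝ × ℝ => F p.2 * κ (p.1 - p.2)) (volume.prod volume) :=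
    Integrable.convolution_integrand (ContinuousLinearMap.mul ℝ ℝ) hF
      (hκ.integrable_of_hasCompactSupport hs)
  have hint : Integrable (Function.uncurry fun x y => F y * κ (x - y) * V x)
      (volume.prod volume) := by
    refine (hint0.norm.const_mul C).mono' (hint0.aestronglyMeasurable.mul
      (hV.comp continuous_fst).aestronglyMeasurable) (Eventually.of_forall fun p => ?_)
    simp only [Function.uncurry, norm_mul]
    by_cases h1 : |p.2| ≤ R
    · by_cases h2 : |p.1 - p.2| ≤ r
      · have h3 : ‖V p.1‖ ≤ C := hC _ (by
          simp only [Metric.mem_closedBall, dist_zero_right, Real.norm_eq_abs]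
          have := abs_add_le (p.1 - p.2) p.2
          simp only [sub_add_cancel] at this; linarith)
        have := mul_le_mul_of_nonneg_left h3
          (mul_nonneg (norm_nonneg (F p.2)) (norm_nonneg (κ (p.1 - p.2))))
        linarith
      · rw [hr' _ (not_le.1 h2)]; simp
    · rw [hR _ (not_le.1 h1)]; simp
  have e1 : ∫ x, conv κ F x * V x = ∫ x, ∫ y, F y * κ (x - y) * V x := by
    refine integral_congr_ae (Eventually.of_forall fun x => ?_)
    simp only
    rw [conv_eq_integral_sub, integral_mul_const]
    congr 1; refine integral_congr_ae (Eventually.of_forall fun y => ?_); simp only; ring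
  rw [e1, integral_integral_swap hint, ← integral_const_mul]
  refine integral_congr_ae (Eventually.of_forall fun y => ?_)
  simp only
  rw [conv_eq_integral_sub, mul_left_comm, ← integral_const_mul, ← integral_const_mul]
  refine integral_congr_ae (Eventually.of_forall fun x => ?_)
  simp only
  rw [show x - y = -(y - x) by ring, hσ]; ring

lemma integrable_mul_bounded {κ F : ℝ → ℝ} (hκ : Continuous κ) (hs : HasCompactSupport κ)
    (hF : Measurable F) {β : ℝ} (hβ : ∀ x, |F x| ≤ β) (x : ℝ) :
    Integrable fun s => κ s * F (x - s) := by
  refine (hκ.integrable_of_hasCompactSupport hs).mul_bdd (c := β)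
    (hF.comp (measurable_const.sub measurable_id)).aestronglyMeasurable
    (Eventually.of_forall fun s => ?_)
  exact hβ _

/-- Jensen's inequality, read off from the nonnegative variance `∫ ρ s * (F (x - s) - c) ^ 2`. -/
lemma conv_sq_le {ρ F : ℝ → ℝ} (hρ : Continuous ρ) (hs : HasCompactSupport ρ)
    (h0 : ∀ s, 0 ≤ ρ s) (h1 : ∫ s, ρ s = 1) (hF : Measurable F) {β : ℝ} (hβ : ∀ x, |F x| ≤ β)
    (x : ℝ) : conv ρ F x ^ 2 ≤ conv ρ (fun y => F y ^ 2) x := by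
  set c := conv ρ F x with hc
  have i1 := integrable_mul_bounded hρ hs hF hβ x
  have i2 := integrable_mul_bounded (F := fun y => F y ^ 2) (β := β ^ 2) hρ hs (hF.pow_const 2)
    (fun y => by rw [abs_pow]; exact pow_le_pow_left₀ (abs_nonneg _) (hβ y) 2) x
  have i0 : Integrable ρ := hρ.integrable_of_hasCompactSupport hs
  have e : ∫ s, ρ s * (F (x - s) - c) ^ 2
      = conv ρ (fun y => F y ^ 2) x - 2 * c * conv ρ F x + c ^ 2 * ∫ s, ρ s := by
    unfold conv
    rw [← integral_const_mul, ← integral_const_mul, ← integral_sub' i2 (i1.const_mul _),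
      ← integral_add' (i2.sub (i1.const_mul _)) (i0.const_mul _)]
    refine integral_congr_ae (Eventually.of_forall fun s => ?_)
    simp only [Pi.sub_apply, Pi.add_apply]; ring
  have hpos : 0 ≤ ∫ s, ρ s * (F (x - s) - c) ^ 2 :=
    integral_nonneg fun s => mul_nonneg (h0 s) (sq_nonneg _)
  rw [e, h1, ← hc] at hpos
  nlinarith

lemma integral_conv_sq_le {ρ F : ℝ → ℝ} (hρ : Continuous ρ) (hs : HasCompactSupport ρ)
    (h0 : ∀ s, 0 ≤ ρ s) (h1 : ∫ s, ρ s = 1) (hF : Measurable F) {β : ℝ} (hβ : ∀ x, |F x| ≤ β)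
    (hF2 : Integrable fun x => F x ^ 2) : ∫ x, conv ρ F x ^ 2 ≤ ∫ x, F x ^ 2 := by
  have i0 : Integrable ρ := hρ.integrable_of_hasCompactSupport hs
  have e : ∫ x, conv ρ (fun y => F y ^ 2) x = ∫ x, F x ^ 2 := by
    have := integral_convolution (ContinuousLinearMap.mul ℝ ℝ) i0 hF2
    rw [h1] at this
    simpa [conv_eq_convolution] using this
  have hint : Integrable (conv ρ fun y => F y ^ 2) :=
    i0.integrable_convolution (ContinuousLinearMap.mul ℝ ℝ) hF2
  rw [← e]
  exact integral_mono_of_nonneg (Eventually.of_forall fun _ => sq_nonneg _) hint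
    (Eventually.of_forall fun x => conv_sq_le hρ hs h0 h1 hF hβ x)

/-! ### Zero-mean functions and their primitives -/

/-- A bounded measurable function supported in `[a, b]` with zero mean. -/
structure IsZeroMean (G : ℝ → ℝ) (a b β : ℝ) : Prop where
  le : a ≤ b
  meas : Measurable G
  bound : ∀ x, |G x| ≤ β
  supp : ∀ x, x ∉ Set.Icc a b → G x = 0
  mean : ∫ x in a..b, G x = 0

namespace IsZeroMean

variable {G : ℝ → ℝ} {a b β : ℝ}

lemma intervalIntegrable (h : IsZeroMean G a b β) (c d : ℝ) : IntervalIntegrable G volume c d := by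
  rw [intervalIntegrable_iff]
  exact Measure.integrableOn_of_bounded (M := β) (by simp) h.meas.aestronglyMeasurable
    (Eventually.of_forall h.bound)

lemma integrable (h : IsZeroMean G a b β) : Integrable G := by
  have h1 : IntegrableOn G (Set.Icc a b) := Measure.integrableOn_of_bounded (M := β) (by simp)
    h.meas.aestronglyMeasurable (Eventually.of_forall h.bound)
  exact (integrableOn_iff_integrable_of_support_subset fun x hx => by
    by_contra h2; exact hx (h.supp x h2)).1 h1

lemma integral_left (h : IsZeroMean G a b β) {c d : ℝ} (hc : c ≤ a) (hd : d ≤ a) :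
    ∫ x in c..d, G x = 0 := by
  rw [intervalIntegral.integral_congr_ae (g := fun _ => 0)]
  · simp
  · have : ∀ᵐ x : ℝ, x ≠ a := by simp [ae_iff]
    filter_upwards [this] with x hx hxm
    refine h.supp x fun h2 => hx (le_antisymm ?_ h2.1)
    exact hxm.2.trans (max_le hc hd)

lemma integral_right (h : IsZeroMean G a b β) {c d : ℝ} (hc : b ≤ c) (hd : b ≤ d) :
    ∫ x in c..d, G x = 0 := by
  rw [intervalIntegral.integral_congr_ae (g := fun _ => 0)]
  · simp
  · refine Eventually.of_forall fun x hxm => h.supp x fun h2 => ?_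
    have := (le_min hc hd).trans_lt hxm.1
    exact absurd h2.2 (not_le.2 this)

/-- The primitive of a zero mean function vanishes outside of the interval. -/
lemma primitive_eq_zero (h : IsZeroMean G a b β) {x : ℝ} (hx : x ∉ Set.Icc a b) :
    ∫ s in a..x, G s = 0 := by
  rcases le_or_gt x a with h1 | h1
  · exact h.integral_left le_rfl h1
  · have h2 : b ≤ x := by
      by_contra h3; exact hx ⟨h1.le, (not_le.1 h3).le⟩
    rw [← intervalIntegral.integral_add_adjacent_intervals (h.intervalIntegrable a b)
      (h.intervalIntegrable b x), h.mean, h.integral_right le_rfl h2, add_zero]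

lemma primitive_continuous (h : IsZeroMean G a b β) : Continuous fun x => ∫ s in a..x, G s :=
  intervalIntegral.continuous_primitive h.intervalIntegrable a

lemma primitive_hasCompactSupport (h : IsZeroMean G a b β) :
    HasCompactSupport fun x => ∫ s in a..x, G s :=
  HasCompactSupport.of_support_subset_isCompact (isCompact_Icc (a := a) (b := b)) fun x hx => by
    by_contra h2; exact hx (h.primitive_eq_zero h2)

/-- Integration and mollification commute. As `ρ` lives in `[-1, 1]`, nothing of `conv ρ G` lies to
the left of `a - 1`. Since `G` need not be continuous, this form is what makes the mollified
primitive differentiable with derivative `conv ρ G`. -/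
lemma conv_primitive (h : IsZeroMean G a b β) {ρ : ℝ → ℝ} (hρ : Continuous ρ)
    (hs : HasCompactSupport ρ) (h1 : ∀ s, 1 < |s| → ρ s = 0) (x : ℝ) :
    conv ρ (fun x => ∫ s in a..x, G s) x = ∫ r in (a - 1)..x, conv ρ G r := by
  have i0 : Integrable ρ := hρ.integrable_of_hasCompactSupport hs
  have hint0 : Integrable (fun p : ℝ × ℝ => ρ p.2 * G (p.1 - p.2)) (volume.prod volume) :=
    Integrable.convolution_integrand (ContinuousLinearMap.mul ℝ ℝ) i0 h.integrable
  have hint : Integrable (Function.uncurry fun r s => ρ s * G (r - s))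
      ((volume.restrict (Set.uIoc (a - 1) x)).prod volume) := by
    refine hint0.mono_measure ?_
    exact Measure.prod_mono Measure.restrict_le_self le_rfl
  unfold conv
  rw [intervalIntegral_integral_swap hint]
  refine integral_congr_ae (Eventually.of_forall fun s => ?_)
  simp only
  rw [intervalIntegral.integral_const_mul]
  by_cases hsm : 1 < |s|
  · rw [h1 s hsm]; simp
  · congr 1
    rw [intervalIntegral.integral_comp_sub_right (fun r => G r) s]
    have hs1 := abs_le.1 (not_lt.1 hsm)
    rw [← intervalIntegral.integral_add_adjacent_intervals (h.intervalIntegrable (a - 1 - s) a)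
      (h.intervalIntegrable a (x - s)), h.integral_left (by linarith) le_rfl, zero_add]

lemma hasDerivAt_conv_primitive (h : IsZeroMean G a b β) {ρ : ℝ → ℝ}
    (hρ : ContDiff ℝ (⊤ : ℕ∞) ρ) (hs : HasCompactSupport ρ) (h1 : ∀ s, 1 < |s| → ρ s = 0)
    (x : ℝ) : HasDerivAt (conv ρ fun x => ∫ s in a..x, G s) (conv ρ G x) x := by
  have hc : Continuous (conv ρ G) := (conv_contDiff hρ hs h.integrable.locallyIntegrable).continuous
  rw [funext (h.conv_primitive hρ.continuous hs h1)]
  exact intervalIntegral.integral_hasDerivAt_right (hc.intervalIntegrable _ _)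
    hc.aestronglyMeasurable.stronglyMeasurableAtFilter hc.continuousAt

lemma sq_integral (h : IsZeroMean G a b β) : ∫ x, G x ^ 2 = ∫ x in a..b, G x ^ 2 := by
  rw [intervalIntegral.integral_of_le h.le, ← integral_Icc_eq_integral_Ioc,
    setIntegral_eq_integral_of_forall_compl_eq_zero fun x hx => by rw [h.supp x hx]; simp]

lemma mul_integral (h : IsZeroMean G a b β) (V : ℝ → ℝ) :
    ∫ x, G x * V x = ∫ x in a..b, G x * V x := by
  rw [intervalIntegral.integral_of_le h.le, ← integral_Icc_eq_integral_Ioc,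
    setIntegral_eq_integral_of_forall_compl_eq_zero fun x hx => by rw [h.supp x hx]; simp]

lemma primitive_sq_integral (h : IsZeroMean G a b β) :
    ∫ x, (∫ s in a..x, G s) ^ 2 = ∫ x in a..b, (∫ s in a..x, G s) ^ 2 := by
  rw [intervalIntegral.integral_of_le h.le, ← integral_Icc_eq_integral_Ioc,
    setIntegral_eq_integral_of_forall_compl_eq_zero fun x hx => by
      rw [h.primitive_eq_zero hx]; simp]

lemma primitive_mul_integral (h : IsZeroMean G a b β) (V : ℝ → ℝ) :
    ∫ x, (∫ s in a..x, G s) * V x = ∫ x in a..b, (∫ s in a..x, G s) * V x := by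
  rw [intervalIntegral.integral_of_le h.le, ← integral_Icc_eq_integral_Ioc,
    setIntegral_eq_integral_of_forall_compl_eq_zero fun x hx => by
      rw [h.primitive_eq_zero hx]; simp]

end IsZeroMean

/-! ### The problem at time one -/

/-- The bracket at time one. -/
def jb (y : ℝ) : ℝ := Real.sqrt (y ^ 2 + 1)

lemma one_le_jb (y : ℝ) : 1 ≤ jb y := Real.one_le_sqrt.2 (by nlinarith [sq_nonneg y])

lemma jb_pos (y : ℝ) : 0 < jb y := by linarith [one_le_jb y]

lemma jb_sq (y : ℝ) : jb y ^ 2 = y ^ 2 + 1 := Real.sq_sqrt (by positivity)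

lemma abs_le_jb (y : ℝ) : |y| ≤ jb y := Real.abs_le_sqrt (by linarith)

lemma jb_continuous : Continuous jb := by unfold jb; fun_prop

lemma jb_mono {x y : ℝ} (h : |x| ≤ |y|) : jb x ≤ jb y :=
  Real.sqrt_le_sqrt (by linarith [sq_le_sq.2 h])

lemma jb_le_add (x y : ℝ) : jb x ≤ jb y + |x - y| := by
  refine Real.sqrt_le_iff.2 ⟨by linarith [one_le_jb y, abs_nonneg (x - y)], ?_⟩
  have h1 := jb_sq y
  have h2 := abs_le_jb y
  have h3 : y * (x - y) ≤ jb y * |x - y| := by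
    refine (le_abs_self _).trans ?_
    rw [abs_mul]; exact mul_le_mul_of_nonneg_right h2 (abs_nonneg _)
  nlinarith [sq_abs (x - y)]

/-- The operator `L^{NL}` at time one. -/
def frc (w : ℝ → ℝ) (x : ℝ) : ℝ := x * w x - 3 * deriv (deriv w) x + 9 * w x ^ 2

/-- The energy bounds at time one, tested against smooth functions. -/
structure WeakTests (D : ℝ) (v : ℝ → ℝ) : Prop where
  force : ∀ φ : ℝ → ℝ, ContDiff ℝ (⊤ : ℕ∞) φ → HasCompactSupport φ → ∀ a b : ℝ, 0 < a → 0 < b →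
    ∫ x, φ x ^ 2 ≤ a ^ 2 → ∫ x, deriv φ x ^ 2 ≤ b ^ 2 →
    |(∫ x, deriv φ x * (x * v x)) - 3 * (∫ x, deriv (deriv (deriv φ)) x * v x)
      + 9 * ∫ x, deriv φ x * v x ^ 2| ≤ D * Real.sqrt (a * b)
  func : ∀ φ : ℝ → ℝ, ContDiff ℝ (⊤ : ℕ∞) φ → HasCompactSupport φ → ∀ a b : ℝ, 0 < a → 0 < b →
    ∫ x, φ x ^ 2 ≤ a ^ 2 → ∫ x, deriv φ x ^ 2 ≤ b ^ 2 →
    |∫ x, φ x * v x| ≤ D * (Real.sqrt (a * b) + a)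

/-- The energy bounds for a smooth function, tested on a window `[-B, B]`. -/
structure Tested (D A B : ℝ) (w : ℝ → ℝ) : Prop where
  smooth : ContDiff ℝ 2 w
  bound : ∀ y, |w y| ≤ A * jb y ^ (-1 / 4 : ℝ)
  bound_deriv : ∀ y, |deriv w y| ≤ A * jb y ^ (1 / 4 : ℝ)
  force : ∀ (G : ℝ → ℝ) (a b β : ℝ), IsZeroMean G a b β → -B ≤ a → b ≤ B → ∀ p q : ℝ, 0 < p →
    0 < q → ∫ x in a..b, (∫ s in a..x, G s) ^ 2 ≤ p ^ 2 → ∫ x in a..b, G x ^ 2 ≤ q ^ 2 →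
    |∫ x in a..b, G x * frc w x| ≤ D * (Real.sqrt (p * q) + β / B)
  func : ∀ (G : ℝ → ℝ) (a b β : ℝ), IsZeroMean G a b β → -B ≤ a → b ≤ B → ∀ p q : ℝ, 0 < p →
    0 < q → ∫ x in a..b, (∫ s in a..x, G s) ^ 2 ≤ p ^ 2 → ∫ x in a..b, G x ^ 2 ≤ q ^ 2 →
    |∫ x in a..b, (∫ s in a..x, G s) * w x| ≤ D * (Real.sqrt (p * q) + p)

/-- An even smooth probability density supported in `[-η, η]`. -/
structure IsMollifier (ρ : ℝ → ℝ) (η : ℝ) : Prop where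
  smooth : ContDiff ℝ (⊤ : ℕ∞) ρ
  compact : HasCompactSupport ρ
  nonneg : ∀ s, 0 ≤ ρ s
  mass : ∫ s, ρ s = 1
  even : ∀ s, ρ (-s) = ρ s
  supp : ∀ s, η < |s| → ρ s = 0

lemma exists_isMollifier {η : ℝ} (hη : 0 < η) : ∃ ρ, IsMollifier ρ η := by
  let f : ContDiffBump (0 : ℝ) := ⟨η / 2, η, by linarith, by linarith⟩
  refine ⟨f.normed volume, f.contDiff_normed, f.hasCompactSupport_normed, f.nonneg_normed,
    f.integral_normed, f.normed_neg, fun s hs => ?_⟩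
  by_contra h
  have : s ∈ Function.support (f.normed volume) := h
  rw [f.support_normed_eq] at this
  simp [f] at this; linarith

namespace IsMollifier

variable {ρ V : ℝ → ℝ} {η : ℝ}

lemma integrable_mul (h : IsMollifier ρ η) (hV : Continuous V) (y : ℝ) :
    Integrable fun s => ρ s * V (y - s) :=
  (h.smooth.continuous.mul (hV.comp (continuous_const.sub continuous_id))).integrable_of_hasCompactSupport
    h.compact.mul_right

lemma abs_integral_le (h : IsMollifier ρ η) {f : ℝ → ℝ} {e : ℝ} (he : ∀ s, |s| ≤ η → |f s| ≤ e) :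
    |∫ s, ρ s * f s| ≤ e := by
  have h1 : Integrable fun s => e * ρ s :=
    (h.smooth.continuous.integrable_of_hasCompactSupport h.compact).const_mul e
  have := norm_integral_le_of_norm_le (f := fun s => ρ s * f s) h1 (Eventually.of_forall fun s => by
    rw [norm_mul, Real.norm_of_nonneg (h.nonneg s), mul_comm e]
    by_cases hs : |s| ≤ η
    · exact mul_le_mul_of_nonneg_left (he s hs) (h.nonneg s)
    · rw [h.supp s (not_le.1 hs)]; simp)
  rwa [integral_const_mul, h.mass, mul_one] at this

lemma abs_sub_conv_le (h : IsMollifier ρ η) (hV : Continuous V) {y c e : ℝ}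
    (he : ∀ s, |s| ≤ η → |c - V (y - s)| ≤ e) : |c - conv ρ V y| ≤ e := by
  have e1 : c - conv ρ V y = ∫ s, ρ s * (c - V (y - s)) := by
    have : ∀ s, ρ s * (c - V (y - s)) = c * ρ s - ρ s * V (y - s) := fun s => by ring
    simp_rw [this]
    rw [integral_sub ((h.smooth.continuous.integrable_of_hasCompactSupport h.compact).const_mul c)
      (h.integrable_mul hV y), integral_const_mul, h.mass, mul_one, conv]
  rw [e1]; exact h.abs_integral_le he

lemma abs_conv_sub_conv_le (h : IsMollifier ρ η) (hV : Continuous V) {y z e : ℝ}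
    (he : ∀ s, |s| ≤ η → |V (y - s) - V (z - s)| ≤ e) : |conv ρ V y - conv ρ V z| ≤ e := by
  have e1 : conv ρ V y - conv ρ V z = ∫ s, ρ s * (V (y - s) - V (z - s)) := by
    unfold conv
    rw [← integral_sub (h.integrable_mul hV y) (h.integrable_mul hV z)]
    simp_rw [mul_sub]
  rw [e1]; exact h.abs_integral_le he

end IsMollifier

lemma two_rpow_quarter_le : (2 : ℝ) ^ (1 / 4 : ℝ) ≤ 2 := by
  conv_rhs => rw [← Real.rpow_one 2]
  exact Real.rpow_le_rpow_of_exponent_le one_le_two (by norm_num)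

lemma three_rpow_quarter_le : (3 : ℝ) ^ (1 / 4 : ℝ) ≤ 2 := by
  have : (2 : ℝ) = (16 : ℝ) ^ (1 / 4 : ℝ) := by
    rw [show (16 : ℝ) = 2 ^ (4 : ℝ) by norm_num, ← Real.rpow_mul (by norm_num)]; norm_num
  rw [this]
  exact Real.rpow_le_rpow (by norm_num) (by norm_num) (by norm_num)

lemma jb_rpow_neg_le {x y : ℝ} (h : |x - y| ≤ 1) :
    jb x ^ (-1 / 4 : ℝ) ≤ 2 * jb y ^ (-1 / 4 : ℝ) := by
  have h1 : jb y ≤ 2 * jb x := by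
    have := jb_le_add y x
    rw [abs_sub_comm] at this
    linarith [one_le_jb x]
  have hx := jb_pos x
  have hy := jb_pos y
  have e : ∀ z : ℝ, 0 < z → z ^ (-1 / 4 : ℝ) = (z ^ (1 / 4 : ℝ))⁻¹ := fun z hz => by
    rw [← Real.rpow_neg hz.le]; norm_num
  rw [e _ hx, e _ hy, ← div_eq_mul_inv, inv_eq_one_div, div_le_div_iff₀ (by positivity) (by positivity),
    one_mul]
  refine (Real.rpow_le_rpow hy.le h1 (by norm_num)).trans ?_
  rw [Real.mul_rpow (by norm_num) hx.le]
  exact mul_le_mul_of_nonneg_right two_rpow_quarter_le (by positivity)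

lemma jb_rpow_le {x y : ℝ} (h : |x - y| ≤ 2) : jb x ^ (1 / 4 : ℝ) ≤ 2 * jb y ^ (1 / 4 : ℝ) := by
  have h1 : jb x ≤ 3 * jb y := by
    have := jb_le_add x y
    linarith [one_le_jb y]
  refine (Real.rpow_le_rpow (jb_pos x).le h1 (by norm_num)).trans ?_
  rw [Real.mul_rpow (by norm_num) (jb_pos y).le]
  exact mul_le_mul_of_nonneg_right three_rpow_quarter_le (by have := jb_pos y; positivity)

lemma jb_rpow_neg_le_one (y : ℝ) : jb y ^ (-1 / 4 : ℝ) ≤ 1 :=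
  Real.rpow_le_one_of_one_le_of_nonpos (one_le_jb y) (by norm_num)

/-! ### Passage to a smooth function by mollification -/

section Mollify

variable {v ρ : ℝ → ℝ} {A D B η : ℝ}

lemma abs_sub_le_of_deriv (hv : Differentiable ℝ v) {c R x y : ℝ}
    (h : ∀ z, |z| ≤ R → |deriv v z| ≤ c) (hx : |x| ≤ R) (hy : |y| ≤ R) :
    |v x - v y| ≤ c * |x - y| :=
  Convex.norm_image_sub_le_of_norm_deriv_le (s := Set.Icc (-R) R) (fun z _ => hv z)
    (fun z hz => h z (abs_le.2 hz)) (convex_Icc _ _) (abs_le.1 hy) (abs_le.1 hx)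

lemma mollify_bound (hρ : IsMollifier ρ η) (hη1 : η ≤ 1) (hv : Continuous v) (hA : 0 ≤ A)
    (h0 : ∀ y, |v y| ≤ A * jb y ^ (-1 / 4 : ℝ)) (y : ℝ) :
    |conv ρ v y| ≤ 2 * A * jb y ^ (-1 / 4 : ℝ) := by
  have := hρ.abs_sub_conv_le (y := y) (c := 0) (e := 2 * A * jb y ^ (-1 / 4 : ℝ)) hv fun s hs => by
    rw [zero_sub, abs_neg]
    have h1 := jb_rpow_neg_le (x := y - s) (y := y) (by simpa using hs.trans hη1)
    have := mul_le_mul_of_nonneg_left h1 hA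
    linarith [h0 (y - s)]
  simpa using this

/-- The derivative of `v` is not known to be continuous, so it is not moved under the integral.
Instead the increments of `v` are estimated by the mean value inequality, and `conv ρ v` inherits
the Lipschitz constant. -/
lemma mollify_bound_deriv (hρ : IsMollifier ρ η) (hη1 : η ≤ 1) (hv : Differentiable ℝ v)
    (hA : 0 ≤ A) (h0 : ∀ y, |deriv v y| ≤ A * jb y ^ (1 / 4 : ℝ)) (y : ℝ) :
    |deriv (conv ρ v) y| ≤ 2 * A * jb y ^ (1 / 4 : ℝ) := by
  have hy := jb_pos y
  change ‖deriv (conv ρ v) y‖ ≤ _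
  refine norm_deriv_le_of_lip' (C := 2 * A * jb y ^ (1 / 4 : ℝ))
    (mul_nonneg (by linarith) (Real.rpow_nonneg hy.le _)) ?_
  filter_upwards [Metric.ball_mem_nhds y one_pos] with z hz
  rw [Metric.mem_ball, Real.dist_eq] at hz
  refine hρ.abs_conv_sub_conv_le hv.continuous fun s hs => ?_
  have hs1 := hs.trans hη1
  have := Convex.norm_image_sub_le_of_norm_deriv_le (f := v) (s := Metric.closedBall y 2)
    (C := 2 * A * jb y ^ (1 / 4 : ℝ)) (x := y - s) (y := z - s) (fun z _ => hv z)
    (fun x hx => by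
      rw [Metric.mem_closedBall, Real.dist_eq] at hx
      have h1 := mul_le_mul_of_nonneg_left (jb_rpow_le hx) hA
      rw [Real.norm_eq_abs]; linarith [h0 x]) (convex_closedBall _ _)
    (by rw [Metric.mem_closedBall, Real.dist_eq]; simp; linarith)
    (by
      rw [Metric.mem_closedBall, Real.dist_eq]
      have := abs_sub (z - y) s
      rw [show z - s - y = z - y - s by ring]; linarith)
  simpa using this

/-- The error in the equation of the mollified function. -/
lemma mollify_commutator (hρ : IsMollifier ρ η) (hη0 : 0 < η) (hη1 : η ≤ 1)
    (hv : Differentiable ℝ v) (hB : 1 ≤ B) {Λ : ℝ}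
    (h0 : ∀ y, |v y| ≤ A) (hΛ : ∀ z, |z| ≤ B + 1 → |deriv v z| ≤ Λ) {y : ℝ} (hy : |y| ≤ B) :
    |y * conv ρ v y + 9 * conv ρ v y ^ 2 - conv ρ (fun x => x * v x + 9 * v x ^ 2) y|
      ≤ (2 * Λ * B + A + 36 * Λ * A) * η := by
  have hΛ0 : 0 ≤ Λ := (abs_nonneg _).trans (hΛ 0 (by simp; linarith))
  have hw : |conv ρ v y| ≤ A := by
    have := hρ.abs_sub_conv_le (y := y) (c := 0) (e := A) hv.continuous fun s _ => by
      rw [zero_sub, abs_neg]; exact h0 _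
    simpa using this
  have hstep : ∀ s, |s| ≤ η → |v y - v (y - s)| ≤ Λ * η := fun s hs => by
    have := abs_sub_le_of_deriv hv hΛ (x := y) (y := y - s) (by linarith)
      ((abs_sub _ _).trans (by linarith))
    rw [sub_sub_cancel] at this
    exact this.trans (mul_le_mul_of_nonneg_left hs hΛ0)
  have hwv : |v y - conv ρ v y| ≤ Λ * η := hρ.abs_sub_conv_le hv.continuous hstep
  have hvc := hv.continuous
  refine hρ.abs_sub_conv_le (V := fun x => x * v x + 9 * v x ^ 2) (by fun_prop) fun s hs => ?_
  set w := conv ρ v y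
  have h1 : |w - v (y - s)| ≤ 2 * Λ * η := by
    have := abs_sub_le w (v y) (v (y - s))
    rw [abs_sub_comm w (v y)] at this
    linarith [hstep s hs]
  have e : y * w + 9 * w ^ 2 - ((y - s) * v (y - s) + 9 * v (y - s) ^ 2)
      = y * (w - v (y - s)) + s * v (y - s) + 9 * ((w - v (y - s)) * (w + v (y - s))) := by ring
  rw [e]
  have h2 : |y * (w - v (y - s))| ≤ B * (2 * Λ * η) := by
    rw [abs_mul]; exact mul_le_mul hy h1 (abs_nonneg _) (by linarith)
  have h3 : |s * v (y - s)| ≤ η * A := by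
    rw [abs_mul]; exact mul_le_mul hs (h0 _) (abs_nonneg _) hη0.le
  have h4 : |9 * ((w - v (y - s)) * (w + v (y - s)))| ≤ 9 * (2 * Λ * η * (2 * A)) := by
    rw [abs_mul, abs_mul, abs_of_pos (by norm_num : (0 : ℝ) < 9)]
    refine mul_le_mul_of_nonneg_left (mul_le_mul h1 ?_ (abs_nonneg _) (by positivity)) (by norm_num)
    have := abs_add_le w (v (y - s))
    linarith [h0 (y - s)]
  have h5 := abs_add_le (y * (w - v (y - s)) + s * v (y - s)) (9 * ((w - v (y - s)) * (w + v (y - s))))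
  have h6 := abs_add_le (y * (w - v (y - s))) (s * v (y - s))
  linarith

lemma integrable_sq_of_compact {f : ℝ → ℝ} (hf : Continuous f) (hs : HasCompactSupport f) :
    Integrable fun x => f x ^ 2 := by
  have h : HasCompactSupport (fun x => f x * f x) := hs.mul_left
  simp only [sq]
  exact (hf.mul hf).integrable_of_hasCompactSupport h

/-- The mollified primitive of a zero-mean function is a legitimate smooth test function. By Jensen
the mollification does not increase the two `L²` norms, and the remaining derivatives fall on `ρ`.
-/
lemma test_properties (hρ : IsMollifier ρ η) (hη1 : η ≤ 1) {G : ℝ → ℝ} {a b β p q : ℝ}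
    (hG : IsZeroMean G a b β) (h1 : ∫ x in a..b, (∫ s in a..x, G s) ^ 2 ≤ p ^ 2)
    (h2 : ∫ x in a..b, G x ^ 2 ≤ q ^ 2) {Ψ : ℝ → ℝ} (hΨ : Ψ = conv ρ fun x => ∫ s in a..x, G s) :
    ContDiff ℝ (⊤ : ℕ∞) Ψ ∧ HasCompactSupport Ψ ∧ deriv Ψ = conv ρ G ∧
      deriv (deriv (deriv Ψ)) = conv (deriv (deriv ρ)) G ∧
      ∫ x, Ψ x ^ 2 ≤ p ^ 2 ∧ ∫ x, deriv Ψ x ^ 2 ≤ q ^ 2 := by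
  have hc := hG.primitive_continuous
  have hs := hG.primitive_hasCompactSupport
  subst hΨ
  have hd : deriv (conv ρ fun x => ∫ s in a..x, G s) = conv ρ G := by
    funext x
    have h3 := hG.hasDerivAt_conv_primitive hρ.smooth
      hρ.compact (fun s hs => hρ.supp s (hη1.trans_lt hs)) x
    exact h3.deriv
  have hGl := hG.integrable.locallyIntegrable
  have h3 := conv_contDiff hρ.smooth hρ.compact hc.locallyIntegrable
  have h4 : HasCompactSupport (conv ρ fun x => ∫ s in a..x, G s) := by
    rw [conv_eq_convolution]
    exact HasCompactSupport.convolution (ContinuousLinearMap.mul ℝ ℝ) hρ.compact hs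
  have hddd : deriv (deriv (deriv (conv ρ fun x => ∫ s in a..x, G s)))
      = conv (deriv (deriv ρ)) G := by
    rw [hd, deriv_conv hρ.smooth hρ.compact hGl,
      deriv_conv (contDiff_deriv hρ.smooth) hρ.compact.deriv hGl]
  have hq : ∫ x, conv ρ G x ^ 2 ≤ q ^ 2 := by
    have h5 : Integrable fun x => G x ^ 2 := by
      have := hG.integrable.mul_bdd (c := β) hG.meas.aestronglyMeasurable
        (Eventually.of_forall hG.bound)
      simpa [sq] using this
    exact (integral_conv_sq_le hρ.smooth.continuous hρ.compact hρ.nonneg hρ.mass hG.meas hG.bound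
      h5).trans (hG.sq_integral.trans_le h2)
  obtain ⟨C, hC⟩ := hc.bounded_above_of_compact_support hs
  have h6 : Integrable fun x => (∫ s in a..x, G s) ^ 2 :=
    integrable_sq_of_compact hc hs
  have hp : ∫ x, (conv ρ fun x => ∫ s in a..x, G s) x ^ 2 ≤ p ^ 2 :=
    (integral_conv_sq_le hρ.smooth.continuous hρ.compact hρ.nonneg hρ.mass hc.measurable hC
      h6).trans (hG.primitive_sq_integral.trans_le h1)
  rw [← hd] at hq
  exact ⟨h3, h4, hd, hddd, hp, hq⟩

lemma deriv_even_odd {f : ℝ → ℝ} {σ : ℝ} (h : ∀ s, f (-s) = σ * f s) (s : ℝ) :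
    deriv f (-s) = (-σ) * deriv f s := by
  have h1 : (fun x => f (-x)) = fun x => σ * f x := funext h
  have h2 := deriv_comp_neg f s
  rw [h1, deriv_const_mul_field] at h2
  linarith

/-- Testing `conv ρ v` with `G` amounts to testing `v` with `conv ρ G`, since `ρ` is even.
Mollification commutes with the second derivative but not with multiplication by `x` or with
squaring; that commutator is small on a window if the mollifier is narrow enough. -/
lemma exists_tested (hv : Differentiable ℝ v) (hA : 0 ≤ A) (hD : 0 < D) (hB : 1 ≤ B)
    (h0 : ∀ y, |v y| ≤ A * jb y ^ (-1 / 4 : ℝ)) (h0' : ∀ y, |deriv v y| ≤ A * jb y ^ (1 / 4 : ℝ))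
    (hW : WeakTests D v) {e : ℝ} (he : 0 < e) :
    ∃ w, Tested D (2 * A) B w ∧ ∀ y, |y| ≤ B → |w y - v y| ≤ e := by
  set Λ := A * jb (B + 1) ^ (1 / 4 : ℝ) with hΛdef
  have hΛ0 : 0 ≤ Λ := mul_nonneg hA (by have := jb_pos (B + 1); positivity)
  have hΛ : ∀ z, |z| ≤ B + 1 → |deriv v z| ≤ Λ := fun z hz => (h0' z).trans
    (mul_le_mul_of_nonneg_left (Real.rpow_le_rpow (jb_pos z).le
      (jb_mono (hz.trans (le_abs_self _))) (by norm_num)) hA)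
  have hvA : ∀ y, |v y| ≤ A := fun y =>
    (h0 y).trans (mul_le_of_le_one_right hA (jb_rpow_neg_le_one y))
  set c1 := 2 * Λ * B + A + 36 * Λ * A with hc1
  have hc10 : 0 ≤ c1 := by positivity
  -- The second entry makes `conv ρ v` differ from `v` by at most `e` on the window. The third makes
  -- the commutator at most `D / (2 B²)`; integrated against `|G| ≤ β` over a length of at most `2
  -- B`, it gives the term `D β / B` of `Tested.force`.
  set η := min 1 (min (e / (Λ + 1)) (D / (2 * B ^ 2) / (c1 + 1))) with hηdef
  have hη0 : 0 < η := by
    refine lt_min one_pos (lt_min (by positivity) (by positivity))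
  have hη1 : η ≤ 1 := min_le_left _ _
  have hη2 : Λ * η ≤ e := by
    have : η ≤ e / (Λ + 1) := (min_le_right _ _).trans (min_le_left _ _)
    rw [le_div_iff₀ (by positivity)] at this
    nlinarith
  have hη3 : c1 * η ≤ D / (2 * B ^ 2) := by
    have : η ≤ D / (2 * B ^ 2) / (c1 + 1) := (min_le_right _ _).trans (min_le_right _ _)
    rw [le_div_iff₀ (by positivity)] at this
    nlinarith
  obtain ⟨ρ, hρ⟩ := exists_isMollifier hη0
  have hvc := hv.continuous
  have hvl : LocallyIntegrable v := hvc.locallyIntegrable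
  have hρd := contDiff_deriv hρ.smooth
  have hρdd := contDiff_deriv hρd
  have heven : ∀ s, ρ (-s) = 1 * ρ s := fun s => by rw [hρ.even, one_mul]
  have hdd : ∀ s, deriv (deriv ρ) (-s) = 1 * deriv (deriv ρ) s := fun s => by
    have := deriv_even_odd (deriv_even_odd heven) s
    simpa using this
  have hwd : deriv (deriv (conv ρ v)) = conv (deriv (deriv ρ)) v := by
    rw [deriv_conv hρ.smooth hρ.compact hvl, deriv_conv hρd hρ.compact.deriv hvl]
  have hR : ∀ {F : ℝ → ℝ} {a b : ℝ}, (∀ x, x ∉ Set.Icc a b → F x = 0) →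
      ∀ x, max |a| |b| < |x| → F x = 0 := fun {F a b} h x hx => h x fun h2 => by
    have := abs_le_max_abs_abs h2.1 h2.2
    linarith
  refine ⟨conv ρ v, ⟨by
      exact_mod_cast contDiff_infty.1 (conv_contDiff hρ.smooth hρ.compact hvl) 2,
    mollify_bound hρ hη1 hvc hA h0, mollify_bound_deriv hρ hη1 hv hA h0', ?_, ?_⟩, fun y hy => ?_⟩
  · intro G a b β hG ha hb p q hp hq h1 h2
    obtain ⟨t1, t2, t3, t4, t5, t6⟩ := test_properties hρ hη1 hG h1 h2 rfl
    have key := hW.force _ t1 t2 p q hp hq t5 t6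
    rw [t4, t3, integral_conv_mul hρ.smooth.continuous hρ.compact heven hG.integrable (hR hG.supp)
        (V := fun x => x * v x) (by fun_prop),
      integral_conv_mul hρ.smooth.continuous hρ.compact heven hG.integrable (hR hG.supp)
        (V := fun x => v x ^ 2) (by fun_prop),
      integral_conv_mul hρdd.continuous hρ.compact.deriv.deriv hdd hG.integrable (hR hG.supp) hvc,
      hG.mul_integral, hG.mul_integral, hG.mul_integral, one_mul, one_mul, one_mul, ← hwd] at key
    have hV1 : Continuous (conv ρ fun x => x * v x) := (conv_contDiff hρ.smooth hρ.compact
      (Continuous.locallyIntegrable (by fun_prop))).continuous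
    have hV2 : Continuous (conv ρ fun x => v x ^ 2) := (conv_contDiff hρ.smooth hρ.compact
      (Continuous.locallyIntegrable (by fun_prop))).continuous
    have hw : Continuous (conv ρ v) := (conv_contDiff hρ.smooth hρ.compact hvl).continuous
    have hw2 : Continuous (deriv (deriv (conv ρ v))) := by
      rw [hwd]; exact (conv_contDiff hρdd hρ.compact.deriv.deriv hvl).continuous
    have hi : ∀ {V : ℝ → ℝ}, Continuous V → IntervalIntegrable (fun x => G x * V x) volume a b :=
      fun hV => (hG.intervalIntegrable a b).mul_continuousOn hV.continuousOn
    have hf : Continuous (frc (conv ρ v)) := by unfold frc; fun_prop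
    have hsum : ∀ y, conv ρ (fun x => x * v x + 9 * v x ^ 2) y
        = conv ρ (fun x => x * v x) y + 9 * conv ρ (fun x => v x ^ 2) y := fun y => by
      unfold conv
      rw [← integral_const_mul, ← integral_add (hρ.integrable_mul (V := fun x => x * v x)
        (by fun_prop) y) ((hρ.integrable_mul (V := fun x => v x ^ 2) (by fun_prop) y).const_mul 9)]
      refine integral_congr_ae (Eventually.of_forall fun s => ?_)
      simp only; ring
    have e1 : ∫ x in a..b, G x * frc (conv ρ v) x
        = ((∫ x in a..b, G x * conv ρ (fun x => x * v x) x)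
          - 3 * (∫ x in a..b, G x * deriv (deriv (conv ρ v)) x)
          + 9 * ∫ x in a..b, G x * conv ρ (fun x => v x ^ 2) x)
          + ∫ x in a..b, G x * (x * conv ρ v x + 9 * conv ρ v x ^ 2
              - conv ρ (fun x => x * v x + 9 * v x ^ 2) x) := by
      rw [← intervalIntegral.integral_const_mul, ← intervalIntegral.integral_const_mul,
        ← intervalIntegral.integral_sub (hi hV1) ((hi hw2).const_mul 3),
        ← intervalIntegral.integral_add ((hi hV1).sub ((hi hw2).const_mul 3))
          ((hi hV2).const_mul 9),
        ← intervalIntegral.integral_add (((hi hV1).sub ((hi hw2).const_mul 3)).add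
          ((hi hV2).const_mul 9))]
      · refine intervalIntegral.integral_congr fun x _ => ?_
        simp only [hsum, frc]; ring
      · refine hi (V := fun x => x * conv ρ v x + 9 * conv ρ v x ^ 2
              - conv ρ (fun x => x * v x + 9 * v x ^ 2) x) ?_
        rw [funext hsum]; fun_prop
    have hβ : 0 ≤ β := (abs_nonneg _).trans (hG.bound 0)
    have e2 : |∫ x in a..b, G x * (x * conv ρ v x + 9 * conv ρ v x ^ 2
              - conv ρ (fun x => x * v x + 9 * v x ^ 2) x)| ≤ β * (D / (2 * B ^ 2)) * |b - a| := by
      refine (Real.norm_eq_abs _).symm.trans_le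
        (intervalIntegral.norm_integral_le_of_norm_le_const fun x hx => ?_)
      rw [Set.uIoc_of_le hG.le] at hx
      have hxB : |x| ≤ B := abs_le.2 ⟨by linarith [hx.1], by linarith [hx.2]⟩
      rw [norm_mul]
      exact mul_le_mul (hG.bound x) ((mollify_commutator hρ hη0 hη1 hv hB hvA hΛ hxB).trans hη3)
        (abs_nonneg _) hβ
    have e3 : β * (D / (2 * B ^ 2)) * |b - a| ≤ D * (β / B) := by
      rw [abs_of_nonneg (by linarith [hG.le])]
      have : β * (D / (2 * B ^ 2)) * (b - a) ≤ β * (D / (2 * B ^ 2)) * (2 * B) :=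
        mul_le_mul_of_nonneg_left (by linarith) (by positivity)
      refine this.trans_eq ?_
      field_simp
    rw [e1]
    refine (abs_add_le _ _).trans ?_
    rw [mul_add]
    exact add_le_add key (e2.trans e3)
  · intro G a b β hG ha hb p q hp hq h1 h2
    obtain ⟨t1, t2, t3, t4, t5, t6⟩ := test_properties hρ hη1 hG h1 h2 rfl
    have key := hW.func _ t1 t2 p q hp hq t5 t6
    have hc := hG.primitive_continuous
    rwa [integral_conv_mul hρ.smooth.continuous hρ.compact heven
      (hc.integrable_of_hasCompactSupport hG.primitive_hasCompactSupport)
      (hR fun x hx => hG.primitive_eq_zero hx) hvc, one_mul, hG.primitive_mul_integral] at key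
  · have := hρ.abs_sub_conv_le (y := y) (c := v y) (e := Λ * η) hvc fun s hs => by
      have := abs_sub_le_of_deriv hv hΛ (x := y) (y := y - s) (by linarith)
        ((abs_sub _ _).trans (by linarith))
      rw [sub_sub_cancel] at this
      exact this.trans (mul_le_mul_of_nonneg_left hs hΛ0)
    rw [abs_sub_comm]; exact this.trans hη2

end Mollify

/-! ### Testing on intervals -/

lemma isZeroMean_indicator {g : ℝ → ℝ} {a b β : ℝ} (hab : a ≤ b) (hg : Measurable g)
    (hβ : ∀ x ∈ Set.Icc a b, |g x| ≤ β) (h0 : ∫ x in a..b, g x = 0) :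
    IsZeroMean ((Set.Icc a b).indicator g) a b β where
  le := hab
  meas := hg.indicator measurableSet_Icc
  bound x := by
    by_cases h : x ∈ Set.Icc a b
    · rw [Set.indicator_of_mem h]; exact hβ x h
    · rw [Set.indicator_of_notMem h, abs_zero]
      exact (abs_nonneg _).trans (hβ a ⟨le_rfl, hab⟩)
  supp x hx := Set.indicator_of_notMem hx _
  mean := by
    rw [← h0]
    refine intervalIntegral.integral_congr fun x hx => ?_
    rw [Set.uIcc_of_le hab] at hx
    exact Set.indicator_of_mem hx _

lemma frc_continuous {w : ℝ → ℝ} (hw : ContDiff ℝ 2 w) : Continuous (frc w) := by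
  have h1 : Continuous w := hw.continuous
  have h2 : ContDiff ℝ 1 (deriv w) := by
    have : ContDiff ℝ (1 + 1) w := by norm_num; exact hw
    exact (contDiff_succ_iff_deriv.1 this).2.2
  have h3 : Continuous (deriv (deriv w)) := h2.continuous_deriv le_rfl
  unfold frc; fun_prop

lemma Tested.hasDerivAt {D A B : ℝ} {w : ℝ → ℝ} (h : Tested D A B w) (x : ℝ) :
    HasDerivAt w (deriv w x) x := (h.smooth.differentiable (by norm_num) x).hasDerivAt

lemma Tested.deriv_contDiff {D A B : ℝ} {w : ℝ → ℝ} (h : Tested D A B w) :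
    ContDiff ℝ 1 (deriv w) := by
  have : ContDiff ℝ (1 + 1) w := by norm_num; exact h.smooth
  exact (contDiff_succ_iff_deriv.1 this).2.2

lemma Tested.hasDerivAt₂ {D A B : ℝ} {w : ℝ → ℝ} (h : Tested D A B w) (x : ℝ) :
    HasDerivAt (deriv w) (deriv (deriv w) x) x :=
  (h.deriv_contDiff.differentiable (by norm_num) x).hasDerivAt

lemma Tested.continuous {D A B : ℝ} {w : ℝ → ℝ} (h : Tested D A B w) : Continuous w :=
  h.smooth.continuous

lemma Tested.continuous_deriv {D A B : ℝ} {w : ℝ → ℝ} (h : Tested D A B w) :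
    Continuous (deriv w) := h.deriv_contDiff.continuous

lemma Tested.continuous_deriv₂ {D A B : ℝ} {w : ℝ → ℝ} (h : Tested D A B w) :
    Continuous (deriv (deriv w)) := h.deriv_contDiff.continuous_deriv le_rfl

lemma sq_integral_le {g : ℝ → ℝ} {a b β : ℝ} (hab : a ≤ b)
    (hβ : ∀ x ∈ Set.Icc a b, |g x| ≤ β) : ∫ x in a..b, g x ^ 2 ≤ (b - a) * β ^ 2 := by
  have := intervalIntegral.norm_integral_le_of_norm_le_const (a := a) (b := b)
    (f := fun x => g x ^ 2) (C := β ^ 2) fun x hx => by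
      rw [Set.uIoc_of_le hab] at hx
      rw [Real.norm_eq_abs, abs_pow]
      exact pow_le_pow_left₀ (abs_nonneg _) (hβ x ⟨hx.1.le, hx.2⟩) 2
  rw [abs_of_nonneg (by linarith)] at this
  linarith [Real.le_norm_self (∫ x in a..b, g x ^ 2)]

section

variable {D A B : ℝ} {w : ℝ → ℝ}

lemma Tested.force_le (h : Tested D A B w) {g : ℝ → ℝ} {a b β p q : ℝ} (hab : a ≤ b) (ha : -B ≤ a)
    (hb : b ≤ B) (hg : Measurable g) (hβ : ∀ x ∈ Set.Icc a b, |g x| ≤ β)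
    (h0 : ∫ x in a..b, g x = 0) (hp : 0 < p) (hq : 0 < q)
    (h1 : ∫ x in a..b, (∫ s in a..x, g s) ^ 2 ≤ p ^ 2) (h2 : ∫ x in a..b, g x ^ 2 ≤ q ^ 2) :
    |∫ x in a..b, g x * frc w x| ≤ D * (Real.sqrt (p * q) + β / B) := by
  have hG := isZeroMean_indicator hab hg hβ h0
  have e0 : ∀ x ∈ Set.uIcc a b, (Set.Icc a b).indicator g x = g x := fun x hx => by
    rw [Set.uIcc_of_le hab] at hx; exact Set.indicator_of_mem hx _
  have e1 : ∀ x ∈ Set.uIcc a b, ∫ s in a..x, (Set.Icc a b).indicator g s = ∫ s in a..x, g s := by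
    intro x hx
    refine intervalIntegral.integral_congr fun s hs => e0 s ?_
    exact Set.uIcc_subset_uIcc_left hx hs
  have := h.force _ a b β hG ha hb p q hp hq
    ((intervalIntegral.integral_congr fun x hx => by simp only [e1 x hx]).trans_le h1)
    ((intervalIntegral.integral_congr fun x hx => by simp only [e0 x hx]).trans_le h2)
  rwa [intervalIntegral.integral_congr (g := fun x => g x * frc w x) fun x hx => by
    simp only [e0 x hx]] at this

lemma Tested.func_le (h : Tested D A B w) {g : ℝ → ℝ} {a b β p q : ℝ} (hab : a ≤ b) (ha : -B ≤ a)
    (hb : b ≤ B) (hg : Measurable g) (hβ : ∀ x ∈ Set.Icc a b, |g x| ≤ β)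
    (h0 : ∫ x in a..b, g x = 0) (hp : 0 < p) (hq : 0 < q)
    (h1 : ∫ x in a..b, (∫ s in a..x, g s) ^ 2 ≤ p ^ 2) (h2 : ∫ x in a..b, g x ^ 2 ≤ q ^ 2) :
    |∫ x in a..b, (∫ s in a..x, g s) * w x| ≤ D * (Real.sqrt (p * q) + p) := by
  have hG := isZeroMean_indicator hab hg hβ h0
  have e0 : ∀ x ∈ Set.uIcc a b, (Set.Icc a b).indicator g x = g x := fun x hx => by
    rw [Set.uIcc_of_le hab] at hx; exact Set.indicator_of_mem hx _
  have e1 : ∀ x ∈ Set.uIcc a b, ∫ s in a..x, (Set.Icc a b).indicator g s = ∫ s in a..x, g s := by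
    intro x hx
    refine intervalIntegral.integral_congr fun s hs => e0 s ?_
    exact Set.uIcc_subset_uIcc_left hx hs
  have := h.func _ a b β hG ha hb p q hp hq
    ((intervalIntegral.integral_congr fun x hx => by simp only [e1 x hx]).trans_le h1)
    ((intervalIntegral.integral_congr fun x hx => by simp only [e0 x hx]).trans_le h2)
  rwa [intervalIntegral.integral_congr (g := fun x => (∫ s in a..x, g s) * w x) fun x hx => by
    simp only [e1 x hx]] at this

/-- Testing the force with bounded functions. -/
lemma Tested.force_sup (h : Tested D A B w) (hD : 0 ≤ D) {g : ℝ → ℝ} {a b α β s : ℝ} (hab : a < b)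
    (ha : -B ≤ a) (hb : b ≤ B) (hg : Measurable g) (hα0 : 0 < α) (hβ0 : 0 < β)
    (hα : ∀ x ∈ Set.Icc a b, |∫ s in a..x, g s| ≤ α)
    (hβ : ∀ x ∈ Set.Icc a b, |g x| ≤ β) (h0 : ∫ x in a..b, g x = 0) (hs : 0 ≤ s)
    (hs2 : (b - a) * (α * β) ≤ s ^ 2) :
    |∫ x in a..b, g x * frc w x| ≤ D * (s + β / B) := by
  have hl : 0 < b - a := by linarith
  have hl2 := Real.sq_sqrt hl.le
  have hl3 := Real.sqrt_pos.2 hl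
  refine (h.force_le hab.le ha hb hg hβ h0 (p := Real.sqrt (b - a) * α)
    (q := Real.sqrt (b - a) * β) (by positivity) (by positivity) ?_ ?_).trans ?_
  · rw [mul_pow, hl2]; exact sq_integral_le hab.le hα
  · rw [mul_pow, hl2]; exact sq_integral_le hab.le hβ
  · refine mul_le_mul_of_nonneg_left (add_le_add ?_ le_rfl) hD
    rw [Real.sqrt_le_left hs]
    refine le_trans (le_of_eq ?_) hs2
    nth_rw 3 [← hl2]; ring

/-- Testing the function with bounded functions. -/
lemma Tested.func_sup (h : Tested D A B w) (hD : 0 ≤ D) {φ φ' : ℝ → ℝ} {a b α β s r : ℝ}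
    (hab : a < b) (ha : -B ≤ a) (hb : b ≤ B) (hφ : ∀ x, HasDerivAt φ (φ' x) x)
    (hφ' : Continuous φ') (h1 : φ a = 0) (h2 : φ b = 0) (hα0 : 0 < α) (hβ0 : 0 < β)
    (hα : ∀ x ∈ Set.Icc a b, |φ x| ≤ α)
    (hβ : ∀ x ∈ Set.Icc a b, |φ' x| ≤ β) (hs : 0 ≤ s)
    (hs2 : (b - a) * (α * β) ≤ s ^ 2) (hr : 0 ≤ r) (hr2 : (b - a) * α ^ 2 ≤ r ^ 2) :
    |∫ x in a..b, φ x * w x| ≤ D * (s + r) := by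
  have hl : 0 < b - a := by linarith
  have hl2 := Real.sq_sqrt hl.le
  have hl3 := Real.sqrt_pos.2 hl
  have e : ∀ x, ∫ s in a..x, φ' s = φ x := fun x => by
    rw [intervalIntegral.integral_eq_sub_of_hasDerivAt (fun y _ => hφ y)
      (hφ'.intervalIntegrable _ _), h1, sub_zero]
  have := h.func_le hab.le ha hb hφ'.measurable hβ (by rw [e, h2]) (p := Real.sqrt (b - a) * α)
    (q := Real.sqrt (b - a) * β) (by positivity) (by positivity)
    (by simp_rw [e]; rw [mul_pow, hl2]; exact sq_integral_le hab.le hα)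
    (by rw [mul_pow, hl2]; exact sq_integral_le hab.le hβ)
  simp_rw [e] at this
  refine this.trans (mul_le_mul_of_nonneg_left (add_le_add ?_ ?_) hD)
  · rw [Real.sqrt_le_left hs]
    refine le_trans (le_of_eq ?_) hs2
    nth_rw 3 [← hl2]; ring
  · refine (Real.le_sqrt' (by positivity)).2 ?_ |>.trans (Real.sqrt_sq hr).le
    rw [mul_pow, hl2]; exact hr2

/-! ### Averages of the force -/

/-- A bounded probability density on `[u, U]`. -/
structure IsWeight (W : ℝ → ℝ) (u U β : ℝ) : Prop where
  meas : Measurable W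
  nonneg : ∀ x, 0 ≤ W x
  le : ∀ x, W x ≤ β
  mass : ∫ x in u..U, W x = 1

lemma IsWeight.intervalIntegrable {W : ℝ → ℝ} {u U β : ℝ} (h : IsWeight W u U β) (a b : ℝ) :
    IntervalIntegrable W volume a b := by
  rw [intervalIntegrable_iff]
  exact Measure.integrableOn_of_bounded (M := β) (by simp) h.meas.aestronglyMeasurable
    (Eventually.of_forall fun x => by rw [Real.norm_of_nonneg (h.nonneg x)]; exact h.le x)

lemma IsWeight.primitive_mem {W : ℝ → ℝ} {u U β : ℝ} (h : IsWeight W u U β) {x : ℝ}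
    (hx : x ∈ Set.Icc u U) : 0 ≤ ∫ s in u..x, W s ∧ ∫ s in u..x, W s ≤ 1 := by
  have h1 : 0 ≤ ∫ s in u..x, W s := intervalIntegral.integral_nonneg hx.1 fun s _ => h.nonneg s
  have h2 : 0 ≤ ∫ s in x..U, W s := intervalIntegral.integral_nonneg hx.2 fun s _ => h.nonneg s
  have := intervalIntegral.integral_add_adjacent_intervals (h.intervalIntegrable u x)
    (h.intervalIntegrable x U)
  rw [h.mass] at this
  exact ⟨h1, by linarith⟩

/-- Averages of the force with respect to two densities are close. -/
lemma Tested.weight_compare (h : Tested D A B w) (hD : 0 ≤ D) {W₁ W₂ : ℝ → ℝ} {u U β₁ β₂ s : ℝ}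
    (h1 : IsWeight W₁ u U β₁) (h2 : IsWeight W₂ u U β₂) (hβ₁ : 0 < β₁) (hβ₂ : 0 < β₂) (huU : u < U)
    (hu : -B ≤ u) (hU : U ≤ B) (hs : 0 ≤ s) (hs2 : (U - u) * (β₁ + β₂) ≤ s ^ 2) :
    |(∫ x in u..U, W₁ x * frc w x) - ∫ x in u..U, W₂ x * frc w x|
      ≤ D * (s + (β₁ + β₂) / B) := by
  have hf := frc_continuous h.smooth
  rw [← intervalIntegral.integral_sub ((h1.intervalIntegrable u U).mul_continuousOn hf.continuousOn)
    ((h2.intervalIntegrable u U).mul_continuousOn hf.continuousOn)]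
  have e : ∀ x, ∫ s in u..x, (W₁ s - W₂ s) = (∫ s in u..x, W₁ s) - ∫ s in u..x, W₂ s := fun x =>
    intervalIntegral.integral_sub (h1.intervalIntegrable u x) (h2.intervalIntegrable u x)
  -- The primitive is a difference of two distribution functions with values in `[0, 1]`, hence `α =
  -- 1`. The resulting condition is scale invariant.
  have := h.force_sup hD (g := fun x => W₁ x - W₂ x) (α := 1) (β := β₁ + β₂) huU hu hU
    (h1.meas.sub h2.meas) one_pos (by positivity) (fun x hx => by
      rw [e, abs_le]
      have m1 := h1.primitive_mem hx
      have m2 := h2.primitive_mem hx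
      constructor <;> linarith [m1.1, m1.2, m2.1, m2.2])
    (fun x _ => by
      rw [abs_le]
      constructor <;> linarith [h1.nonneg x, h2.nonneg x, h1.le x, h2.le x])
    (by rw [e, h1.mass, h2.mass, sub_self]) hs (by rwa [one_mul])
  simpa only [sub_mul] using this

/-- The normalized indicator function of an interval. -/
def box (a b : ℝ) : ℝ → ℝ := (Set.Ioc a b).indicator fun _ => (b - a)⁻¹

lemma integral_indicator_mul {a b u U : ℝ} (hab : a ≤ b) (hu : u ≤ a) (hU : b ≤ U) (g V : ℝ → ℝ) :
    ∫ x in u..U, (Set.Ioc a b).indicator g x * V x = ∫ x in a..b, g x * V x := by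
  have huU : u ≤ U := hu.trans (hab.trans hU)
  rw [intervalIntegral.integral_of_le huU, intervalIntegral.integral_of_le hab]
  have : ∀ x, (Set.Ioc a b).indicator g x * V x = (Set.Ioc a b).indicator (fun x => g x * V x) x :=
    fun x => by
      by_cases hx : x ∈ Set.Ioc a b
      · simp [hx]
      · simp [hx]
  simp_rw [this]
  rw [setIntegral_indicator measurableSet_Ioc, Set.inter_eq_self_of_subset_right
    (Set.Ioc_subset_Ioc hu hU)]

lemma box_mul_integral {a b u U : ℝ} (hab : a ≤ b) (hu : u ≤ a) (hU : b ≤ U) (V : ℝ → ℝ) :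
    ∫ x in u..U, box a b x * V x = (b - a)⁻¹ * ∫ x in a..b, V x := by
  unfold box
  rw [integral_indicator_mul hab hu hU, intervalIntegral.integral_const_mul]

lemma isWeight_box {a b u U : ℝ} (hab : a < b) (hu : u ≤ a) (hU : b ≤ U) :
    IsWeight (box a b) u U (b - a)⁻¹ where
  meas := measurable_const.indicator measurableSet_Ioc
  nonneg x := Set.indicator_nonneg (fun _ _ => inv_nonneg.2 (by linarith)) x
  le x := Set.indicator_le_self' (fun _ _ => inv_nonneg.2 (by linarith)) x
  mass := by
    have := box_mul_integral hab.le hu hU fun _ => 1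
    simp only [mul_one, intervalIntegral.integral_const, smul_eq_mul] at this
    rw [this, inv_mul_cancel₀ (by linarith)]

/-- Mean value of the force over an interval. -/
def avg (w : ℝ → ℝ) (a b : ℝ) : ℝ := (b - a)⁻¹ * ∫ x in a..b, frc w x

lemma Tested.avg_compare (h : Tested D A B w) (hD : 0 ≤ D) {a b c d u U s : ℝ} (hab : a < b)
    (hcd : c < d) (hua : u ≤ a) (hbU : b ≤ U) (huc : u ≤ c) (hdU : d ≤ U) (hu : -B ≤ u)
    (hU : U ≤ B) (hs : 0 ≤ s) (hs2 : (U - u) * ((b - a)⁻¹ + (d - c)⁻¹) ≤ s ^ 2) :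
    |avg w a b - avg w c d| ≤ D * (s + ((b - a)⁻¹ + (d - c)⁻¹) / B) := by
  have := h.weight_compare hD (isWeight_box hab hua hbU) (isWeight_box hcd huc hdU)
    (inv_pos.2 (by linarith)) (inv_pos.2 (by linarith)) (by linarith) hu hU hs hs2
  rwa [box_mul_integral hab.le hua hbU, box_mul_integral hcd.le huc hdU] at this

/-- A twice differentiable probability density on `[-1, 1]`, with its derivatives. -/
def hump (x : ℝ) : ℝ := 315 / 256 * (1 - x ^ 2) ^ 4
def hump₁ (x : ℝ) : ℝ := 315 / 256 * (-8 * x * (1 - x ^ 2) ^ 3)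
def hump₂ (x : ℝ) : ℝ := 315 / 256 * (-8 * (1 - x ^ 2) ^ 3 + 48 * x ^ 2 * (1 - x ^ 2) ^ 2)
def hump₃ (x : ℝ) : ℝ := 315 / 256 * (144 * x * (1 - x ^ 2) ^ 2 - 192 * x ^ 3 * (1 - x ^ 2))

lemma one_sub_sq_hasDerivAt (x : ℝ) (n : ℕ) :
    HasDerivAt (fun x : ℝ => (1 - x ^ 2) ^ n) (n * (1 - x ^ 2) ^ (n - 1) * (-(2 * x))) x := by
  have h1 : HasDerivAt (fun x : ℝ => 1 - x ^ 2) (-(2 * x)) x := by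
    simpa using (hasDerivAt_pow 2 x).const_sub 1
  exact h1.pow n

lemma hump_hasDerivAt (x : ℝ) : HasDerivAt hump (hump₁ x) x := by
  refine ((one_sub_sq_hasDerivAt x 4).const_mul (315 / 256)).congr_deriv ?_
  simp [hump₁]; ring

lemma hump₁_hasDerivAt (x : ℝ) : HasDerivAt hump₁ (hump₂ x) x := by
  refine ((((hasDerivAt_id x).const_mul (-8)).mul (one_sub_sq_hasDerivAt x 3)).const_mul
    (315 / 256)).congr_deriv ?_
  simp [hump₂]; ring

lemma hump₂_hasDerivAt (x : ℝ) : HasDerivAt hump₂ (hump₃ x) x := by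
  refine ((((one_sub_sq_hasDerivAt x 3).const_mul (-8)).add
    (((hasDerivAt_pow 2 x).const_mul 48).mul (one_sub_sq_hasDerivAt x 2))).const_mul
    (315 / 256)).congr_deriv ?_
  simp [hump₃]; ring

lemma hump_mass : ∫ x in (-1 : ℝ)..1, hump x = 1 := by
  have : ∀ x ∈ Set.uIcc (-1 : ℝ) 1, HasDerivAt (fun x : ℝ => 315 / 256 *
      (x - 4 / 3 * x ^ 3 + 6 / 5 * x ^ 5 - 4 / 7 * x ^ 7 + x ^ 9 / 9)) (hump x) x := fun x _ => by
    refine ((((((hasDerivAt_id x).sub ((hasDerivAt_pow 3 x).const_mul (4 / 3))).add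
      ((hasDerivAt_pow 5 x).const_mul (6 / 5))).sub ((hasDerivAt_pow 7 x).const_mul (4 / 7))).add
      ((hasDerivAt_pow 9 x).div_const 9)).const_mul (315 / 256)).congr_deriv ?_
    simp [hump]; ring
  have hc : Continuous hump := by unfold hump; fun_prop
  rw [intervalIntegral.integral_eq_sub_of_hasDerivAt this (hc.intervalIntegrable _ _)]
  norm_num

/-- The mean of the force near the origin is controlled by the function. -/
lemma exists_hump_le : ∃ C, 0 < C ∧ ∀ D A B : ℝ, ∀ w : ℝ → ℝ, 0 ≤ D → 0 ≤ A → 1 ≤ B →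
    A ^ 2 ≤ D → Tested D A B w → |∫ x in (-1 : ℝ)..1, hump x * frc w x| ≤ C * D := by
  have c0 : Continuous hump := by unfold hump; fun_prop
  have c1 : Continuous hump₁ := by unfold hump₁; fun_prop
  have c2 : Continuous hump₂ := by unfold hump₂; fun_prop
  have c3 : Continuous hump₃ := by unfold hump₃; fun_prop
  obtain ⟨α, hα⟩ := (isCompact_Icc (a := (-1 : ℝ)) (b := 1)).exists_bound_of_continuousOn
    (f := fun x => x * hump x - 3 * hump₂ x) (by fun_prop)
  obtain ⟨β, hβ⟩ := (isCompact_Icc (a := (-1 : ℝ)) (b := 1)).exists_bound_of_continuousOn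
    (f := fun x => (1 * hump x + x * hump₁ x) - 3 * hump₃ x) (by fun_prop)
  have hα0 : 0 ≤ α := (norm_nonneg _).trans (hα 0 (by simp))
  have hβ0 : 0 ≤ β := (norm_nonneg _).trans (hβ 0 (by simp))
  refine ⟨2 * (α + β + 1) + 2 * (α + β + 1) + 9, by positivity, fun D A B w hD hA hB hAD h => ?_⟩
  have hw := h.continuous
  have hw1 := h.continuous_deriv
  have hw2 := h.continuous_deriv₂
  -- The linear part of the operator is moved onto the density. The fourth power in `hump` makes the
  -- second derivative vanish at `±1`, as the endpoint conditions require.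
  have main := h.func_sup hD (φ := fun x => x * hump x - 3 * hump₂ x)
    (φ' := fun x => (1 * hump x + x * hump₁ x) - 3 * hump₃ x) (a := -1) (b := 1)
    (α := α + β + 1) (β := α + β + 1) (s := 2 * (α + β + 1)) (r := 2 * (α + β + 1))
    (by norm_num) (by linarith) hB
    (fun x => ((hasDerivAt_id x).mul (hump_hasDerivAt x)).sub ((hump₂_hasDerivAt x).const_mul 3))
    (by fun_prop) (by simp [hump, hump₂]) (by simp [hump, hump₂]) (by positivity) (by positivity)
    (fun x hx => (hα x hx).trans (by linarith)) (fun x hx => (hβ x hx).trans (by linarith))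
    (by positivity) (by nlinarith) (by positivity) (by nlinarith)
  have ibp : ∫ x in (-1 : ℝ)..1, hump x * deriv (deriv w) x = ∫ x in (-1 : ℝ)..1, hump₂ x * w x := by
    have i1 := intervalIntegral.integral_mul_deriv_eq_deriv_mul (a := -1) (b := 1)
      (fun x _ => hump_hasDerivAt x) (fun x _ => h.hasDerivAt₂ x) (c1.intervalIntegrable _ _)
      (hw2.intervalIntegrable _ _)
    have i2 := intervalIntegral.integral_mul_deriv_eq_deriv_mul (a := -1) (b := 1)
      (fun x _ => hump₁_hasDerivAt x) (fun x _ => h.hasDerivAt x) (c2.intervalIntegrable _ _)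
      (hw1.intervalIntegrable _ _)
    have z1 : hump 1 = 0 := by norm_num [hump]
    have z2 : hump (-1) = 0 := by norm_num [hump]
    have z3 : hump₁ 1 = 0 := by norm_num [hump₁]
    have z4 : hump₁ (-1) = 0 := by norm_num [hump₁]
    rw [i1, i2, z1, z2, z3, z4]
    ring
  have e : ∫ x in (-1 : ℝ)..1, hump x * frc w x
      = (∫ x in (-1 : ℝ)..1, (x * hump x - 3 * hump₂ x) * w x)
        + ∫ x in (-1 : ℝ)..1, 9 * (hump x * w x ^ 2) := by
    have : ∫ x in (-1 : ℝ)..1, (x * hump x - 3 * hump₂ x) * w x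
        = (∫ x in (-1 : ℝ)..1, x * hump x * w x) - 3 * ∫ x in (-1 : ℝ)..1, hump₂ x * w x := by
      rw [← intervalIntegral.integral_const_mul, ← intervalIntegral.integral_sub]
      · refine intervalIntegral.integral_congr fun x _ => ?_
        ring
      all_goals exact Continuous.intervalIntegrable (by fun_prop) _ _
    rw [this, ← ibp, ← intervalIntegral.integral_const_mul, ← intervalIntegral.integral_sub,
      ← intervalIntegral.integral_add]
    · refine intervalIntegral.integral_congr fun x _ => ?_
      simp only [frc]; ring
    all_goals exact Continuous.intervalIntegrable (by fun_prop) _ _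
  -- The quadratic term is harmless because `A ^ 2 ≤ D`.
  have e2 : |∫ x in (-1 : ℝ)..1, 9 * (hump x * w x ^ 2)| ≤ 9 * D := by
    have hn : 0 ≤ ∫ x in (-1 : ℝ)..1, 9 * (hump x * w x ^ 2) :=
      intervalIntegral.integral_nonneg (by norm_num) fun x _ => by unfold hump; positivity
    rw [abs_of_nonneg hn]
    have : ∫ x in (-1 : ℝ)..1, 9 * (hump x * w x ^ 2) ≤ ∫ x in (-1 : ℝ)..1, 9 * A ^ 2 * hump x := by
      refine intervalIntegral.integral_mono_on (by norm_num)
        (Continuous.intervalIntegrable (by fun_prop) _ _)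
        (Continuous.intervalIntegrable (by fun_prop) _ _) fun x _ => ?_
      have h1 : 0 ≤ hump x := by unfold hump; positivity
      have h2 : w x ^ 2 ≤ A ^ 2 := sq_le_sq' (by
        have := (h.bound x).trans (mul_le_of_le_one_right hA (jb_rpow_neg_le_one x))
        linarith [neg_abs_le (w x)])
        ((le_abs_self _).trans ((h.bound x).trans (mul_le_of_le_one_right hA (jb_rpow_neg_le_one x))))
      nlinarith
    rw [intervalIntegral.integral_const_mul (9 * A ^ 2), hump_mass] at this
    linarith
  rw [e]
  have := abs_add_le (∫ x in (-1 : ℝ)..1, (x * hump x - 3 * hump₂ x) * w x)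
    (∫ x in (-1 : ℝ)..1, 9 * (hump x * w x ^ 2))
  linarith

lemma hump_nonneg (x : ℝ) : 0 ≤ hump x := by unfold hump; positivity

lemma isWeight_hump {S : ℝ} (hS : 1 ≤ S) :
    IsWeight ((Set.Ioc (-1) 1).indicator hump) (-S) S 2 where
  meas := by
    have : Continuous hump := by unfold hump; fun_prop
    exact this.measurable.indicator measurableSet_Ioc
  nonneg x := Set.indicator_nonneg (fun x _ => hump_nonneg x) x
  le x := by
    refine Set.indicator_apply_le' (fun hx => ?_) fun _ => by norm_num
    have h1 : 0 ≤ 1 - x ^ 2 := by nlinarith [hx.1, hx.2]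
    have h2 : (1 - x ^ 2) ^ 4 ≤ 1 := pow_le_one₀ h1 (by nlinarith)
    unfold hump; linarith
  mass := by
    have := integral_indicator_mul (a := -1) (b := 1) (u := -S) (U := S) (by norm_num)
      (by linarith) hS hump fun _ => 1
    simpa [hump_mass] using this

/-- Averages of the force over intervals that are not short. -/
lemma exists_avg_le : ∃ C, 0 < C ∧ ∀ D A B : ℝ, ∀ w : ℝ → ℝ, 0 ≤ D → 0 ≤ A → 1 ≤ B →
    A ^ 2 ≤ D → Tested D A B w → ∀ a b S σ : ℝ, 1 ≤ σ → S = σ ^ 2 → S ≤ B → -S ≤ a → b ≤ S →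
    1 / 16 ≤ b - a → |avg w a b| ≤ C * D * σ := by
  obtain ⟨C, hC, hump⟩ := exists_hump_le
  refine ⟨24 + C, by positivity, fun D A B w hD hA hB hAD h a b S σ hσ hS hSB ha hb hab => ?_⟩
  have hS1 : 1 ≤ S := by nlinarith
  have h1 := hump D A B w hD hA hB hAD h
  have hinv : (b - a)⁻¹ ≤ 16 := by
    rw [inv_le_comm₀ (by linarith) (by norm_num)]; linarith
  -- The densities are at most `16` and `2` on an interval of length `2 σ ^ 2`, and `2 σ ^ 2 * 18 =
  -- (6 σ) ^ 2`.
  have h2 := h.weight_compare hD (isWeight_box (a := a) (b := b) (u := -S) (U := S) (by linarith) ha hb)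
    (isWeight_hump hS1) (s := 6 * σ) (inv_pos.2 (by linarith)) two_pos (by linarith) (by linarith) hSB
    (by positivity) (by nlinarith)
  rw [box_mul_integral (by linarith) ha hb, integral_indicator_mul (by norm_num) (by linarith) hS1]
    at h2
  have h3 : ((b - a)⁻¹ + 2) / B ≤ 18 := by
    rw [div_le_iff₀ (by linarith)]; nlinarith
  have h4 : D * (6 * σ + ((b - a)⁻¹ + 2) / B) ≤ D * (24 * σ) :=
    mul_le_mul_of_nonneg_left (by linarith) hD
  have h5 := abs_sub_abs_le_abs_sub (avg w a b) (∫ x in (-1 : ℝ)..1, KdV.hump x * frc w x)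
  have h6 : |avg w a b - ∫ x in (-1 : ℝ)..1, KdV.hump x * frc w x| ≤ D * (24 * σ) := h2.trans h4
  have h7 : C * D ≤ C * D * σ := le_mul_of_one_le_right (by positivity) hσ
  nlinarith

/-- Averages over dyadically growing intervals. -/
lemma Tested.avg_chain (h : Tested D A B w) (hD : 0 ≤ D) {a L : ℝ} (hL : 0 < L) (hLB : L⁻¹ ≤ B)
    (ha : -B ≤ a) (n : ℕ) (hn : a + 2 ^ n * L ≤ B) :
    |avg w a (a + L) - avg w a (a + 2 ^ n * L)| ≤ 4 * D * n := by
  induction n with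
  | zero => simp
  | succ n ih =>
    have hp : (1 : ℝ) ≤ 2 ^ n := one_le_pow₀ (by norm_num)
    have e : (2 : ℝ) ^ (n + 1) * L = 2 * (2 ^ n * L) := by ring
    rw [e] at hn ⊢
    set M := (2 : ℝ) ^ n * L with hM
    have hM0 : L ≤ M := by nlinarith
    clear_value M
    have hMp : 0 < M := by linarith
    have h1 := ih (by linarith)
    have hMi : M⁻¹ ≤ B := (inv_anti₀ hL hM0).trans hLB
    have hMi0 := inv_pos.2 hMp
    -- Doubling costs a bounded multiple of `D` at every scale: `2 M * (1 / M + 1 / (2 M)) = 3 ≤ 2 ^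
    -- 2`.
    have h2 := h.avg_compare hD (a := a) (b := a + M) (c := a) (d := a + 2 * M) (u := a)
      (U := a + 2 * M) (s := 2) (by linarith) (by linarith) le_rfl (by linarith) le_rfl le_rfl ha hn
      (by norm_num) (by
        simp only [add_sub_cancel_left]
        field_simp; norm_num)
    simp only [add_sub_cancel_left] at h2
    have h3 : (M⁻¹ + (2 * M)⁻¹) / B ≤ 2 := by
      rw [div_le_iff₀ (by linarith), mul_inv]; linarith
    have h4 := abs_sub_le (avg w a (a + L)) (avg w a (a + M)) (avg w a (a + 2 * M))
    have h5 : D * (2 + (M⁻¹ + (2 * M)⁻¹) / B) ≤ D * 4 := mul_le_mul_of_nonneg_left (by linarith) hD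
    push_cast
    linarith

/-- Since `h ≥ 1 / R`, going from `h` to `R` takes at most `2 log₂ R` doublings, and `log 2 ≥ 1/2`
turns this into `4 log R`. -/
lemma exists_dyadic_le {R h : ℝ} (hR : 2 ≤ R) (h0 : R⁻¹ ≤ h) (h1 : h ≤ 1) :
    ∃ n : ℕ, 2 ^ n * h ≤ R ∧ R / 2 < 2 ^ n * h ∧ (n : ℝ) ≤ 4 * Real.log R := by
  have hR0 : 0 < R := by linarith
  have hh : 0 < h := (inv_pos.2 hR0).trans_le h0
  obtain ⟨n, hn1, hn2⟩ := exists_nat_pow_near (x := R / h) (y := 2)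
    (by rw [le_div_iff₀ hh]; linarith) one_lt_two
  rw [le_div_iff₀ hh] at hn1
  rw [div_lt_iff₀ hh, pow_succ] at hn2
  refine ⟨n, hn1, by linarith, ?_⟩
  have h2 : (2 : ℝ) ^ n ≤ R ^ 2 := by
    have : 2 ^ n * R⁻¹ ≤ R := (mul_le_mul_of_nonneg_left h0 (by positivity)).trans hn1
    rw [← div_eq_mul_inv, div_le_iff₀ hR0] at this
    nlinarith
  have h3 := Real.log_le_log (by positivity) h2
  rw [Real.log_pow, Real.log_pow] at h3
  have h4 : (1 / 2 : ℝ) ≤ Real.log 2 := by linarith [Real.log_two_gt_d9]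
  have h5 : (n : ℝ) * (1 / 2) ≤ n * Real.log 2 := mul_le_mul_of_nonneg_left h4 (by positivity)
  push_cast at h3
  linarith

/-- Averages of the force over short intervals grow at most logarithmically. -/
lemma exists_avg_le_log : ∃ C, 0 < C ∧ ∀ D A B : ℝ, ∀ w : ℝ → ℝ, 0 ≤ D → 0 ≤ A → 1 ≤ B →
    A ^ 2 ≤ D → Tested D A B w → ∀ R y h : ℝ, 2 ≤ R → 2 * R ≤ B → 0 ≤ y → y ≤ R → R⁻¹ ≤ h → h ≤ 1 →
    |avg w y (y + h)| ≤ C * D * (1 + Real.log R) := by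
  obtain ⟨C, hC, hC'⟩ := exists_avg_le
  refine ⟨C + 40, by positivity, fun D A B w hD hA hB hAD ht R y h hR hRB hy hyR h0 h1 => ?_⟩
  have hR0 : 0 < R := by linarith
  have hh : 0 < h := (inv_pos.2 hR0).trans_le h0
  have hB0 : 0 < B := by linarith
  -- The chain climbs from the short interval at `y` to length about `R`, jumps at bounded cost to
  -- an interval of similar length starting at `0`, and descends to `[0, 1]`, where the average is
  -- known.
  obtain ⟨n, hn1, hn2, hn3⟩ := exists_dyadic_le hR h0 h1
  obtain ⟨m, hm1, hm2, hm3⟩ := exists_dyadic_le hR (h := 1) (inv_le_one_of_one_le₀ (by linarith)) le_rfl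
  have a1 := ht.avg_chain hD (a := y) hh (by
    rw [inv_le_comm₀ hh hB0]
    exact (inv_anti₀ hR0 (by linarith)).trans h0) (by linarith) n (by linarith)
  have a2 := ht.avg_chain hD (a := 0) (L := 1) one_pos (by simpa using hB) (by linarith) m (by linarith)
  have a3 := hC' D A B w hD hA hB hAD ht 0 1 1 1 le_rfl (by norm_num) hB (by norm_num) le_rfl
    (by norm_num)
  simp only [zero_add, mul_one] at a2 a3
  have i1 : (y + 2 ^ n * h - y)⁻¹ ≤ 2 / R := by
    rw [add_sub_cancel_left, inv_eq_one_div, div_le_div_iff₀ (by linarith) hR0]; linarith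
  have i2 : ((2 : ℝ) ^ m - 0)⁻¹ ≤ 2 / R := by
    rw [sub_zero, inv_eq_one_div, div_le_div_iff₀ (by positivity) hR0]; linarith
  have i3 : 2 / R ≤ 1 := by rw [div_le_one hR0]; exact hR
  -- Both intervals are longer than `R / 2` and lie in `[0, 2R]`: `2 R * (4 / R) = 8 ≤ 3 ^ 2`.
  have a4 := ht.avg_compare hD (a := y) (b := y + 2 ^ n * h) (c := 0) (d := 2 ^ m) (u := 0)
    (U := 2 * R) (s := 3) (by linarith) (by positivity) hy (by linarith) le_rfl (by linarith)
    (by linarith) hRB (by norm_num) (by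
      have : 2 * R * (2 / R) = 4 := by field_simp; norm_num
      nlinarith)
  have i4 : ((y + 2 ^ n * h - y)⁻¹ + ((2 : ℝ) ^ m - 0)⁻¹) / B ≤ 2 := by
    rw [div_le_iff₀ hB0]; nlinarith
  have a5 : |avg w y (y + 2 ^ n * h) - avg w 0 (2 ^ m)| ≤ D * 5 :=
    a4.trans (mul_le_mul_of_nonneg_left (by linarith) hD)
  have hlog : 0 ≤ Real.log R := Real.log_nonneg (by linarith)
  have b1 : 4 * D * n ≤ 4 * D * (4 * Real.log R) := mul_le_mul_of_nonneg_left hn3 (by positivity)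
  have b2 : 4 * D * m ≤ 4 * D * (4 * Real.log R) := mul_le_mul_of_nonneg_left hm3 (by positivity)
  have t1 := abs_sub_abs_le_abs_sub (avg w y (y + h)) (avg w y (y + 2 ^ n * h))
  have t2 := abs_sub_abs_le_abs_sub (avg w y (y + 2 ^ n * h)) (avg w 0 (2 ^ m))
  have t3 := abs_sub_abs_le_abs_sub (avg w 0 (2 ^ m)) (avg w 0 1)
  rw [abs_sub_comm (avg w 0 (2 ^ m))] at t3
  have hDl : 0 ≤ D * Real.log R := mul_nonneg hD hlog
  have hCl : 0 ≤ C * D * Real.log R := by positivity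
  nlinarith

end

/-! ### Local mass and energy estimates -/

/-- A `C¹` cutoff supported in `[m - L, m + L]`, with its derivatives inside the interval. -/
def cap (m L y : ℝ) : ℝ := (1 - ((y - m) / L) ^ 2) ^ 2
def cap₁ (m L y : ℝ) : ℝ := -(4 / L) * (((y - m) / L) * (1 - ((y - m) / L) ^ 2))
def cap₂ (m L y : ℝ) : ℝ := (4 / L ^ 2) * (3 * ((y - m) / L) ^ 2 - 1)

lemma cap_hasDerivAt (m L y : ℝ) : HasDerivAt (cap m L) (cap₁ m L y) y := by
  have h : HasDerivAt (fun y : ℝ => (y - m) / L) (1 / L) y := ((hasDerivAt_id y).sub_const m).div_const L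
  refine (((h.pow 2).const_sub 1).pow 2).congr_deriv ?_
  simp [cap₁]; ring

lemma cap₁_hasDerivAt (m L y : ℝ) : HasDerivAt (cap₁ m L) (cap₂ m L y) y := by
  have h : HasDerivAt (fun y : ℝ => (y - m) / L) (1 / L) y := ((hasDerivAt_id y).sub_const m).div_const L
  refine ((h.mul ((h.pow 2).const_sub 1)).const_mul (-(4 / L))).congr_deriv ?_
  simp [cap₂]; ring

lemma cap_continuous (m L : ℝ) : Continuous (cap m L) := by unfold cap; fun_prop
lemma cap₁_continuous (m L : ℝ) : Continuous (cap₁ m L) := by unfold cap₁; fun_prop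
lemma cap₂_continuous (m L : ℝ) : Continuous (cap₂ m L) := by unfold cap₂; fun_prop

lemma cap_arg_sq_le {m L y : ℝ} (hL : 0 < L) (hy : y ∈ Set.Icc (m - L) (m + L)) :
    ((y - m) / L) ^ 2 ≤ 1 := by
  rw [sq_le_one_iff_abs_le_one, abs_div, abs_of_pos hL, div_le_one hL, abs_le]
  constructor <;> linarith [hy.1, hy.2]

lemma cap_nonneg (m L y : ℝ) : 0 ≤ cap m L y := sq_nonneg _

lemma cap_le_one {m L y : ℝ} (hL : 0 < L) (hy : y ∈ Set.Icc (m - L) (m + L)) : cap m L y ≤ 1 := by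
  have := cap_arg_sq_le hL hy
  exact pow_le_one₀ (by linarith) (by linarith [sq_nonneg ((y - m) / L)])

lemma abs_cap₁_le {m L y : ℝ} (hL : 0 < L) (hy : y ∈ Set.Icc (m - L) (m + L)) :
    |cap₁ m L y| ≤ 4 / L := by
  have := cap_arg_sq_le hL hy
  unfold cap₁
  rw [abs_mul, abs_neg, abs_of_pos (by positivity : 0 < 4 / L), abs_mul,
    abs_of_nonneg (by linarith : 0 ≤ 1 - ((y - m) / L) ^ 2)]
  refine mul_le_of_le_one_right (by positivity) (mul_le_one₀ ?_ (by linarith) ?_)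
  · exact sq_le_one_iff_abs_le_one _ |>.1 this
  · linarith [sq_nonneg ((y - m) / L)]

lemma abs_cap₂_le {m L y : ℝ} (hL : 0 < L) (hy : y ∈ Set.Icc (m - L) (m + L)) :
    |cap₂ m L y| ≤ 8 / L ^ 2 := by
  have := cap_arg_sq_le hL hy
  unfold cap₂
  rw [abs_mul, abs_of_pos (by positivity : 0 < 4 / L ^ 2), show 8 / L ^ 2 = 4 / L ^ 2 * 2 by ring]
  refine mul_le_mul_of_nonneg_left ?_ (by positivity)
  rw [abs_le]; constructor <;> linarith [sq_nonneg ((y - m) / L)]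

lemma cap_left (m : ℝ) {L : ℝ} (hL : 0 < L) : cap m L (m - L) = 0 := by
  have : (m - L - m) / L = -1 := by field_simp; ring
  rw [cap, this]; norm_num

lemma cap_right (m : ℝ) {L : ℝ} (hL : 0 < L) : cap m L (m + L) = 0 := by
  have : (m + L - m) / L = 1 := by field_simp; ring
  rw [cap, this]; norm_num

lemma cap₁_left (m : ℝ) {L : ℝ} (hL : 0 < L) : cap₁ m L (m - L) = 0 := by
  have : (m - L - m) / L = -1 := by field_simp; ring
  rw [cap₁, this]; norm_num

lemma cap₁_right (m : ℝ) {L : ℝ} (hL : 0 < L) : cap₁ m L (m + L) = 0 := by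
  have : (m + L - m) / L = 1 := by field_simp; ring
  rw [cap₁, this]; norm_num

lemma integral_middle_le {m L : ℝ} (hL : 0 < L) {F : ℝ → ℝ} (hF : Continuous F)
    (h0 : ∀ y, 0 ≤ F y) :
    ∫ y in (m - L / 2)..(m + L / 2), F y ≤ 2 * ∫ y in (m - L)..(m + L), cap m L y * F y := by
  have hc := cap_continuous m L
  rw [← intervalIntegral.integral_const_mul]
  refine le_trans (intervalIntegral.integral_mono_on (g := fun y => 2 * (cap m L y * F y))
    (by linarith) (hF.intervalIntegrable _ _) (Continuous.intervalIntegrable (by fun_prop) _ _)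
    fun y hy => ?_) ?_
  · have : ((y - m) / L) ^ 2 ≤ 1 / 4 := by
      rw [div_pow, div_le_iff₀ (by positivity)]
      nlinarith [hy.1, hy.2]
    have h1 : 1 / 2 ≤ cap m L y := by unfold cap; nlinarith
    nlinarith [h0 y]
  · refine intervalIntegral.integral_mono_interval (by linarith) (by linarith) (by linarith)
      (Eventually.of_forall fun y => ?_) (Continuous.intervalIntegrable (by fun_prop) _ _)
    exact mul_nonneg zero_le_two (mul_nonneg (cap_nonneg _ _ _) (h0 y))

lemma intervalIntegral_abs_le {F : ℝ → ℝ} {a b c : ℝ} (hab : a ≤ b)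
    (h : ∀ x ∈ Set.Icc a b, |F x| ≤ c) : |∫ x in a..b, F x| ≤ c * (b - a) := by
  have := intervalIntegral.norm_integral_le_of_norm_le_const (a := a) (b := b) (f := F) (C := c)
    fun x hx => by
      rw [Set.uIoc_of_le hab] at hx
      exact h x ⟨hx.1.le, hx.2⟩
  rwa [abs_of_nonneg (by linarith)] at this

section

variable {D A B : ℝ} {w : ℝ → ℝ}

/-- The local mass is controlled by duality. -/
lemma Tested.local_mass (h : Tested D A B w) (hD : 0 ≤ D) {m ℓ p q s r : ℝ} (hℓ : 0 < ℓ)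
    (hp : 0 < p) (hq : 0 < q) (hlo : -B ≤ m - 2 * ℓ) (hhi : m + 2 * ℓ ≤ B)
    (hw : ∀ y ∈ Set.Icc (m - 2 * ℓ) (m + 2 * ℓ), |w y| ≤ p)
    (hw' : ∀ y ∈ Set.Icc (m - 2 * ℓ) (m + 2 * ℓ), |deriv w y| ≤ q)
    (hs : 0 ≤ s) (hs2 : 4 * ℓ * (p * (q + 2 * p / ℓ)) ≤ s ^ 2) (hr : 0 ≤ r)
    (hr2 : 4 * ℓ * p ^ 2 ≤ r ^ 2) :
    ∫ y in (m - ℓ)..(m + ℓ), w y ^ 2 ≤ 2 * (D * (s + r)) := by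
  have hL : 0 < 2 * ℓ := by linarith
  have c0 := h.continuous
  have c1 := h.continuous_deriv
  have k0 := cap_continuous m (2 * ℓ)
  have k1 := cap₁_continuous m (2 * ℓ)
  have hlen : m + 2 * ℓ - (m - 2 * ℓ) = 4 * ℓ := by ring
  -- The function is paired with a cutoff of itself, so the pairing is the localized mass. The term
  -- `2 p / ℓ` in `β` comes from the derivative of the cutoff at scale `2 ℓ`.
  have key := h.func_sup hD (φ := fun y => cap m (2 * ℓ) y * w y)
    (φ' := fun y => cap₁ m (2 * ℓ) y * w y + cap m (2 * ℓ) y * deriv w y)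
    (a := m - 2 * ℓ) (b := m + 2 * ℓ) (α := p) (β := q + 2 * p / ℓ) (s := s) (r := r) (by linarith)
    hlo hhi (fun y => (cap_hasDerivAt m _ y).mul (h.hasDerivAt y)) (by fun_prop)
    (by simp only [cap_left m hL, zero_mul]) (by simp only [cap_right m hL, zero_mul]) hp
    (by positivity) (fun y hy => by
      rw [abs_mul, abs_of_nonneg (cap_nonneg _ _ _)]
      exact (mul_le_of_le_one_left (abs_nonneg _) (cap_le_one hL hy)).trans (hw y hy))
    (fun y hy => by
      refine (abs_add_le _ _).trans ?_
      rw [abs_mul, abs_mul, abs_of_nonneg (cap_nonneg _ _ _), add_comm q]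
      refine add_le_add ?_ ((mul_le_of_le_one_left (abs_nonneg _) (cap_le_one hL hy)).trans
        (hw' y hy))
      refine (mul_le_mul (abs_cap₁_le hL hy) (hw y hy) (abs_nonneg _) (by positivity)).trans_eq ?_
      field_simp; norm_num) hs (by rwa [hlen]) hr (by rwa [hlen])
  have := integral_middle_le (m := m) hL (F := fun y => w y ^ 2) (by fun_prop) fun y => sq_nonneg _
  rw [show 2 * ℓ / 2 = ℓ by ring] at this
  refine this.trans (mul_le_mul_of_nonneg_left ?_ zero_le_two)
  refine le_trans (le_of_eq ?_) ((le_abs_self _).trans key)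
  exact intervalIntegral.integral_congr fun y _ => by ring

/-- With `c` the mean of `g`, the first part is an admissible test of the force and the second is an
average of the force, estimated separately. -/
lemma integral_mul_frc_eq (hw : ContDiff ℝ 2 w) (g : ℝ → ℝ) (hg : Continuous g) (a b c : ℝ) :
    ∫ x in a..b, g x * frc w x
      = (∫ x in a..b, (g x - c) * frc w x) + c * ∫ x in a..b, frc w x := by
  have hf := frc_continuous hw
  rw [← intervalIntegral.integral_const_mul, ← intervalIntegral.integral_add
    (Continuous.intervalIntegrable (by fun_prop) _ _)
    (Continuous.intervalIntegrable (by fun_prop) _ _)]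
  exact intervalIntegral.integral_congr fun y _ => by ring

/-- The local energy is controlled by the local mass. -/
lemma Tested.local_energy (h : Tested D A B w) (hD : 0 ≤ D) {m ℓ p S N μ : ℝ} (hℓ : 0 < ℓ)
    (hp : 0 < p) (hlo : -B ≤ m - ℓ) (hhi : m + ℓ ≤ B)
    (hw : ∀ y ∈ Set.Icc (m - ℓ) (m + ℓ), |w y| ≤ p)
    (hS : ∀ y ∈ Set.Icc (m - ℓ) (m + ℓ), |y| + 9 * |w y| ≤ S)
    (hN : ∫ y in (m - ℓ)..(m + ℓ), w y ^ 2 ≤ N) (hμ : |avg w (m - ℓ) (m + ℓ)| ≤ μ) :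
    ∫ y in (m - ℓ / 2)..(m + ℓ / 2), deriv w y ^ 2
      ≤ (12 / ℓ ^ 2 + S) * N + D * (4 * ℓ * p + 2 * p / B) + 2 * ℓ * p * μ := by
  have c0 := h.continuous
  have c1 := h.continuous_deriv
  have c2 := h.continuous_deriv₂
  have cf := frc_continuous h.smooth
  have k0 := cap_continuous m ℓ
  have k1 := cap₁_continuous m ℓ
  have k2 := cap₂_continuous m ℓ
  have hlt : m - ℓ < m + ℓ := by linarith
  have hlen : m + ℓ - (m - ℓ) = 2 * ℓ := by ring
  have hS0 : 0 ≤ S := by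
    have := hS m ⟨by linarith, by linarith⟩
    linarith [abs_nonneg m, abs_nonneg (w m)]
  have hmid := integral_middle_le (m := m) hℓ (F := fun y => deriv w y ^ 2) (by fun_prop)
    fun y => sq_nonneg _
  -- integration by parts
  have i1 := intervalIntegral.integral_mul_deriv_eq_deriv_mul (a := m - ℓ) (b := m + ℓ)
    (u := fun y => cap m ℓ y * w y) (v := deriv w)
    (fun x _ => (cap_hasDerivAt m ℓ x).mul (h.hasDerivAt x)) (fun x _ => h.hasDerivAt₂ x)
    (Continuous.intervalIntegrable (by fun_prop) _ _) (c2.intervalIntegrable _ _)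
  have i2 := intervalIntegral.integral_mul_deriv_eq_deriv_mul (a := m - ℓ) (b := m + ℓ)
    (u := cap₁ m ℓ) (v := fun y => w y ^ 2)
    (fun x _ => cap₁_hasDerivAt m ℓ x) (fun x _ => (h.hasDerivAt x).pow 2)
    (k2.intervalIntegrable _ _) (Continuous.intervalIntegrable (by fun_prop) _ _)
  rw [cap_left m hℓ, cap_right m hℓ] at i1
  rw [cap₁_left m hℓ, cap₁_right m hℓ] at i2
  -- The equation is multiplied by `cap * w`. Integrating by parts twice leaves only `w ^ 2`
  -- multiplied by the second derivative of the cutoff and the potential.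
  have e : 3 * ∫ y in (m - ℓ)..(m + ℓ), cap m ℓ y * deriv w y ^ 2
      = (∫ y in (m - ℓ)..(m + ℓ), (3 / 2 * cap₂ m ℓ y - cap m ℓ y * (y + 9 * w y)) * w y ^ 2)
        + ∫ y in (m - ℓ)..(m + ℓ), cap m ℓ y * w y * frc w y := by
    have j1 : ∫ y in (m - ℓ)..(m + ℓ), cap m ℓ y * w y * deriv (deriv w) y
        = -((∫ y in (m - ℓ)..(m + ℓ), cap₁ m ℓ y * w y * deriv w y)
          + ∫ y in (m - ℓ)..(m + ℓ), cap m ℓ y * deriv w y ^ 2) := by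
      rw [i1, ← intervalIntegral.integral_add (Continuous.intervalIntegrable (by fun_prop) _ _)
        (Continuous.intervalIntegrable (by fun_prop) _ _)]
      have : ∫ y in (m - ℓ)..(m + ℓ), (cap₁ m ℓ y * w y + cap m ℓ y * deriv w y) * deriv w y
        = ∫ y in (m - ℓ)..(m + ℓ), (cap₁ m ℓ y * w y * deriv w y + cap m ℓ y * deriv w y ^ 2) :=
        intervalIntegral.integral_congr fun y _ => by ring
      rw [this]; ring
    have j2 : 2 * ∫ y in (m - ℓ)..(m + ℓ), cap₁ m ℓ y * w y * deriv w y
        = -∫ y in (m - ℓ)..(m + ℓ), cap₂ m ℓ y * w y ^ 2 := by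
      have : 2 * ∫ y in (m - ℓ)..(m + ℓ), cap₁ m ℓ y * w y * deriv w y
        = ∫ y in (m - ℓ)..(m + ℓ), cap₁ m ℓ y * (2 * w y ^ (2 - 1) * deriv w y) := by
        rw [← intervalIntegral.integral_const_mul]
        exact intervalIntegral.integral_congr fun y _ => by ring
      rw [this]
      have i2' := i2
      push_cast at i2'
      rw [i2']; ring
    have j3 : (∫ y in (m - ℓ)..(m + ℓ), (3 / 2 * cap₂ m ℓ y - cap m ℓ y * (y + 9 * w y)) * w y ^ 2)
        + ∫ y in (m - ℓ)..(m + ℓ), cap m ℓ y * w y * frc w y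
        = 3 / 2 * (∫ y in (m - ℓ)..(m + ℓ), cap₂ m ℓ y * w y ^ 2)
          - 3 * ∫ y in (m - ℓ)..(m + ℓ), cap m ℓ y * w y * deriv (deriv w) y := by
      rw [← intervalIntegral.integral_const_mul, ← intervalIntegral.integral_const_mul,
        ← intervalIntegral.integral_add (Continuous.intervalIntegrable (by fun_prop) _ _)
        (Continuous.intervalIntegrable (by fun_prop) _ _),
        ← intervalIntegral.integral_sub (Continuous.intervalIntegrable (by fun_prop) _ _)
        (Continuous.intervalIntegrable (by fun_prop) _ _)]
      exact intervalIntegral.integral_congr fun y _ => by simp only [frc]; ring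
    rw [j3, j1]; linarith
  have b1 : ∫ y in (m - ℓ)..(m + ℓ), (3 / 2 * cap₂ m ℓ y - cap m ℓ y * (y + 9 * w y)) * w y ^ 2
      ≤ (12 / ℓ ^ 2 + S) * N := by
    refine le_trans ?_ (mul_le_mul_of_nonneg_left hN (by positivity))
    rw [← intervalIntegral.integral_const_mul]
    refine intervalIntegral.integral_mono_on hlt.le
      (Continuous.intervalIntegrable (by fun_prop) _ _)
      (Continuous.intervalIntegrable (by fun_prop) _ _) fun y hy => ?_
    refine mul_le_mul_of_nonneg_right ?_ (sq_nonneg _)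
    have t1 := (le_abs_self _).trans (abs_cap₂_le hℓ hy)
    have t2 : -(cap m ℓ y * (y + 9 * w y)) ≤ S := by
      refine (neg_le_abs _).trans ?_
      rw [abs_mul, abs_of_nonneg (cap_nonneg _ _ _)]
      refine (mul_le_of_le_one_left (abs_nonneg _) (cap_le_one hℓ hy)).trans ?_
      refine (abs_add_le _ _).trans ?_
      rw [abs_mul, abs_of_pos (by norm_num : (0 : ℝ) < 9)]
      exact hS y hy
    have t3 : 12 / ℓ ^ 2 = 3 / 2 * (8 / ℓ ^ 2) := by ring
    linarith
  -- testing the force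
  have hcw : ∀ y ∈ Set.Icc (m - ℓ) (m + ℓ), |cap m ℓ y * w y| ≤ p := fun y hy => by
    rw [abs_mul, abs_of_nonneg (cap_nonneg _ _ _)]
    exact (mul_le_of_le_one_left (abs_nonneg _) (cap_le_one hℓ hy)).trans (hw y hy)
  set I := ∫ y in (m - ℓ)..(m + ℓ), cap m ℓ y * w y with hI
  have hIle : |I| ≤ p * (2 * ℓ) := by
    rw [← hlen]; exact intervalIntegral_abs_le hlt.le hcw
  set c := I / (2 * ℓ) with hc
  have hcle : |c| ≤ p := by
    rw [hc, abs_div, abs_of_pos (by linarith : 0 < 2 * ℓ), div_le_iff₀ (by linarith)]; exact hIle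
  have hg2 : ∀ y ∈ Set.Icc (m - ℓ) (m + ℓ), |cap m ℓ y * w y - c| ≤ 2 * p := fun y hy => by
    have := abs_sub (cap m ℓ y * w y) c
    linarith [hcw y hy]
  have b2 := h.force_sup hD (g := fun y => cap m ℓ y * w y - c) (a := m - ℓ) (b := m + ℓ)
    (α := 4 * ℓ * p) (β := 2 * p) (s := 4 * ℓ * p) hlt hlo hhi
    (Continuous.measurable (by fun_prop)) (by positivity) (by positivity) (fun x hx => by
      refine (intervalIntegral_abs_le hx.1 fun y hy => hg2 y ⟨hy.1, hy.2.trans hx.2⟩).trans ?_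
      have : x - (m - ℓ) ≤ 2 * ℓ := by linarith [hx.2]
      nlinarith) hg2 (by
      rw [intervalIntegral.integral_sub (Continuous.intervalIntegrable (by fun_prop) _ _)
        (by simp), intervalIntegral.integral_const, ← hI, hlen, hc, smul_eq_mul]
      field_simp; simp) (by positivity) (by rw [hlen]; nlinarith)
  have e3 := integral_mul_frc_eq h.smooth (fun y => cap m ℓ y * w y) (by fun_prop) (m - ℓ) (m + ℓ) c
  have e4 : ∫ y in (m - ℓ)..(m + ℓ), frc w y = 2 * ℓ * avg w (m - ℓ) (m + ℓ) := by
    rw [avg, hlen]; field_simp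
  have b3 : |c * ∫ y in (m - ℓ)..(m + ℓ), frc w y| ≤ 2 * ℓ * p * μ := by
    rw [e4, abs_mul, abs_mul, abs_of_pos (by linarith : 0 < 2 * ℓ)]
    calc |c| * (2 * ℓ * |avg w (m - ℓ) (m + ℓ)|) ≤ p * (2 * ℓ * μ) := by gcongr
      _ = _ := by ring
  have b4 := (le_abs_self _).trans b2
  have b5 := (le_abs_self _).trans b3
  have hnn : 0 ≤ (12 / ℓ ^ 2 + S) * N + D * (4 * ℓ * p + 2 * p / B) + 2 * ℓ * p * μ := by
    have : 0 ≤ ∫ y in (m - ℓ)..(m + ℓ), cap m ℓ y * deriv w y ^ 2 :=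
      intervalIntegral.integral_nonneg hlt.le fun y _ => mul_nonneg (cap_nonneg _ _ _) (sq_nonneg _)
    linarith
  linarith

/-- The pointwise energy is controlled by its local average. -/
lemma Tested.energy_le (h : Tested D A B w) (hD : 0 ≤ D) {y₀ ℓ p q s S N J μ : ℝ} (hℓ : 0 < ℓ)
    (hp : 0 < p) (hq : 0 < q) (hlo : -B ≤ y₀ - ℓ) (hhi : y₀ ≤ B)
    (hw : ∀ y ∈ Set.Icc (y₀ - ℓ) y₀, |w y| ≤ p)
    (hw' : ∀ y ∈ Set.Icc (y₀ - ℓ) y₀, |deriv w y| ≤ q)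
    (hS : ∀ y ∈ Set.Icc (y₀ - ℓ) y₀, |y| + 9 * |w y| ≤ S)
    (hs : 0 ≤ s) (hs2 : 4 * ℓ * (p * (q + 2 * p / ℓ)) ≤ s ^ 2)
    (hN : ∫ y in (y₀ - ℓ)..y₀, w y ^ 2 ≤ N) (hJ : ∫ y in (y₀ - ℓ)..y₀, deriv w y ^ 2 ≤ J)
    (hμ : |avg w (y₀ - ℓ) y₀| ≤ μ) :
    3 / 2 * deriv w y₀ ^ 2 - y₀ / 2 * w y₀ ^ 2 - 3 * w y₀ ^ 3
      ≤ 3 / 2 * J / ℓ + (S / (2 * ℓ) + 1 / 2) * N + D * (s + (q + 2 * p / ℓ) / B) + 2 * p * μ := by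
  have c0 := h.continuous
  have c1 := h.continuous_deriv
  have c2 := h.continuous_deriv₂
  have cf := frc_continuous h.smooth
  set a := y₀ - ℓ with ha
  have hlt : a < y₀ := by linarith
  have hlen : y₀ - a = ℓ := by rw [ha]; ring
  have hS0 : 0 ≤ S := by
    have := hS y₀ ⟨hlt.le, le_rfl⟩
    linarith [abs_nonneg y₀, abs_nonneg (w y₀)]
  -- The Hamiltonian of the equation without force. Along a solution it changes only through the
  -- force and through the explicit dependence of the potential on `y`.
  set E : ℝ → ℝ := fun y => 3 / 2 * deriv w y ^ 2 - y / 2 * w y ^ 2 - 3 * w y ^ 3 with hE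
  have cE : Continuous E := by fun_prop
  have dk : ∀ y, HasDerivAt (fun y : ℝ => (y - a) / ℓ) (1 / ℓ) y := fun y =>
    ((hasDerivAt_id y).sub_const a).div_const ℓ
  have dE : ∀ y, HasDerivAt E (-(frc w y * deriv w y) - w y ^ 2 / 2) y := fun y => by
    have d0 := h.hasDerivAt y
    have d1 := h.hasDerivAt₂ y
    refine ((((d1.pow 2).const_mul (3 / 2)).sub (((hasDerivAt_id y).div_const 2).mul (d0.pow 2))).sub
      ((d0.pow 3).const_mul 3)).congr_deriv ?_
    simp [frc]; ring
  have hk : ∀ y ∈ Set.Icc a y₀, 0 ≤ (y - a) / ℓ ∧ (y - a) / ℓ ≤ 1 := fun y hy =>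
    ⟨div_nonneg (by linarith [hy.1]) hℓ.le, by rw [div_le_one hℓ]; linarith [hy.2]⟩
  -- The linear ramp vanishes at `a`, so the value of `E` at `y₀` is expressed by integrals, with no
  -- boundary term on the left.
  have ftc := intervalIntegral.integral_eq_sub_of_hasDerivAt (a := a) (b := y₀)
    (f := fun y => (y - a) / ℓ * E y) (fun y _ => (dk y).mul (dE y))
    (Continuous.intervalIntegrable (by fun_prop) _ _)
  rw [hlen, sub_self, zero_div, zero_mul, div_self hℓ.ne', one_mul, sub_zero] at ftc
  have split : ∫ y in a..y₀, (1 / ℓ * E y + (y - a) / ℓ * (-(frc w y * deriv w y) - w y ^ 2 / 2))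
      = (∫ y in a..y₀, (1 / ℓ * E y - (y - a) / ℓ * (w y ^ 2 / 2)))
        - ∫ y in a..y₀, (y - a) / ℓ * deriv w y * frc w y := by
    rw [← intervalIntegral.integral_sub (Continuous.intervalIntegrable (by fun_prop) _ _)
      (Continuous.intervalIntegrable (by fun_prop) _ _)]
    exact intervalIntegral.integral_congr fun y _ => by ring
  have b1 : ∫ y in a..y₀, (1 / ℓ * E y - (y - a) / ℓ * (w y ^ 2 / 2))
      ≤ 3 / 2 * J / ℓ + (S / (2 * ℓ) + 1 / 2) * N := by
    have : ∫ y in a..y₀, (1 / ℓ * E y - (y - a) / ℓ * (w y ^ 2 / 2))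
        ≤ ∫ y in a..y₀, (3 / (2 * ℓ) * deriv w y ^ 2 + (S / (2 * ℓ) + 1 / 2) * w y ^ 2) := by
      refine intervalIntegral.integral_mono_on hlt.le
        (Continuous.intervalIntegrable (by fun_prop) _ _)
        (Continuous.intervalIntegrable (by fun_prop) _ _) fun y hy => ?_
      have t1 := hk y hy
      have t2 : -(y / 2 + 3 * w y) ≤ S / 2 := by
        linarith [hS y hy, neg_le_abs y, neg_le_abs (w y), abs_nonneg (w y)]
      have t3 : -(y / 2 + 3 * w y) * w y ^ 2 ≤ S / 2 * w y ^ 2 :=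
        mul_le_mul_of_nonneg_right t2 (sq_nonneg _)
      have t4 : 0 ≤ (y - a) / ℓ * (w y ^ 2 / 2) := mul_nonneg t1.1 (by positivity)
      have t5 : E y ≤ 3 / 2 * deriv w y ^ 2 + S / 2 * w y ^ 2 := by simp only [hE]; linarith
      have t6 := mul_le_mul_of_nonneg_left t5 (by positivity : 0 ≤ 1 / ℓ)
      have t7 : 1 / ℓ * (3 / 2 * deriv w y ^ 2 + S / 2 * w y ^ 2)
          = 3 / (2 * ℓ) * deriv w y ^ 2 + S / (2 * ℓ) * w y ^ 2 := by field_simp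
      linarith [sq_nonneg (w y)]
    refine this.trans ?_
    rw [intervalIntegral.integral_add (Continuous.intervalIntegrable (by fun_prop) _ _)
      (Continuous.intervalIntegrable (by fun_prop) _ _), intervalIntegral.integral_const_mul,
      intervalIntegral.integral_const_mul]
    refine add_le_add ?_ (mul_le_mul_of_nonneg_left hN (by positivity))
    rw [show 3 / 2 * J / ℓ = 3 / (2 * ℓ) * J by field_simp]
    exact mul_le_mul_of_nonneg_left hJ (by positivity)
  -- testing the force
  have prim : ∀ x, ∫ y in a..x, (y - a) / ℓ * deriv w y
      = (x - a) / ℓ * w x - (∫ y in a..x, w y) / ℓ := fun x => by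
    rw [intervalIntegral.integral_mul_deriv_eq_deriv_mul (fun y _ => dk y)
      (fun y _ => h.hasDerivAt y) (by simp) (c1.intervalIntegrable _ _),
      intervalIntegral.integral_const_mul]
    simp; ring
  have hprim : ∀ x ∈ Set.Icc a y₀, |∫ y in a..x, (y - a) / ℓ * deriv w y| ≤ 2 * p := fun x hx => by
    rw [prim]
    refine (abs_sub _ _).trans ?_
    have t1 : |(x - a) / ℓ * w x| ≤ p := by
      rw [abs_mul, abs_of_nonneg (hk x hx).1]
      exact (mul_le_of_le_one_left (abs_nonneg _) (hk x hx).2).trans (hw x hx)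
    have t2 : |(∫ y in a..x, w y) / ℓ| ≤ p := by
      rw [abs_div, abs_of_pos hℓ, div_le_iff₀ hℓ]
      refine (intervalIntegral_abs_le hx.1 fun y hy => hw y ⟨hy.1, hy.2.trans hx.2⟩).trans ?_
      exact mul_le_mul_of_nonneg_left (by linarith [hx.2]) hp.le
    linarith
  set I := ∫ y in a..y₀, (y - a) / ℓ * deriv w y with hI
  have hIle : |I| ≤ 2 * p := hprim y₀ ⟨hlt.le, le_rfl⟩
  have hcle : |I / ℓ| ≤ 2 * p / ℓ := by
    rw [abs_div, abs_of_pos hℓ]; gcongr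
  have b2 := h.force_sup hD (g := fun y => (y - a) / ℓ * deriv w y - I / ℓ) (a := a) (b := y₀)
    (α := 4 * p) (β := q + 2 * p / ℓ) (s := s) hlt hlo hhi
    (Continuous.measurable (by fun_prop)) (by positivity) (by positivity) (fun x hx => by
      rw [intervalIntegral.integral_sub (Continuous.intervalIntegrable (by fun_prop) _ _)
        (by simp), intervalIntegral.integral_const, smul_eq_mul]
      refine (abs_sub _ _).trans ?_
      have t1 : |(x - a) * (I / ℓ)| ≤ 2 * p := by
        rw [show (x - a) * (I / ℓ) = (x - a) / ℓ * I by ring, abs_mul, abs_of_nonneg (hk x hx).1]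
        exact (mul_le_of_le_one_left (abs_nonneg _) (hk x hx).2).trans hIle
      linarith [hprim x hx]) (fun y hy => by
      refine (abs_sub _ _).trans (add_le_add ?_ hcle)
      rw [abs_mul, abs_of_nonneg (hk y hy).1]
      exact (mul_le_of_le_one_left (abs_nonneg _) (hk y hy).2).trans (hw' y hy)) (by
      rw [intervalIntegral.integral_sub (Continuous.intervalIntegrable (by fun_prop) _ _)
        (by simp), intervalIntegral.integral_const, ← hI, hlen, smul_eq_mul]
      field_simp; simp) hs (by rw [hlen]; linarith)
  have e3 := integral_mul_frc_eq h.smooth (fun y => (y - a) / ℓ * deriv w y) (by fun_prop) a y₀ (I / ℓ)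
  have e4 : I / ℓ * ∫ y in a..y₀, frc w y = I * avg w a y₀ := by
    rw [avg, hlen]; field_simp
  have b3 : |I * avg w a y₀| ≤ 2 * p * μ := by
    rw [abs_mul]; gcongr
  have b4 := (neg_le_abs _).trans b2
  have b5 := (neg_le_abs _).trans b3
  rw [split] at ftc
  have : E y₀ = 3 / 2 * deriv w y₀ ^ 2 - y₀ / 2 * w y₀ ^ 2 - 3 * w y₀ ^ 3 := rfl
  rw [← this]
  linarith

end

/-! ### Pointwise bounds in the oscillatory and bounded regions -/

lemma jb_le_abs_add_one (y : ℝ) : jb y ≤ |y| + 1 :=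
  Real.sqrt_le_iff.2 ⟨by positivity, by nlinarith [sq_abs y, abs_nonneg y]⟩

lemma jb_rpow_neg_le_div {r y : ℝ} (hr : 0 < r) (h : (r / 2) ^ 4 ≤ jb y) :
    jb y ^ (-1 / 4 : ℝ) ≤ 2 / r := by
  refine (Real.rpow_le_rpow_of_nonpos (by positivity) h (by norm_num)).trans_eq ?_
  rw [← Real.rpow_natCast, ← Real.rpow_mul (by positivity)]
  norm_num
  rw [Real.rpow_neg_one, inv_div]

lemma jb_rpow_le_mul {r y : ℝ} (hr : 0 < r) (h : jb y ≤ (2 * r) ^ 4) :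
    jb y ^ (1 / 4 : ℝ) ≤ 2 * r := by
  refine (Real.rpow_le_rpow (jb_pos y).le h (by norm_num)).trans_eq ?_
  rw [← Real.rpow_natCast, ← Real.rpow_mul (by positivity)]
  norm_num

section

variable {D A B : ℝ} {w : ℝ → ℝ}

lemma Tested.abs_apply_le (h : Tested D A B w) (hA : 0 ≤ A) (y : ℝ) : |w y| ≤ A :=
  (h.bound y).trans (mul_le_of_le_one_right hA (jb_rpow_neg_le_one y))

/-- The fundamental theorem of calculus for a linear ramp times `w ^ 2`, with `2 w w' ≤ w² + w'²`.
It serves where the potential has no favourable sign. -/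
lemma Tested.sq_le (h : Tested D A B w) {y₀ ℓ N J : ℝ} (hℓ : 0 < ℓ)
    (hN : ∫ y in (y₀ - ℓ)..y₀, w y ^ 2 ≤ N) (hJ : ∫ y in (y₀ - ℓ)..y₀, deriv w y ^ 2 ≤ J) :
    w y₀ ^ 2 ≤ (1 / ℓ + 1) * N + J := by
  have c0 := h.continuous
  have c1 := h.continuous_deriv
  set a := y₀ - ℓ with ha
  have hlt : a < y₀ := by linarith
  have hlen : y₀ - a = ℓ := by rw [ha]; ring
  have dk : ∀ y, HasDerivAt (fun y : ℝ => (y - a) / ℓ) (1 / ℓ) y := fun y =>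
    ((hasDerivAt_id y).sub_const a).div_const ℓ
  have ftc := intervalIntegral.integral_eq_sub_of_hasDerivAt (a := a) (b := y₀)
    (f := fun y => (y - a) / ℓ * w y ^ 2) (fun y _ => (dk y).mul ((h.hasDerivAt y).pow 2))
    (Continuous.intervalIntegrable (by fun_prop) _ _)
  rw [hlen, sub_self, zero_div, zero_mul, div_self hℓ.ne', one_mul, sub_zero] at ftc
  rw [← ftc]
  have : ∫ y in a..y₀, (1 / ℓ * w y ^ 2 + (y - a) / ℓ * (((2 : ℕ) : ℝ) * w y ^ (2 - 1) * deriv w y))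
      ≤ ∫ y in a..y₀, ((1 / ℓ + 1) * w y ^ 2 + deriv w y ^ 2) := by
    refine intervalIntegral.integral_mono_on hlt.le
      (Continuous.intervalIntegrable (by fun_prop) _ _)
      (Continuous.intervalIntegrable (by fun_prop) _ _) fun y hy => ?_
    have k0 : 0 ≤ (y - a) / ℓ := div_nonneg (by linarith [hy.1]) hℓ.le
    have k1 : (y - a) / ℓ ≤ 1 := by rw [div_le_one hℓ]; linarith [hy.2]
    have t1 : 2 * w y * deriv w y ≤ w y ^ 2 + deriv w y ^ 2 := two_mul_le_add_sq _ _
    have t2 : (y - a) / ℓ * (2 * w y * deriv w y) ≤ 1 * (w y ^ 2 + deriv w y ^ 2) :=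
      (mul_le_mul_of_nonneg_left t1 k0).trans (mul_le_mul_of_nonneg_right k1 (by positivity))
    push_cast
    simp only [pow_one]
    linarith
  refine this.trans ?_
  rw [intervalIntegral.integral_add (Continuous.intervalIntegrable (by fun_prop) _ _)
      (Continuous.intervalIntegrable (by fun_prop) _ _), intervalIntegral.integral_const_mul]
  exact add_le_add (mul_le_mul_of_nonneg_left hN (by positivity)) hJ

end

set_option maxHeartbeats 1000000 in
/-- Pointwise bounds in the oscillatory region. -/
lemma exists_hyperbolic : ∃ C, 0 < C ∧ ∀ D A B : ℝ, ∀ w : ℝ → ℝ, 0 ≤ D → 0 < A → A ≤ 1 / 100 →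
    1 ≤ B → A ^ 2 ≤ D → Tested D A B w → ∀ r : ℝ, 1 ≤ r → 4 * r ^ 4 ≤ B →
    r ^ 2 * w (-r ^ 4) ^ 2 ≤ C * (D * A) ∧ deriv w (-r ^ 4) ^ 2 ≤ C * (D * A) * r ^ 2 := by
  obtain ⟨C, hC, hC'⟩ := exists_avg_le
  refine ⟨8 * (9442 + 10 * C), by positivity, fun D A B w hD hA hA1 hB hAD h r hr hrB => ?_⟩
  have hr0 : 0 < r := by linarith
  have hr4 : 1 ≤ r ^ 4 := one_le_pow₀ hr
  set R := r ^ 4 with hR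
  have hwin : ∀ y, -R - R / 8 - R / 2 ≤ y → y ≤ -R - R / 8 + R / 2 →
      |w y| ≤ 2 * A / r ∧ |deriv w y| ≤ 2 * A * r ∧ |y| + 9 * |w y| ≤ 3 * R := fun y h1 h2 => by
    have hy : |y| = -y := abs_of_nonpos (by linarith)
    have j1 : (r / 2) ^ 4 ≤ jb y := by
      have := abs_le_jb y
      rw [div_pow, ← hR]; linarith
    have j2 : jb y ≤ (2 * r) ^ 4 := by
      have := jb_le_abs_add_one y
      rw [mul_pow, ← hR]; linarith
    refine ⟨?_, ?_, ?_⟩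
    · refine (h.bound y).trans ((mul_le_mul_of_nonneg_left (jb_rpow_neg_le_div hr0 j1) hA.le).trans_eq ?_)
      ring
    · refine (h.bound_deriv y).trans
        ((mul_le_mul_of_nonneg_left (jb_rpow_le_mul hr0 j2) hA.le).trans_eq ?_)
      ring
    · have := h.abs_apply_le hA.le y
      linarith
  set P := 2 * A with hP
  have hP0 : 0 < P := by linarith
  set X := D * P with hX
  have hX0 : 0 ≤ X := by positivity
  have hPr : P / r ≤ P := div_le_self hP0.le hr
  have r12 : r ≤ r ^ 2 := by nlinarith
  have r1 : 1 ≤ r ^ 2 := by nlinarith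
  have r36 : r ^ 3 ≤ r ^ 6 := pow_le_pow_right₀ hr (by norm_num)
  have r56 : r ^ 5 ≤ r ^ 6 := pow_le_pow_right₀ hr (by norm_num)
  have r6 : 1 ≤ r ^ 6 := one_le_pow₀ hr
  have eR1 : R * (P / r) = P * r ^ 3 := by rw [hR]; field_simp
  have hq : P * r + 2 * (P / r) / (R / 4) ≤ 9 * (P * r) := by
    have : 2 * (P / r) / (R / 4) ≤ 2 * P / (1 / 4) := by gcongr
    nlinarith
  have hs2 : 4 * (R / 4) * (P / r * (P * r + 2 * (P / r) / (R / 4))) ≤ (3 * (P * r ^ 2)) ^ 2 := by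
    calc 4 * (R / 4) * (P / r * (P * r + 2 * (P / r) / (R / 4)))
        ≤ 4 * (R / 4) * (P / r * (9 * (P * r))) := by gcongr
      _ = R * (P / r) * (9 * (P * r)) := by ring
      _ = _ := by rw [eR1]; ring
  have hlog : ∀ a b, -(4 * R) ≤ a → b ≤ 4 * R → 1 / 16 ≤ b - a →
      |avg w a b| ≤ 2 * C * D * r ^ 2 := fun a b h1 h2 h3 => by
    refine (hC' D A B w hD hA.le hB hAD h a b (4 * R) (2 * r ^ 2) (by linarith) (by rw [hR]; ring)
      hrB h1 h2 h3).trans_eq (by ring)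
  -- The centre `-R - R/8` is chosen so that the nested windows, of radius `R/2`, `R/4` and `R/8`,
  -- end with one whose right endpoint is exactly `-R`, the point in question.
  have mass := h.local_mass hD (m := -R - R / 8) (ℓ := R / 4) (p := P / r) (q := P * r)
    (s := 3 * (P * r ^ 2)) (r := P * r ^ 2) (by linarith) (by positivity) (by positivity)
    (by linarith) (by linarith) (fun y hy => (hwin y (by linarith [hy.1]) (by linarith [hy.2])).1)
    (fun y hy => (hwin y (by linarith [hy.1]) (by linarith [hy.2])).2.1) (by positivity) hs2
    (by positivity) (by
      calc 4 * (R / 4) * (P / r) ^ 2 = R * (P / r) * (P / r) := by ring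
        _ = (P * r) ^ 2 := by rw [eR1]; field_simp
        _ ≤ (P * r ^ 2) ^ 2 := by gcongr)
  have mass' : ∫ y in (-R - R / 8 - R / 4)..(-R - R / 8 + R / 4), w y ^ 2 ≤ 8 * X * r ^ 2 :=
    mass.trans_eq (by rw [hX]; ring)
  have energy := h.local_energy hD (m := -R - R / 8) (ℓ := R / 4) (p := P / r) (S := 3 * R)
    (N := 8 * X * r ^ 2) (μ := 2 * C * D * r ^ 2) (by linarith) (by positivity) (by linarith)
    (by linarith) (fun y hy => (hwin y (by linarith [hy.1]) (by linarith [hy.2])).1)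
    (fun y hy => (hwin y (by linarith [hy.1]) (by linarith [hy.2])).2.2) mass'
    (hlog _ _ (by linarith) (by linarith) (by linarith))
  have hPB : 2 * (P / r) / B ≤ 2 * P := (div_le_self (by positivity) hB).trans (by linarith)
  have energy' : ∫ y in (-R - R / 8 - R / 4 / 2)..(-R - R / 8 + R / 4 / 2), deriv w y ^ 2
      ≤ (1563 + C) * X * r ^ 6 := by
    refine energy.trans ?_
    have t1 : 12 / (R / 4) ^ 2 + 3 * R ≤ 195 * R := by
      have : 12 / (R / 4) ^ 2 ≤ 12 / (1 / 4) ^ 2 := by gcongr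
      linarith
    have t2 : (12 / (R / 4) ^ 2 + 3 * R) * (8 * X * r ^ 2) ≤ 1560 * X * r ^ 6 :=
      (mul_le_mul_of_nonneg_right t1 (by positivity)).trans_eq (by rw [hR]; ring)
    have t3 : D * (4 * (R / 4) * (P / r) + 2 * (P / r) / B) ≤ 3 * X * r ^ 6 := by
      have : 4 * (R / 4) * (P / r) + 2 * (P / r) / B ≤ 3 * P * r ^ 6 := by
        have e : 4 * (R / 4) * (P / r) = R * (P / r) := by ring
        rw [e, eR1]
        nlinarith
      exact (mul_le_mul_of_nonneg_left this hD).trans_eq (by rw [hX]; ring)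
    have t4 : 2 * (R / 4) * (P / r) * (2 * C * D * r ^ 2) ≤ C * X * r ^ 6 := by
      have e : 2 * (R / 4) * (P / r) * (2 * C * D * r ^ 2) = R * (P / r) * (C * D * r ^ 2) := by ring
      rw [e, eR1]
      have : P * r ^ 3 * (C * D * r ^ 2) = C * X * r ^ 5 := by rw [hX]; ring
      rw [this]; exact mul_le_mul_of_nonneg_left r56 (by positivity)
    linarith
  have ea : -R - R / 8 - R / 4 / 2 = -R - R / 4 := by ring
  have eb : -R - R / 8 + R / 4 / 2 = -R := by ring
  rw [ea, eb] at energy'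
  have massc : ∫ y in (-R - R / 4)..(-R), w y ^ 2 ≤ 8 * X * r ^ 2 := by
    refine le_trans ?_ mass'
    have c0 := h.continuous
    exact intervalIntegral.integral_mono_interval (by linarith) (by linarith) (by linarith)
      (Eventually.of_forall fun y => sq_nonneg _) (Continuous.intervalIntegrable (by fun_prop) _ _)
  have point := h.energy_le hD (y₀ := -R) (ℓ := R / 4) (p := P / r) (q := P * r)
    (s := 3 * (P * r ^ 2)) (S := 3 * R) (N := 8 * X * r ^ 2) (J := (1563 + C) * X * r ^ 6)
    (μ := 2 * C * D * r ^ 2) (by linarith) (by positivity) (by positivity) (by linarith)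
    (by linarith) (fun y hy => (hwin y (by linarith [hy.1]) (by linarith [hy.2])).1)
    (fun y hy => (hwin y (by linarith [hy.1]) (by linarith [hy.2])).2.1)
    (fun y hy => (hwin y (by linarith [hy.1]) (by linarith [hy.2])).2.2) (by positivity) hs2
    massc energy' (hlog _ _ (by linarith) (by linarith) (by linarith))
  have point' : 3 / 2 * deriv w (-R) ^ 2 - -R / 2 * w (-R) ^ 2 - 3 * w (-R) ^ 3
      ≤ (9442 + 10 * C) * X * r ^ 2 := by
    refine point.trans ?_
    have t1 : 3 / 2 * ((1563 + C) * X * r ^ 6) / (R / 4) = 6 * (1563 + C) * X * r ^ 2 := by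
      rw [hR]; field_simp; ring
    have t2 : 3 * R / (2 * (R / 4)) = 6 := by field_simp; norm_num
    have t3 : D * (3 * (P * r ^ 2) + (P * r + 2 * (P / r) / (R / 4)) / B) ≤ 12 * X * r ^ 2 := by
      have a1 : (P * r + 2 * (P / r) / (R / 4)) / B ≤ 9 * (P * r) :=
        (div_le_self (by positivity) hB).trans hq
      have a2 : 9 * (P * r) ≤ 9 * (P * r ^ 2) := by gcongr
      have : 3 * (P * r ^ 2) + (P * r + 2 * (P / r) / (R / 4)) / B ≤ 12 * P * r ^ 2 := by linarith
      exact (mul_le_mul_of_nonneg_left this hD).trans_eq (by rw [hX]; ring)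
    have t4 : 2 * (P / r) * (2 * C * D * r ^ 2) ≤ 4 * C * X * r ^ 2 := by
      calc 2 * (P / r) * (2 * C * D * r ^ 2) ≤ 2 * P * (2 * C * D * r ^ 2) := by gcongr
        _ = _ := by rw [hX]; ring
    rw [t1, t2]
    linarith
  have hw1 := h.abs_apply_le hA.le (-R)
  -- At `-R` the potential term of the energy is positive, and since `3 A ≤ 3/100` the cubic term
  -- uses up at most half of it. Coercivity at negative `y` is what makes the energy useful.
  have low : 3 / 2 * deriv w (-R) ^ 2 + R / 4 * w (-R) ^ 2
      ≤ 3 / 2 * deriv w (-R) ^ 2 - -R / 2 * w (-R) ^ 2 - 3 * w (-R) ^ 3 := by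
    have : 0 ≤ (R / 4 - 3 * w (-R)) * w (-R) ^ 2 :=
      mul_nonneg (by linarith [le_abs_self (w (-R))]) (sq_nonneg _)
    linarith
  have h2 := low.trans point'
  have sq1 := sq_nonneg (deriv w (-R))
  have sq2 : 0 ≤ R / 4 * w (-R) ^ 2 := by positivity
  constructor
  · have : r ^ 2 * (r ^ 2 * w (-R) ^ 2) ≤ r ^ 2 * (8 * (9442 + 10 * C) * (D * A)) := by
      have e : r ^ 2 * (r ^ 2 * w (-R) ^ 2) = 4 * (R / 4 * w (-R) ^ 2) := by rw [hR]; ring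
      have e2 : r ^ 2 * (8 * (9442 + 10 * C) * (D * A)) = 4 * ((9442 + 10 * C) * X * r ^ 2) := by
        rw [hX, hP]; ring
      rw [e, e2]; linarith
    exact le_of_mul_le_mul_left this (by positivity)
  · have e2 : 8 * (9442 + 10 * C) * (D * A) * r ^ 2 = 4 * ((9442 + 10 * C) * X * r ^ 2) := by
      rw [hX, hP]; ring
    rw [e2]; linarith

set_option maxHeartbeats 1000000 in
/-- Pointwise bounds in a bounded region. -/
lemma exists_middle (Y : ℝ) (hY : 0 ≤ Y) : ∃ C, 0 < C ∧ ∀ D A B : ℝ, ∀ w : ℝ → ℝ, 0 ≤ D → 0 < A →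
    A ≤ 1 / 100 → (Y + 2) ^ 2 ≤ B → A ^ 2 ≤ D → Tested D A B w → ∀ y : ℝ, |y| ≤ Y →
    w y ^ 2 ≤ C * (D * A) ∧ deriv w y ^ 2 ≤ C * (D * A) := by
  obtain ⟨C, hC, hC'⟩ := exists_avg_le
  set Z := Y + 2 with hZ
  have hZ2 : 2 ≤ Z := by linarith
  set n := 2 * (Z + 9) with hn
  set j := (192 + Z) * n + 3 + C * Z / 2 with hj
  set e := 6 * j + (2 * Z + 1 / 2) * n + 2 * (Z + 8) + 2 * C * Z with he
  have hn0 : 0 < n := by positivity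
  have hj0 : 0 < j := by positivity
  have he0 : 0 < e := by positivity
  refine ⟨(5 * n + j) + (e + Z * (5 * n + j)), by positivity,
    fun D A B w hD hA hA1 hB hAD h y₀ hy₀ => ?_⟩
  have hB1 : 1 ≤ B := by nlinarith
  have hBZ : Z ≤ B := by nlinarith
  set X := D * A with hX
  have hX0 : 0 ≤ X := by positivity
  have hy1 := abs_le.1 hy₀
  have hwin : ∀ y, y₀ - 1 ≤ y → y ≤ y₀ + 3 / 4 →
      |w y| ≤ A ∧ |deriv w y| ≤ A * Z ∧ |y| + 9 * |w y| ≤ Z := fun y h1 h2 => by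
    have hA2 := h.abs_apply_le hA.le y
    have hy : |y| ≤ Y + 1 := abs_le.2 ⟨by linarith, by linarith⟩
    refine ⟨hA2, (h.bound_deriv y).trans (mul_le_mul_of_nonneg_left ?_ hA.le), by linarith⟩
    refine (Real.rpow_le_self_of_one_le (one_le_jb y) (by norm_num)).trans ?_
    linarith [jb_le_abs_add_one y]
  have hs2 : 4 * (1 / 4) * (A * (A * Z + 2 * A / (1 / 4))) ≤ (A * (Z + 8)) ^ 2 := by
    have : A * (A * Z + 2 * A / (1 / 4)) = A ^ 2 * (Z + 8) := by ring
    rw [mul_pow, mul_assoc 4, mul_left_comm, this]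
    have : A ^ 2 * (Z + 8) ≤ A ^ 2 * (Z + 8) ^ 2 :=
      mul_le_mul_of_nonneg_left (by nlinarith) (by positivity)
    linarith
  have hlog : ∀ a b, -Z ^ 2 ≤ a → b ≤ Z ^ 2 → 1 / 16 ≤ b - a → |avg w a b| ≤ C * D * Z :=
    fun a b h1 h2 h3 => hC' D A B w hD hA.le hB1 hAD h a b _ Z (by linarith) rfl hB h1 h2 h3
  have hZZ : 2 * Z ≤ Z ^ 2 := by nlinarith
  have mass := h.local_mass hD (m := y₀ - 1 / 8) (ℓ := 1 / 4) (p := A) (q := A * Z)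
    (s := A * (Z + 8)) (r := A) (by norm_num) hA (by positivity) (by linarith) (by linarith)
    (fun y hy => (hwin y (by linarith [hy.1]) (by linarith [hy.2])).1)
    (fun y hy => (hwin y (by linarith [hy.1]) (by linarith [hy.2])).2.1) (by positivity) hs2
    hA.le (by linarith)
  have mass' : ∫ y in (y₀ - 1 / 8 - 1 / 4)..(y₀ - 1 / 8 + 1 / 4), w y ^ 2 ≤ n * X :=
    mass.trans_eq (by rw [hX, hn]; ring)
  have energy := h.local_energy hD (m := y₀ - 1 / 8) (ℓ := 1 / 4) (p := A) (S := Z) (N := n * X)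
    (μ := C * D * Z) (by norm_num) hA (by linarith) (by linarith)
    (fun y hy => (hwin y (by linarith [hy.1]) (by linarith [hy.2])).1)
    (fun y hy => (hwin y (by linarith [hy.1]) (by linarith [hy.2])).2.2) mass'
    (hlog _ _ (by linarith) (by linarith) (by linarith))
  have hAB : 2 * A / B ≤ 2 * A := div_le_self (by positivity) hB1
  have energy' : ∫ y in (y₀ - 1 / 8 - 1 / 4 / 2)..(y₀ - 1 / 8 + 1 / 4 / 2), deriv w y ^ 2
      ≤ j * X := by
    refine energy.trans ?_
    have t1 : D * (4 * (1 / 4) * A + 2 * A / B) ≤ 3 * X :=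
      (mul_le_mul_of_nonneg_left (by linarith : _ ≤ 3 * A) hD).trans_eq (by rw [hX]; ring)
    have t2 : 2 * (1 / 4) * A * (C * D * Z) = C * Z / 2 * X := by rw [hX]; ring
    have t3 : (12 / (1 / 4 : ℝ) ^ 2 + Z) * (n * X) = (192 + Z) * n * X := by norm_num; ring
    rw [t2, t3, hj]
    linarith
  rw [show y₀ - 1 / 8 - 1 / 4 / 2 = y₀ - 1 / 4 by ring, show y₀ - 1 / 8 + 1 / 4 / 2 = y₀ by ring]
    at energy'
  have massc : ∫ y in (y₀ - 1 / 4)..y₀, w y ^ 2 ≤ n * X := by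
    refine le_trans ?_ mass'
    have c0 := h.continuous
    exact intervalIntegral.integral_mono_interval (by linarith) (by linarith) (by linarith)
      (Eventually.of_forall fun y => sq_nonneg _) (Continuous.intervalIntegrable (by fun_prop) _ _)
  have point := h.energy_le hD (y₀ := y₀) (ℓ := 1 / 4) (p := A) (q := A * Z)
    (s := A * (Z + 8)) (S := Z) (N := n * X) (J := j * X)
    (μ := C * D * Z) (by norm_num) hA (by positivity) (by linarith)
    (by linarith) (fun y hy => (hwin y (by linarith [hy.1]) (by linarith [hy.2])).1)
    (fun y hy => (hwin y (by linarith [hy.1]) (by linarith [hy.2])).2.1)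
    (fun y hy => (hwin y (by linarith [hy.1]) (by linarith [hy.2])).2.2) (by positivity) hs2
    massc energy' (hlog _ _ (by linarith) (by linarith) (by linarith))
  have point' : 3 / 2 * deriv w y₀ ^ 2 - y₀ / 2 * w y₀ ^ 2 - 3 * w y₀ ^ 3 ≤ e * X := by
    refine point.trans ?_
    have a1 : (A * Z + 2 * A / (1 / 4)) / B ≤ A * (Z + 8) :=
      (div_le_self (by positivity) hB1).trans_eq (by ring)
    have t3 : D * (A * (Z + 8) + (A * Z + 2 * A / (1 / 4)) / B) ≤ 2 * (Z + 8) * X :=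
      (mul_le_mul_of_nonneg_left (by linarith : _ ≤ 2 * (A * (Z + 8))) hD).trans_eq
        (by rw [hX]; ring)
    have t4 : 2 * A * (C * D * Z) = 2 * C * Z * X := by rw [hX]; ring
    have t5 : 3 / 2 * (j * X) / (1 / 4) = 6 * j * X := by ring
    have t6 : (Z / (2 * (1 / 4)) + 1 / 2) * (n * X) = (2 * Z + 1 / 2) * n * X := by ring
    rw [t4, t5, t6, he]
    linarith
  -- The potential may have the wrong sign here, so `w ^ 2` is bounded first; the energy then yields
  -- only the derivative.
  have hsq := h.sq_le (by norm_num) massc energy'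
  have hsq' : w y₀ ^ 2 ≤ (5 * n + j) * X := hsq.trans_eq (by ring)
  have hcoef : y₀ / 2 + 3 * w y₀ ≤ Z := by
    have := (hwin y₀ (by linarith) (by linarith)).2.2
    linarith [le_abs_self y₀, le_abs_self (w y₀), abs_nonneg y₀, abs_nonneg (w y₀)]
  have t1 : (y₀ / 2 + 3 * w y₀) * w y₀ ^ 2 ≤ Z * ((5 * n + j) * X) :=
    (mul_le_mul_of_nonneg_right hcoef (sq_nonneg _)).trans
      (mul_le_mul_of_nonneg_left hsq' (by linarith))
  have t2 : 0 ≤ Z * ((5 * n + j) * X) := by positivity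
  have t3 : 0 ≤ e * X := by positivity
  have t4 : 0 ≤ (5 * n + j) * X := by positivity
  constructor
  · linarith
  · linarith [sq_nonneg (deriv w y₀)]

/-! ### Pointwise bounds in the elliptic region -/

lemma exp_decay_hasDerivAt (k a x : ℝ) :
    HasDerivAt (fun x => Real.exp (-(k * (x - a)))) (-k * Real.exp (-(k * (x - a)))) x := by
  have h : HasDerivAt (fun x => -(k * (x - a))) (-(k * 1)) x :=
    (((hasDerivAt_id x).sub_const a).const_mul k).neg
  refine h.exp.congr_deriv (by ring)

lemma integral_exp_decay {k : ℝ} (hk : 0 < k) (a x y : ℝ) :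
    ∫ s in x..y, Real.exp (-(k * (s - a)))
      = (Real.exp (-(k * (x - a))) - Real.exp (-(k * (y - a)))) / k := by
  have := intervalIntegral.integral_eq_sub_of_hasDerivAt (a := x) (b := y)
    (f := fun s => -(1 / k) * Real.exp (-(k * (s - a)))) (f' := fun s => Real.exp (-(k * (s - a))))
    (fun s _ => ((exp_decay_hasDerivAt k a s).const_mul (-(1 / k))).congr_deriv (by field_simp))
    (Continuous.intervalIntegrable (by fun_prop) _ _)
  rw [this]; ring

lemma sq_integral_le_of_exp {F : ℝ → ℝ} {a b c k : ℝ} (hk : 0 < k) (hab : a ≤ b)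
    (h : ∀ x ∈ Set.Icc a b, |F x| ≤ c * Real.exp (-(k * (x - a)))) :
    ∫ x in a..b, F x ^ 2 ≤ c ^ 2 / k := by
  have h1 := intervalIntegral.norm_integral_le_of_norm_le (a := a) (b := b) (f := fun x => F x ^ 2)
    (g := fun x => c ^ 2 * Real.exp (-(2 * k * (x - a)))) (μ := volume) hab
    (Eventually.of_forall fun x hx => by
      rw [Real.norm_eq_abs, abs_pow]
      refine (pow_le_pow_left₀ (abs_nonneg _) (h x ⟨hx.1.le, hx.2⟩) 2).trans_eq ?_
      rw [mul_pow, ← Real.exp_nat_mul]; congr 2; push_cast; ring)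
    (Continuous.intervalIntegrable (by fun_prop) _ _)
  rw [intervalIntegral.integral_const_mul, integral_exp_decay (by linarith)] at h1
  refine (Real.le_norm_self _).trans (h1.trans ?_)
  rw [sub_self, mul_zero, neg_zero, Real.exp_zero, div_eq_mul_inv (c ^ 2)]
  refine mul_le_mul_of_nonneg_left ?_ (sq_nonneg _)
  rw [div_le_iff₀ (by linarith)]
  have : k⁻¹ * (2 * k) = 2 := by field_simp
  rw [this]
  linarith [Real.exp_pos (-(2 * k * (b - a)))]

lemma sq_mul_exp_neg_le {k : ℝ} (hk : 0 ≤ k) : Real.exp (-k) * k ^ 2 ≤ 2 := by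
  have h1 := Real.quadratic_le_exp_of_nonneg hk
  rw [Real.exp_neg, inv_mul_le_iff₀ (Real.exp_pos _)]
  linarith

section

variable {D A B : ℝ} {w : ℝ → ℝ}

/-- Testing the force with a decaying exponential. -/
lemma Tested.force_exp (h : Tested D A B w) {k y μ : ℝ} (hk : 1 ≤ k)
    (hy : -B ≤ y) (hyB : y + 1 ≤ B) (hμ : |avg w y (y + 1 / k)| ≤ μ) :
    |∫ x in y..(y + 1), Real.exp (-(k * (x - y))) * frc w x| ≤ D * (3 / k + 1 / B) + μ / k := by
  have hk0 : 0 < k := by linarith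
  have hk1 : 1 / k ≤ 1 := by rw [div_le_one hk0]; exact hk
  have hk2 : 0 < 1 / k := by positivity
  have hle : y ≤ y + 1 := by linarith
  have cf := frc_continuous h.smooth
  -- The exponential has mass `c / k` on `[y, y + 1]`. Subtracting `c` on an interval of length `1 /
  -- k` makes the mean zero and leaves one average of the force at that scale.
  set c := 1 - Real.exp (-k) with hc
  have hek : Real.exp (-k) ≤ 1 := Real.exp_le_one_iff.2 (by linarith)
  have hc0 : 0 ≤ c := by linarith
  have hc1 : c ≤ 1 := by linarith [Real.exp_pos (-k)]
  set I : ℝ → ℝ := (Set.Ioc y (y + 1 / k)).indicator fun _ => c with hI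
  have hI0 : ∀ x, 0 ≤ I x := fun x => Set.indicator_nonneg (fun _ _ => hc0) x
  have hI1 : ∀ x, I x ≤ 1 := fun x => (Set.indicator_le_self' (fun _ _ => hc0) x).trans hc1
  have hIm : Measurable I := measurable_const.indicator measurableSet_Ioc
  have hIi : ∀ a b, IntervalIntegrable I volume a b := fun a b => by
    rw [intervalIntegrable_iff]
    exact Measure.integrableOn_of_bounded (M := 1) (by simp) hIm.aestronglyMeasurable
      (Eventually.of_forall fun x => by rw [Real.norm_of_nonneg (hI0 x)]; exact hI1 x)
  have hei : ∀ a b, IntervalIntegrable (fun x => Real.exp (-(k * (x - y)))) volume a b :=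
    fun a b => Continuous.intervalIntegrable (by fun_prop) _ _
  set g : ℝ → ℝ := fun x => Real.exp (-(k * (x - y))) - I x with hg
  have hgi : ∀ a b, IntervalIntegrable g volume a b := fun a b => (hei a b).sub (hIi a b)
  have hexp1 : ∀ x, y ≤ x → Real.exp (-(k * (x - y))) ≤ 1 := fun x hx =>
    Real.exp_le_one_iff.2 (by nlinarith)
  have hexp3 : ∀ x, x ≤ y + 1 / k → 1 ≤ 3 * Real.exp (-(k * (x - y))) := fun x hx => by
    have h1 : k * (x - y) ≤ 1 := by
      have : k * (x - y) ≤ k * (1 / k) := mul_le_mul_of_nonneg_left (by linarith) hk0.le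
      rwa [mul_one_div_cancel hk0.ne'] at this
    rw [Real.exp_neg, ← div_eq_mul_inv, le_div_iff₀ (Real.exp_pos _), one_mul]
    exact (Real.exp_le_exp.2 h1).trans (by linarith [Real.exp_one_lt_d9])
  have hg1 : ∀ x ∈ Set.Icc y (y + 1), |g x| ≤ 1 := fun x hx => by
    have h1 := hexp1 x hx.1
    have h2 := Real.exp_pos (-(k * (x - y)))
    simp only [hg]
    rw [abs_le]; constructor <;> linarith [hI0 x, hI1 x]
  have hgI : ∀ x, y + 1 / k < x → g x = Real.exp (-(k * (x - y))) := fun x hx => by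
    have : I x = 0 := Set.indicator_of_notMem (fun h2 => absurd h2.2 (not_le.2 hx)) _
    simp only [hg, this, sub_zero]
  have hIV : ∀ V : ℝ → ℝ, ∫ x in y..(y + 1), I x * V x = c * ∫ x in y..(y + 1 / k), V x := fun V => by
    rw [hI, integral_indicator_mul (by linarith) le_rfl (by linarith),
      intervalIntegral.integral_const_mul]
  have hmean : ∫ x in y..(y + 1), g x = 0 := by
    have h1 := hIV fun _ => 1
    simp only [mul_one, intervalIntegral.integral_const, smul_eq_mul, add_sub_cancel_left] at h1
    rw [hg, intervalIntegral.integral_sub (hei _ _) (hIi _ _), h1, integral_exp_decay hk0,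
      sub_self, mul_zero, neg_zero, Real.exp_zero, add_sub_cancel_left, mul_one]
    ring
  have hprim : ∀ x ∈ Set.Icc y (y + 1), |∫ s in y..x, g s| ≤ 3 / k * Real.exp (-(k * (x - y))) :=
    fun x hx => by
      rcases le_or_gt x (y + 1 / k) with h1 | h1
      · refine (intervalIntegral_abs_le hx.1 fun s hs => hg1 s ⟨hs.1, hs.2.trans hx.2⟩).trans ?_
        have := mul_le_mul_of_nonneg_left (hexp3 x h1) hk2.le
        rw [show 3 / k * Real.exp (-(k * (x - y))) = 1 / k * (3 * Real.exp (-(k * (x - y)))) by ring]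
        linarith
      · have h2 := intervalIntegral.integral_add_adjacent_intervals (hgi y x) (hgi x (y + 1))
        rw [hmean] at h2
        have h3 : ∫ s in x..(y + 1), g s = ∫ s in x..(y + 1), Real.exp (-(k * (s - y))) :=
          intervalIntegral.integral_congr fun s hs => by
            rw [Set.uIcc_of_le hx.2] at hs
            exact hgI s (h1.trans_le hs.1)
        rw [integral_exp_decay hk0] at h3
        have h4 : ∫ s in y..x, g s
            = -((Real.exp (-(k * (x - y))) - Real.exp (-(k * (y + 1 - y)))) / k) := by linarith
        have h5 : Real.exp (-(k * (y + 1 - y))) ≤ Real.exp (-(k * (x - y))) :=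
          Real.exp_le_exp.2 (by nlinarith [hx.2])
        have h6 := Real.exp_pos (-(k * (y + 1 - y)))
        have h7 := Real.exp_pos (-(k * (x - y)))
        rw [h4, abs_neg, abs_div, abs_of_pos hk0, abs_of_nonneg (by linarith), div_mul_eq_mul_div]
        gcongr
        linarith
  have hgexp : ∀ x ∈ Set.Icc y (y + 1), |g x| ≤ 3 * Real.exp (-(k * (x - y))) := fun x hx => by
    rcases le_or_gt x (y + 1 / k) with h1 | h1
    · exact (hg1 x hx).trans (hexp3 x h1)
    · have := Real.exp_pos (-(k * (x - y)))
      rw [hgI x h1, abs_of_pos this]; linarith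
  set κ := Real.sqrt k with hκ
  have hκ0 : 0 < κ := Real.sqrt_pos.2 hk0
  have hκ2 : κ ^ 2 = k := Real.sq_sqrt hk0.le
  -- The test function lives at scale `1 / k`: its norm is of order `k^(-1/2)` and that of its
  -- primitive `k^(-3/2)`, so the pairing gains `1 / k`.
  have key := h.force_le (g := g) (a := y) (b := y + 1) (β := 1) (p := 3 / κ ^ 3) (q := 3 / κ) hle hy
    hyB (((by fun_prop : Continuous fun x => Real.exp (-(k * (x - y))))).measurable.sub hIm) hg1 hmean
    (by positivity) (by positivity)
    ((sq_integral_le_of_exp hk0 hle hprim).trans_eq (by rw [← hκ2]; field_simp))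
    ((sq_integral_le_of_exp hk0 hle hgexp).trans_eq (by rw [← hκ2]; field_simp))
  have hsq : Real.sqrt (3 / κ ^ 3 * (3 / κ)) = 3 / k := by
    rw [Real.sqrt_eq_iff_mul_self_eq (by positivity) (by positivity), ← hκ2]
    field_simp
  rw [hsq] at key
  have split : ∫ x in y..(y + 1), Real.exp (-(k * (x - y))) * frc w x
      = (∫ x in y..(y + 1), g x * frc w x) + c * ∫ x in y..(y + 1 / k), frc w x := by
    rw [← hIV, ← intervalIntegral.integral_add ((hgi _ _).mul_continuousOn cf.continuousOn)
      ((hIi _ _).mul_continuousOn cf.continuousOn)]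
    refine intervalIntegral.integral_congr fun x _ => ?_
    simp only [hg]; ring
  have e4 : ∫ x in y..(y + 1 / k), frc w x = 1 / k * avg w y (y + 1 / k) := by
    rw [avg, add_sub_cancel_left]; field_simp
  have e5 : |c * ∫ x in y..(y + 1 / k), frc w x| ≤ μ / k := by
    rw [e4, abs_mul, abs_mul, abs_of_nonneg hc0, abs_of_pos hk2]
    refine (mul_le_of_le_one_left (by positivity) hc1).trans ?_
    rw [div_mul_eq_mul_div, one_mul]; gcongr
  rw [split]
  exact (abs_add_le _ _).trans (add_le_add key e5)

/-- The decaying component of the solution is controlled by the force. -/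
lemma Tested.flux_le (h : Tested D A B w) {k y μ σ : ℝ} (hk : 1 ≤ k)
    (hy : -B ≤ y) (hyB : y + 1 ≤ B) (hμ : |avg w y (y + 1 / k)| ≤ μ)
    (hσ : ∀ x ∈ Set.Icc y (y + 1), |(x - 3 * k ^ 2) * w x + 9 * w x ^ 2| ≤ σ) :
    |deriv w y + k * w y| ≤ Real.exp (-k) * (|deriv w (y + 1)| + k * |w (y + 1)|)
      + (D * (3 / k + 1 / B) + μ / k) + σ / k := by
  have hk0 : 0 < k := by linarith
  have c0 := h.continuous
  have c1 := h.continuous_deriv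
  have c2 := h.continuous_deriv₂
  have cf := frc_continuous h.smooth
  have hle : y ≤ y + 1 := by linarith
  have hσ0 : 0 ≤ σ := (abs_nonneg _).trans (hσ y ⟨le_rfl, hle⟩)
  have hF := h.force_exp hk hy hyB hμ
  have ftc := intervalIntegral.integral_eq_sub_of_hasDerivAt (a := y) (b := y + 1)
    (f := fun x => Real.exp (-(k * (x - y))) * (deriv w x + k * w x))
    (fun x _ => (exp_decay_hasDerivAt k y x).mul
      ((h.hasDerivAt₂ x).add ((h.hasDerivAt x).const_mul k)))
    (Continuous.intervalIntegrable (by fun_prop) _ _)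
  rw [sub_self, mul_zero, neg_zero, Real.exp_zero, one_mul, add_sub_cancel_left, mul_one] at ftc
  -- The integrand is the exponential times `w'' - k ^ 2 w`, the factorized operator; the equation
  -- replaces `3 w''` by the potential terms minus the force.
  have split : 3 * ∫ x in y..(y + 1), (-k * Real.exp (-(k * (x - y))) * (deriv w x + k * w x)
        + Real.exp (-(k * (x - y))) * (deriv (deriv w) x + k * deriv w x))
      = (∫ x in y..(y + 1), Real.exp (-(k * (x - y))) * ((x - 3 * k ^ 2) * w x + 9 * w x ^ 2))
        - ∫ x in y..(y + 1), Real.exp (-(k * (x - y))) * frc w x := by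
    rw [← intervalIntegral.integral_const_mul,
      ← intervalIntegral.integral_sub (Continuous.intervalIntegrable (by fun_prop) _ _)
      (Continuous.intervalIntegrable (by fun_prop) _ _)]
    refine intervalIntegral.integral_congr fun x _ => ?_
    simp only [frc]; ring
  have hrem : |∫ x in y..(y + 1), Real.exp (-(k * (x - y))) * ((x - 3 * k ^ 2) * w x + 9 * w x ^ 2)|
      ≤ σ / k := by
    have h1 := intervalIntegral.norm_integral_le_of_norm_le (a := y) (b := y + 1)
      (f := fun x => Real.exp (-(k * (x - y))) * ((x - 3 * k ^ 2) * w x + 9 * w x ^ 2))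
      (g := fun x => Real.exp (-(k * (x - y))) * σ) (μ := volume) hle
      (Eventually.of_forall fun x hx => by
        rw [norm_mul, Real.norm_of_nonneg (Real.exp_pos _).le]
        exact mul_le_mul_of_nonneg_left (hσ x ⟨hx.1.le, hx.2⟩) (Real.exp_pos _).le)
      (Continuous.intervalIntegrable (by fun_prop) _ _)
    rw [intervalIntegral.integral_mul_const, integral_exp_decay hk0, sub_self, mul_zero, neg_zero,
      Real.exp_zero, Real.norm_eq_abs] at h1
    refine h1.trans ?_
    rw [div_mul_eq_mul_div]
    gcongr
    exact mul_le_of_le_one_left hσ0 (by linarith [Real.exp_pos (-(k * (y + 1 - y)))])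
  set X := ∫ x in y..(y + 1), Real.exp (-(k * (x - y))) * ((x - 3 * k ^ 2) * w x + 9 * w x ^ 2)
  set Z := ∫ x in y..(y + 1), Real.exp (-(k * (x - y))) * frc w x
  have e : deriv w y + k * w y
      = Real.exp (-k) * (deriv w (y + 1) + k * w (y + 1)) + (Z / 3 - X / 3) := by linarith
  have t1 : |Real.exp (-k) * (deriv w (y + 1) + k * w (y + 1))|
      ≤ Real.exp (-k) * (|deriv w (y + 1)| + k * |w (y + 1)|) := by
    rw [abs_mul, abs_of_pos (Real.exp_pos _)]
    refine mul_le_mul_of_nonneg_left ((abs_add_le _ _).trans_eq ?_) (Real.exp_pos _).le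
    rw [abs_mul, abs_of_pos hk0]
  have t2 : |Z / 3 - X / 3| ≤ |Z| + |X| := by
    refine (abs_sub _ _).trans ?_
    rw [abs_div, abs_div, abs_of_pos (by norm_num : (0 : ℝ) < 3)]
    linarith [abs_nonneg Z, abs_nonneg X]
  rw [e]
  have := abs_add_le (Real.exp (-k) * (deriv w (y + 1) + k * w (y + 1))) (Z / 3 - X / 3)
  linarith

/-- The second first-order factor is integrated from the left, with the integrating factor `exp (k
(x - R))`. The flux was integrated from the right, so both boundary terms are exponentially small.
-/
lemma Tested.le_of_flux (h : Tested D A B w) {k R Q : ℝ} (hk : 0 < k) (hQ : 0 ≤ Q)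
    (hf : ∀ y ∈ Set.Icc (R - 1) R, |deriv w y + k * w y| ≤ Q) :
    |w R| ≤ Real.exp (-k) * |w (R - 1)| + Q / k := by
  have c0 := h.continuous
  have c1 := h.continuous_deriv
  have hle : R - 1 ≤ R := by linarith
  have ftc := intervalIntegral.integral_eq_sub_of_hasDerivAt (a := R - 1) (b := R)
    (f := fun x => Real.exp (-(-k * (x - R))) * w x)
    (fun x _ => (exp_decay_hasDerivAt (-k) R x).mul (h.hasDerivAt x))
    (Continuous.intervalIntegrable (by fun_prop) _ _)
  rw [sub_self, mul_zero, neg_zero, Real.exp_zero, one_mul] at ftc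
  have e1 : -(-k * (R - 1 - R)) = -k := by ring
  rw [e1] at ftc
  have h1 := intervalIntegral.norm_integral_le_of_norm_le (a := R - 1) (b := R)
      (f := fun x => -(-k) * Real.exp (-(-k * (x - R))) * w x + Real.exp (-(-k * (x - R))) * deriv w x)
      (g := fun x => Real.exp (-(-k * (x - R))) * Q) (μ := volume) hle
      (Eventually.of_forall fun x hx => by
        rw [show -(-k) * Real.exp (-(-k * (x - R))) * w x + Real.exp (-(-k * (x - R))) * deriv w x
          = Real.exp (-(-k * (x - R))) * (deriv w x + k * w x) by ring,
          norm_mul, Real.norm_of_nonneg (Real.exp_pos _).le]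
        exact mul_le_mul_of_nonneg_left (hf x ⟨hx.1.le, hx.2⟩) (Real.exp_pos _).le)
      (Continuous.intervalIntegrable (by fun_prop) _ _)
  have h2 : ∫ x in (R - 1)..R, Real.exp (-(-k * (x - R))) ≤ 1 / k := by
    have := intervalIntegral.integral_eq_sub_of_hasDerivAt (a := R - 1) (b := R)
      (f := fun s => 1 / k * Real.exp (-(-k * (s - R)))) (f' := fun s => Real.exp (-(-k * (s - R))))
      (fun s _ => ((exp_decay_hasDerivAt (-k) R s).const_mul (1 / k)).congr_deriv (by field_simp))
      (Continuous.intervalIntegrable (by fun_prop) _ _)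
    rw [this, sub_self, mul_zero, neg_zero, Real.exp_zero, mul_one]
    have : 0 < 1 / k * Real.exp (-(-k * (R - 1 - R))) := by positivity
    linarith
  rw [intervalIntegral.integral_mul_const, ftc, Real.norm_eq_abs] at h1
  have h3 : (∫ x in (R - 1)..R, Real.exp (-(-k * (x - R)))) * Q ≤ Q / k :=
    (mul_le_mul_of_nonneg_right h2 hQ).trans_eq (by ring)
  have h4 := abs_sub_abs_le_abs_sub (w R) (Real.exp (-k) * w (R - 1))
  rw [abs_mul, abs_of_pos (Real.exp_pos _)] at h4
  linarith

end

set_option maxHeartbeats 1000000 in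
/-- Pointwise bounds in the elliptic region. -/
lemma exists_elliptic : ∃ C, 0 < C ∧ ∀ D A B : ℝ, ∀ w : ℝ → ℝ, 0 ≤ D → 0 < A → A ≤ 1 / 100 →
    1 ≤ B → A ^ 2 ≤ D → Tested D A B w → ∀ r : ℝ, 0 < r → 4 ≤ r ^ 4 → 4 * r ^ 4 ≤ B →
    |w (r ^ 4)| ≤ C * (D * Real.log (r ^ 4) / r ^ 4 + A / r ^ 5) ∧
      |deriv w (r ^ 4)| ≤ C * (D * Real.log (r ^ 4) / r ^ 2 + A / r ^ 3) := by
  obtain ⟨C, hC, hC'⟩ := exists_avg_le_log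
  refine ⟨12 + 3 * (24 + 2 * (4 + 2 * C)), by positivity,
    fun D A B w hD hA hA1 hB hAD h r hr hR4 hRB => ?_⟩
  set R := r ^ 4 with hR
  have hB0 : 0 < B := by linarith
  have h3 : (0 : ℝ) < Real.sqrt 3 := by positivity
  have h33 : Real.sqrt 3 ^ 2 = 3 := Real.sq_sqrt (by norm_num)
  -- The potential is frozen at `R`; on the unit window around `R` the error `x - 3 k ^ 2` is at
  -- most one.
  obtain ⟨k, hk0, hkR, hkr, hrk⟩ : ∃ k : ℝ, 0 < k ∧ 3 * k ^ 2 = R ∧ k ≤ r ^ 2 ∧ r ^ 2 ≤ 2 * k := by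
    have hk : 3 * (r ^ 2 / Real.sqrt 3) ^ 2 = R := by
      rw [div_pow, h33, hR]; ring
    have hp : 0 < r ^ 2 / Real.sqrt 3 := by positivity
    refine ⟨_, hp, hk, ?_, ?_⟩
    · refine le_of_sq_le_sq ?_ (by positivity)
      have : (r ^ 2) ^ 2 = R := by rw [hR]; ring
      nlinarith
    · refine le_of_sq_le_sq ?_ (by positivity)
      have : (r ^ 2) ^ 2 = R := by rw [hR]; ring
      nlinarith
  have hk1 : 1 ≤ k := by nlinarith
  have hkRle : k ≤ R := by nlinarith
  set L := Real.log R with hL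
  have hL1 : 1 ≤ L := by
    rw [hL, Real.le_log_iff_exp_le (by linarith)]
    linarith [Real.exp_one_lt_d9]
  have hwin : ∀ y ∈ Set.Icc (R - 1) (R + 1), |w y| ≤ 2 * A / r ∧ |deriv w y| ≤ 2 * A * r :=
    fun y hy => by
    have hy0 : |y| = y := abs_of_nonneg (by linarith [hy.1])
    have j1 : (r / 2) ^ 4 ≤ jb y := by
      have := abs_le_jb y
      rw [div_pow, ← hR]; linarith [hy.1]
    have j2 : jb y ≤ (2 * r) ^ 4 := by
      have := jb_le_abs_add_one y
      rw [mul_pow, ← hR]; linarith [hy.2]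
    refine ⟨?_, ?_⟩
    · refine (h.bound y).trans ((mul_le_mul_of_nonneg_left (jb_rpow_neg_le_div hr j1) hA.le).trans_eq ?_)
      ring
    · refine (h.bound_deriv y).trans
        ((mul_le_mul_of_nonneg_left (jb_rpow_le_mul hr j2) hA.le).trans_eq ?_)
      ring
  -- Of the exponential smallness only one factor `1 / R` is used. It brings boundary terms of sizes
  -- `A r` and `A / r` down to `A / r ^ 3` and `A / r ^ 5`.
  have hek := sq_mul_exp_neg_le hk0.le
  have hE := Real.exp_pos (-k)
  have hEr4 : Real.exp (-k) * r ^ 4 ≤ 6 := by rw [← hR, ← hkR]; linarith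
  have hEkr : Real.exp (-k) * (k * r ^ 2) ≤ 4 := by
    have : k * r ^ 2 ≤ 2 * k ^ 2 := by nlinarith
    linarith [mul_le_mul_of_nonneg_left this hE.le]
  set U := D * L / r ^ 2 + A / r ^ 3 with hU
  have hU1 : 0 ≤ D * L / r ^ 2 := by positivity
  have hU2 : 0 ≤ A / r ^ 3 := by positivity
  set C₁ := 24 + 2 * (4 + 2 * C) with hC₁
  have hC₁0 : 0 < C₁ := by positivity
  have hkinv : 1 / k ≤ 2 / r ^ 2 := by
    rw [div_le_div_iff₀ hk0 (by positivity)]; linarith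
  have flux : ∀ y ∈ Set.Icc (R - 1) R, |deriv w y + k * w y| ≤ C₁ * U := fun y hy => by
    have hμ := hC' D A B w hD hA.le hB hAD h R y (1 / k) (by linarith) (by linarith)
      (by linarith [hy.1]) hy.2 (by rw [inv_eq_one_div]; exact one_div_le_one_div_of_le hk0 hkRle)
      (by rw [div_le_one hk0]; exact hk1)
    have hf := h.flux_le (k := k) (y := y) (σ := 2 * (2 * A / r)) hk1 (by linarith [hy.1])
      (by linarith [hy.2]) hμ fun x hx => by
        have hx1 := (hwin x ⟨by linarith [hx.1, hy.1], by linarith [hx.2, hy.2]⟩).1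
        have hx2 := h.abs_apply_le hA.le x
        rw [hkR]
        have e : (x - R) * w x + 9 * w x ^ 2 = ((x - R) + 9 * w x) * w x := by ring
        rw [e, abs_mul]
        have : |x - R + 9 * w x| ≤ 2 := by
          have t1 : |x - R| ≤ 1 := abs_le.2 ⟨by linarith [hx.1, hy.1], by linarith [hx.2, hy.2]⟩
          have t2 := abs_add_le (x - R) (9 * w x)
          rw [abs_mul, abs_of_pos (by norm_num : (0 : ℝ) < 9)] at t2
          linarith
        exact mul_le_mul this hx1 (abs_nonneg _) zero_le_two
    refine hf.trans ?_
    have hp := hwin (y + 1) ⟨by linarith [hy.1], by linarith [hy.2]⟩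
    have a1 : Real.exp (-k) * (|deriv w (y + 1)| + k * |w (y + 1)|) ≤ 20 * (A / r ^ 3) := by
      calc Real.exp (-k) * (|deriv w (y + 1)| + k * |w (y + 1)|)
          ≤ Real.exp (-k) * (2 * A * r + k * (2 * A / r)) := by
            gcongr
            · exact hp.2
            · exact hp.1
        _ = 2 * (A / r ^ 3) * (Real.exp (-k) * r ^ 4 + Real.exp (-k) * (k * r ^ 2)) := by
            field_simp
        _ ≤ 2 * (A / r ^ 3) * (6 + 4) := by gcongr
        _ = _ := by ring
    have a2 : 2 * (2 * A / r) / k ≤ 8 * (A / r ^ 3) := by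
      calc 2 * (2 * A / r) / k = 4 * A / r * (1 / k) := by ring
        _ ≤ 4 * A / r * (2 / r ^ 2) := by gcongr
        _ = _ := by field_simp; norm_num
    have a3 : 1 / B ≤ 1 / k := one_div_le_one_div_of_le hk0 (by linarith)
    have a4 : D * (3 / k + 1 / B) + C * D * (1 + L) / k ≤ 2 * (4 + 2 * C) * (D * L / r ^ 2) := by
      calc D * (3 / k + 1 / B) + C * D * (1 + L) / k
          ≤ D * (3 / k + 1 / k) + C * D * (1 + L) / k := by gcongr
        _ = (4 * D + C * D * (1 + L)) * (1 / k) := by ring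
        _ ≤ (4 * D + C * D * (1 + L)) * (2 / r ^ 2) := by gcongr
        _ ≤ (4 * D * L + C * D * (L + L)) * (2 / r ^ 2) := by
            have : 4 * D ≤ 4 * D * L := le_mul_of_one_le_right (by positivity) hL1
            gcongr
        _ = _ := by ring
    have a5 : C₁ * U = 24 * (D * L / r ^ 2) + 2 * (4 + 2 * C) * (D * L / r ^ 2)
        + 24 * (A / r ^ 3) + 2 * (4 + 2 * C) * (A / r ^ 3) := by rw [hC₁, hU]; ring
    have a6 : 8 * (A / r ^ 3) ≤ 2 * (4 + 2 * C) * (A / r ^ 3) := by gcongr; linarith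
    linarith
  have hU0 : 0 ≤ U := by positivity
  have hw := h.le_of_flux hk0 (by positivity) flux
  have hw1 := (hwin (R - 1) ⟨le_rfl, by linarith⟩).1
  have b1 : Real.exp (-k) * |w (R - 1)| ≤ 12 * (A / r ^ 5) := by
    calc Real.exp (-k) * |w (R - 1)| ≤ Real.exp (-k) * (2 * A / r) := by gcongr
      _ = 2 * (A / r ^ 5) * (Real.exp (-k) * r ^ 4) := by field_simp
      _ ≤ 2 * (A / r ^ 5) * 6 := by gcongr
      _ = _ := by ring
  have eU : U / r ^ 2 = D * L / r ^ 4 + A / r ^ 5 := by rw [hU]; field_simp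
  have b2 : C₁ * U / k ≤ 2 * C₁ * (U / r ^ 2) := by
    calc C₁ * U / k = C₁ * U * (1 / k) := by ring
      _ ≤ C₁ * U * (2 / r ^ 2) := by gcongr
      _ = _ := by ring
  have hDL : 0 ≤ D * L / r ^ 4 := by positivity
  have hA5 : 0 ≤ A / r ^ 5 := by positivity
  have b3 : |w R| ≤ (12 + 2 * C₁) * (U / r ^ 2) := by
    have : 12 * (A / r ^ 5) ≤ 12 * (U / r ^ 2) := by rw [eU]; linarith
    linarith
  constructor
  · have eU2 : D * L / R + A / r ^ 5 = U / r ^ 2 := by rw [eU]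
    rw [eU2]
    refine b3.trans (mul_le_mul_of_nonneg_right (by linarith) (by positivity))
  · have c1 : |deriv w R| ≤ |deriv w R + k * w R| + k * |w R| := by
      have := abs_sub (deriv w R + k * w R) (k * w R)
      rw [add_sub_cancel_right, abs_mul, abs_of_pos hk0] at this
      exact this
    have c2 : k * |w R| ≤ (12 + 2 * C₁) * U := by
      calc k * |w R| ≤ r ^ 2 * ((12 + 2 * C₁) * (U / r ^ 2)) := by gcongr
        _ = _ := by field_simp
    have c3 := flux R ⟨by linarith, le_rfl⟩
    linarith

/-! ### Closing the bootstrap -/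

lemma jb_rpow_neg (y : ℝ) : jb y ^ (-1 / 4 : ℝ) = (jb y ^ (1 / 4 : ℝ))⁻¹ := by
  rw [← Real.rpow_neg (jb_pos y).le]; norm_num

lemma exists_fourth_root {x : ℝ} (hx : 0 < x) : ∃ r, 0 < r ∧ r ^ 4 = x :=
  ⟨x ^ (1 / 4 : ℝ), by positivity, by
    rw [← Real.rpow_natCast, ← Real.rpow_mul hx.le]; norm_num⟩

lemma jb_rpow_mem {r y : ℝ} (hr : 1 ≤ r) (hy : |y| = r ^ 4) :
    r ≤ jb y ^ (1 / 4 : ℝ) ∧ jb y ^ (1 / 4 : ℝ) ≤ 2 * r := by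
  have hr0 : 0 < r := by linarith
  have hr4 : 1 ≤ r ^ 4 := one_le_pow₀ hr
  constructor
  · have h1 : r = (r ^ 4) ^ (1 / 4 : ℝ) := by
      rw [← Real.rpow_natCast, ← Real.rpow_mul hr0.le]; norm_num
    nth_rw 1 [h1]
    exact Real.rpow_le_rpow (by positivity) (hy ▸ abs_le_jb y) (by norm_num)
  · refine jb_rpow_le_mul hr0 ((jb_le_abs_add_one y).trans ?_)
    rw [hy, mul_pow]; linarith

/-- Self-improvement of the pointwise bounds. -/
lemma exists_improve : ∃ C, 0 < C ∧ ∀ Y : ℝ, ∃ B : ℝ, 1 ≤ B ∧ Y ≤ B ∧ ∀ D A : ℝ, ∀ w : ℝ → ℝ,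
    0 ≤ D → 0 < A → A ≤ 1 / 100 → A ^ 2 ≤ D → Tested D A B w → ∀ y : ℝ, |y| ≤ Y →
    |w y| ≤ (C * (Real.sqrt (D * A) + D) + A / 8) * jb y ^ (-1 / 4 : ℝ) ∧
      |deriv w y| ≤ (C * (Real.sqrt (D * A) + D) + A / 8) * jb y ^ (1 / 4 : ℝ) := by
  obtain ⟨C₁, h₁, H₁⟩ := exists_hyperbolic
  obtain ⟨C₃, h₃, H₃⟩ := exists_elliptic
  -- Beyond `Y₁` the elliptic contribution satisfies `C₃ A / |y| ≤ A / 16`, half of the `A / 8` that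
  -- is allowed; the other factor `2` comes from `⟨y⟩^(1/4) ≤ 2 r`.
  set Y₁ := 4 + 16 * C₃ with hY₁
  obtain ⟨C₂, h₂, H₂⟩ := exists_middle Y₁ (by positivity)
  set C := 2 * Real.sqrt C₁ + (Y₁ + 1) * Real.sqrt C₂ + 8 * C₃ with hC
  have hY₁0 : 4 ≤ Y₁ := by linarith
  have hs1 := Real.sqrt_nonneg C₁
  have hs2 := Real.sqrt_nonneg C₂
  have hYs2 : 0 ≤ Y₁ * Real.sqrt C₂ := by positivity
  refine ⟨C, by positivity, fun Y => ⟨max (4 * Y) ((Y₁ + 2) ^ 2), ?_, ?_,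
    fun D A w hD hA hA1 hAD h y hy => ?_⟩⟩
  · exact le_max_of_le_right (by nlinarith)
  · rcases le_or_gt 0 Y with h | h
    · exact le_max_of_le_left (by linarith)
    · exact le_max_of_le_right (by nlinarith)
  set B := max (4 * Y) ((Y₁ + 2) ^ 2)
  have hB1 : 1 ≤ B := le_max_of_le_right (by nlinarith)
  have hBY : 4 * Y ≤ B := le_max_left _ _
  set s := Real.sqrt (D * A) with hs
  have hs0 : 0 ≤ s := Real.sqrt_nonneg _
  have hss : s ^ 2 = D * A := Real.sq_sqrt (by positivity)
  set a := jb y ^ (1 / 4 : ℝ) with ha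
  have ha1 : 1 ≤ a := Real.one_le_rpow (one_le_jb y) (by norm_num)
  have ha0 : 0 < a := by linarith
  set Γ := C * (s + D) + A / 8 with hΓ
  have key : a * |w y| ≤ Γ ∧ |deriv w y| ≤ Γ * a := by
    rcases le_or_gt |y| Y₁ with hm | hm
    · obtain ⟨e1, e2⟩ := H₂ D A B w hD hA hA1 (le_max_right _ _) hAD h y hm
      have f1 : |w y| ≤ Real.sqrt C₂ * s := abs_le_of_sq_le_sq (by
        rw [mul_pow, hss, Real.sq_sqrt h₂.le]; exact e1) (by positivity)
      have f2 : |deriv w y| ≤ Real.sqrt C₂ * s := abs_le_of_sq_le_sq (by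
        rw [mul_pow, hss, Real.sq_sqrt h₂.le]; exact e2) (by positivity)
      have haY : a ≤ Y₁ + 1 := (Real.rpow_le_self_of_one_le (one_le_jb y) (by norm_num)).trans
        ((jb_le_abs_add_one y).trans (by linarith))
      have g : (Y₁ + 1) * (Real.sqrt C₂ * s) ≤ Γ := by
        have : 0 ≤ 2 * Real.sqrt C₁ * s + 8 * C₃ * s + C * D + A / 8 := by positivity
        rw [hΓ, hC] at *; linarith
      refine ⟨(mul_le_mul haY f1 (abs_nonneg _) (by linarith)).trans g, ?_⟩
      have g2 : Real.sqrt C₂ * s ≤ (Y₁ + 1) * (Real.sqrt C₂ * s) :=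
        le_mul_of_one_le_left (by positivity) (by linarith)
      have g3 : Γ ≤ Γ * a := le_mul_of_one_le_right (by positivity) ha1
      linarith
    · obtain ⟨r, hr0, hr⟩ := exists_fourth_root (x := |y|) (by linarith)
      have hr1 : 1 ≤ r := by
        by_contra hlt
        have := pow_le_one₀ (n := 4) hr0.le (not_le.1 hlt).le
        linarith
      obtain ⟨ra, ar⟩ := jb_rpow_mem hr1 hr.symm
      rw [← ha] at ra ar
      have hrB : 4 * r ^ 4 ≤ B := by rw [hr]; linarith
      rcases le_or_gt y 0 with hneg | hpos
      · have hyr : -r ^ 4 = y := by rw [hr, abs_of_nonpos hneg]; ring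
        obtain ⟨e1, e2⟩ := H₁ D A B w hD hA hA1 hB1 hAD h r hr1 hrB
        rw [hyr] at e1 e2
        have f1 : |r * w y| ≤ Real.sqrt C₁ * s := abs_le_of_sq_le_sq (by
          rw [mul_pow, mul_pow, hss, Real.sq_sqrt h₁.le]; exact e1) (by positivity)
        have f2 : |deriv w y| ≤ Real.sqrt C₁ * s * r := abs_le_of_sq_le_sq (by
          rw [mul_pow, mul_pow, hss, Real.sq_sqrt h₁.le]; exact e2) (by positivity)
        rw [abs_mul, abs_of_pos hr0] at f1
        have g : 2 * Real.sqrt C₁ * s ≤ Γ := by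
          have : 0 ≤ (Y₁ + 1) * Real.sqrt C₂ * s + 8 * C₃ * s + C * D + A / 8 := by positivity
          rw [hΓ, hC] at *; linarith
        have g0 : 0 ≤ Real.sqrt C₁ * s := by positivity
        constructor
        · have := mul_le_mul_of_nonneg_right ar (abs_nonneg (w y))
          linarith
        · refine f2.trans (mul_le_mul (by linarith) ra hr0.le (by linarith))
      · have hyr : r ^ 4 = y := by rw [hr, abs_of_pos hpos]
        obtain ⟨e1, e2⟩ := H₃ D A B w hD hA hA1 hB1 hAD h r hr0 (by rw [hr]; linarith) hrB
        rw [hyr] at e1 e2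
        -- For the bound on the whole line there is room to spare, and the logarithm is simply
        -- absorbed by a power.
        have hlog : Real.log y ≤ 4 * r ^ 3 := by
          rw [← hyr, Real.log_pow]
          have h1 := Real.log_le_sub_one_of_pos hr0
          have h2 : r ≤ r ^ 3 := le_self_pow₀ hr1 (by norm_num)
          push_cast; linarith
        have hlog' : D * Real.log y / r ^ 3 ≤ 4 * D := by
          rw [div_le_iff₀ (by positivity)]
          calc D * Real.log y ≤ D * (4 * r ^ 3) := by gcongr
            _ = _ := by ring
        have hA4 : C₃ * (A / r ^ 4) ≤ A / 16 := by
          rw [hr, mul_div_assoc', div_le_div_iff₀ (by linarith) (by norm_num)]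
          nlinarith
        have g : 2 * (C₃ * (D * Real.log y / r ^ 3 + A / r ^ 4)) ≤ Γ := by
          have : 0 ≤ (2 * Real.sqrt C₁ + (Y₁ + 1) * Real.sqrt C₂) * (s + D) + 8 * C₃ * s := by
            positivity
          have := mul_le_mul_of_nonneg_left hlog' h₃.le
          rw [hΓ, hC] at *; linarith
        have hyp : 0 ≤ C₃ * (D * Real.log y / r ^ 3 + A / r ^ 4) := by
          have := Real.log_nonneg (x := y) (by rw [abs_of_pos hpos] at hm; linarith)
          positivity
        constructor
        · calc a * |w y| ≤ 2 * r * (C₃ * (D * Real.log y / y + A / r ^ 5)) := by gcongr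
            _ = 2 * (C₃ * (D * Real.log y / r ^ 3 + A / r ^ 4)) := by
              nth_rw 2 [← hyr]; field_simp
            _ ≤ Γ := g
        · calc |deriv w y| ≤ C₃ * (D * Real.log y / r ^ 2 + A / r ^ 3) := e2
            _ = C₃ * (D * Real.log y / r ^ 3 + A / r ^ 4) * r := by field_simp
            _ ≤ Γ * a := mul_le_mul (by linarith) ra hr0.le (by linarith)
  refine ⟨?_, key.2⟩
  rw [jb_rpow_neg, ← ha, ← div_eq_mul_inv, le_div_iff₀ ha0, mul_comm]
  exact key.1

/-- The improved bounds in the elliptic region. -/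
lemma exists_elliptic_log : ∃ C, 0 < C ∧ ∀ D A B : ℝ, ∀ w : ℝ → ℝ, 0 ≤ D → 0 < A → A ≤ 1 / 100 →
    1 ≤ B → A ^ 2 ≤ D → Tested D A B w → ∀ y : ℝ, 4 ≤ y → 4 * y ≤ B →
    jb y * |w y| ≤ C * (D + A) * Real.log (jb y) ∧
      |deriv w y| ≤ C * (D + A) * Real.log (jb y) / jb y ^ (1 / 2 : ℝ) := by
  obtain ⟨C, hC, H⟩ := exists_elliptic
  refine ⟨2 * C, by positivity, fun D A B w hD hA hA1 hB hAD h y hy hyB => ?_⟩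
  obtain ⟨r, hr0, hr⟩ := exists_fourth_root (x := y) (by linarith)
  have hr1 : 1 ≤ r := by
    by_contra hlt
    have := pow_le_one₀ (n := 4) hr0.le (not_le.1 hlt).le
    linarith
  obtain ⟨e1, e2⟩ := H D A B w hD hA hA1 hB hAD h r hr0 (by rw [hr]; exact hy) (by rw [hr]; exact hyB)
  have hjy : y ≤ jb y := (le_abs_self y).trans (abs_le_jb y)
  have hj2 : jb y ≤ 2 * r ^ 4 := by
    have := jb_le_abs_add_one y
    rw [abs_of_nonneg (by linarith)] at this
    rw [hr]; linarith
  have hj := jb_pos y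
  have hL1 : 1 ≤ Real.log y := by
    rw [Real.le_log_iff_exp_le (by linarith)]
    linarith [Real.exp_one_lt_d9]
  have hLj : Real.log y ≤ Real.log (jb y) := Real.log_le_log (by linarith) hjy
  rw [hr] at e1 e2
  have hArL : A / r ≤ A * Real.log y :=
    (div_le_self hA.le hr1).trans (le_mul_of_one_le_right hA.le hL1)
  have hmain : 2 * C * (D * Real.log y + A / r) ≤ 2 * C * (D + A) * Real.log (jb y) := by
    calc 2 * C * (D * Real.log y + A / r) ≤ 2 * C * (D * Real.log y + A * Real.log y) := by gcongr
      _ = 2 * C * (D + A) * Real.log y := by ring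
      _ ≤ _ := by gcongr
  constructor
  · calc jb y * |w y| ≤ 2 * r ^ 4 * (C * (D * Real.log y / y + A / r ^ 5)) := by gcongr
      _ = 2 * C * (D * Real.log y + A / r) := by nth_rw 2 [← hr]; field_simp
      _ ≤ _ := hmain
  · have hjp : 0 < jb y ^ (1 / 2 : ℝ) := by positivity
    have hjs : jb y ^ (1 / 2 : ℝ) ≤ 2 * r ^ 2 := by
      rw [← Real.sqrt_eq_rpow]
      refine Real.sqrt_le_iff.2 ⟨by positivity, hj2.trans ?_⟩
      have : (2 * r ^ 2) ^ 2 = 4 * r ^ 4 := by ring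
      have : 0 < r ^ 4 := by positivity
      linarith
    rw [le_div_iff₀ hjp]
    calc |deriv w y| * jb y ^ (1 / 2 : ℝ)
        ≤ C * (D * Real.log y / r ^ 2 + A / r ^ 3) * (2 * r ^ 2) := by gcongr
      _ = 2 * C * (D * Real.log y + A / r) := by field_simp
      _ ≤ _ := hmain

section

variable {v : ℝ → ℝ} {D A B : ℝ}

/-- The bound `β` is the same for all mollifications, so their distance `e` to `v` may tend to zero.
-/
lemma abs_le_of_tested (hv : Differentiable ℝ v) (hA : 0 ≤ A) (hD : 0 < D) (hB : 1 ≤ B)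
    (h0 : ∀ y, |v y| ≤ A * jb y ^ (-1 / 4 : ℝ)) (h0' : ∀ y, |deriv v y| ≤ A * jb y ^ (1 / 4 : ℝ))
    (hW : WeakTests D v) {y β : ℝ} (hy : |y| ≤ B)
    (H : ∀ w, Tested D (2 * A) B w → |w y| ≤ β) : |v y| ≤ β := by
  refine le_of_forall_pos_le_add fun e he => ?_
  obtain ⟨w, hw, hwv⟩ := exists_tested hv hA hD hB h0 h0' hW he
  have h1 := abs_sub_abs_le_abs_sub (v y) (w y)
  rw [abs_sub_comm] at h1
  linarith [H w hw, hwv y hy]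

/-- Uniform closeness says nothing about derivatives, but Lipschitz bounds survive uniform limits.
Hence the bound is needed on a neighbourhood of `y`, and continuity of `β` recovers its value at
`y`. -/
lemma abs_deriv_le_of_tested (hv : Differentiable ℝ v) (hA : 0 ≤ A) (hD : 0 < D) (hB : 1 ≤ B)
    (h0 : ∀ y, |v y| ≤ A * jb y ^ (-1 / 4 : ℝ)) (h0' : ∀ y, |deriv v y| ≤ A * jb y ^ (1 / 4 : ℝ))
    (hW : WeakTests D v) {y d : ℝ} (hd : 0 < d) (hy : |y| + d ≤ B) {β : ℝ → ℝ} (hβ : ContinuousAt β y)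
    (H : ∀ w, Tested D (2 * A) B w → ∀ z, |z - y| ≤ d → |deriv w z| ≤ β z) :
    |deriv v y| ≤ β y := by
  refine le_of_forall_pos_le_add fun η hη => ?_
  have hβ1 : ∀ᶠ z in 𝓝 y, β z ≤ β y + η := hβ.eventually (eventually_le_nhds (by linarith))
  obtain ⟨δ, hδ, hδb⟩ := Metric.eventually_nhds_iff_ball.1 hβ1
  have hβ0 : 0 ≤ β y := by
    obtain ⟨w, hw, -⟩ := exists_tested hv hA hD hB h0 h0' hW one_pos
    exact (abs_nonneg _).trans (H w hw y (by simpa using hd.le))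
  change ‖deriv v y‖ ≤ _
  refine norm_deriv_le_of_lip' (by positivity) ?_
  filter_upwards [Metric.ball_mem_nhds y (lt_min hδ hd)] with z hz
  rw [Real.norm_eq_abs, Real.norm_eq_abs]
  refine le_of_forall_pos_le_add fun e he => ?_
  obtain ⟨w, hw, hwv⟩ := exists_tested hv hA hD hB h0 h0' hW (half_pos he)
  have hzy : |z - y| < min δ d := by rwa [Metric.mem_ball, Real.dist_eq] at hz
  have hzd : |z - y| ≤ d := hzy.le.trans (min_le_right _ _)
  have hmv := Convex.norm_image_sub_le_of_norm_deriv_le (f := w) (s := Metric.ball y (min δ d))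
    (C := β y + η) (x := y) (y := z) (fun x _ => hw.smooth.differentiable (by norm_num) x)
    (fun x hx => by
      have hx1 : |x - y| < min δ d := by rwa [Metric.mem_ball, Real.dist_eq] at hx
      exact (H w hw x (hx1.le.trans (min_le_right _ _))).trans
        (hδb x (Metric.ball_subset_ball (min_le_left _ _) hx))) (convex_ball _ _)
    (Metric.mem_ball_self (lt_min hδ hd)) hz
  rw [Real.norm_eq_abs, Real.norm_eq_abs] at hmv
  have hz1 := hwv z (by
    have := abs_add_le y (z - y)
    rw [add_sub_cancel] at this; linarith)
  have hy1 := hwv y (by linarith)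
  have e1 : v z - v y = (w z - w y) - (w z - v z) + (w y - v y) := by ring
  have e2 := abs_add_le ((w z - w y) - (w z - v z)) (w y - v y)
  have e3 := abs_sub (w z - w y) (w z - v z)
  rw [e1]; linarith

/-- Closing the bootstrap at time one. -/
lemma exists_bootstrap : ∃ C, 0 < C ∧ ∀ D A₀ : ℝ, ∀ v : ℝ → ℝ, 0 < D → 0 < A₀ → 2 * A₀ ≤ 1 / 100 →
    (2 * A₀) ^ 2 ≤ D → Differentiable ℝ v → WeakTests D v →
    (∀ y, |v y| ≤ A₀ * jb y ^ (-1 / 4 : ℝ)) → (∀ y, |deriv v y| ≤ A₀ * jb y ^ (1 / 4 : ℝ)) →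
    ∃ A, 0 < A ∧ A ≤ A₀ ∧ A ≤ C * D ∧ (∀ y, |v y| ≤ A * jb y ^ (-1 / 4 : ℝ)) ∧
      ∀ y, |deriv v y| ≤ A * jb y ^ (1 / 4 : ℝ) := by
  obtain ⟨C, hC, H⟩ := exists_improve
  set K := 4 * C ^ 2 + 2 * C with hK
  refine ⟨K + 1, by positivity, fun D A₀ v hD hA₀ hA1 hA2 hv hW h0 h0' => ?_⟩
  set T : Set ℝ := {A | 0 < A ∧ A ≤ A₀ ∧ (∀ y, |v y| ≤ A * jb y ^ (-1 / 4 : ℝ)) ∧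
      ∀ y, |deriv v y| ≤ A * jb y ^ (1 / 4 : ℝ)} with hT
  have hne : T.Nonempty := ⟨A₀, hA₀, le_rfl, h0, h0'⟩
  have hbd : BddBelow T := ⟨0, fun A hA => hA.1.le⟩
  -- The improvement is applied with `2 A`, since mollification doubles the bounds. The window may
  -- depend on the point, because the resulting constant does not.
  have himp : ∀ A ∈ T, sInf T ≤ A / 2 + K * D / 2 := fun A hA => by
    obtain ⟨p0, p1, p2, p3⟩ := hA
    set Γ := C * (Real.sqrt (D * (2 * A)) + D) + 2 * A / 8 with hΓ
    have hΓ0 : 0 < Γ := by positivity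
    have hsq : (2 * A) ^ 2 ≤ D := (pow_le_pow_left₀ (by positivity) (by linarith) 2).trans hA2
    have q2 : ∀ y, |v y| ≤ Γ * jb y ^ (-1 / 4 : ℝ) := fun y => by
      obtain ⟨B, hB1, hBy, HB⟩ := H |y|
      exact abs_le_of_tested hv p0.le hD hB1 p2 p3 hW hBy fun w hw =>
        (HB D (2 * A) w hD.le (by positivity) (by linarith) hsq hw y le_rfl).1
    have q3 : ∀ y, |deriv v y| ≤ Γ * jb y ^ (1 / 4 : ℝ) := fun y => by
      obtain ⟨B, hB1, hBy, HB⟩ := H (|y| + 1)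
      refine abs_deriv_le_of_tested (β := fun y => Γ * jb y ^ (1 / 4 : ℝ)) hv p0.le hD hB1 p2 p3 hW
        one_pos hBy ?_ fun w hw z hz =>
        (HB D (2 * A) w hD.le (by positivity) (by linarith) hsq hw z ?_).2
      · exact continuousAt_const.mul (jb_continuous.continuousAt.rpow_const (Or.inr (by norm_num)))
      · have := abs_add_le y (z - y)
        rw [add_sub_cancel] at this; linarith
    have hmem : min Γ A₀ ∈ T := by
      refine ⟨lt_min hΓ0 hA₀, min_le_right _ _, fun y => ?_, fun y => ?_⟩
      · rcases min_choice Γ A₀ with h | h <;> rw [h]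
        exacts [q2 y, h0 y]
      · rcases min_choice Γ A₀ with h | h <;> rw [h]
        exacts [q3 y, h0' y]
    refine (csInf_le hbd hmem).trans ((min_le_left _ _).trans ?_)
    -- The arithmetic–geometric inequality; this `A / 4` and the `2 A / 8` from the improvement add
    -- up to `A / 2`.
    have hs : C * Real.sqrt (D * (2 * A)) ≤ A / 4 + 2 * C ^ 2 * D := by
      have h1 : C * Real.sqrt (D * (2 * A)) = Real.sqrt (C ^ 2 * (D * (2 * A))) := by
        rw [Real.sqrt_mul (sq_nonneg C), Real.sqrt_sq hC.le]
      rw [h1]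
      refine Real.sqrt_le_iff.2 ⟨by positivity, ?_⟩
      nlinarith [sq_nonneg (A / 4 - 2 * C ^ 2 * D)]
    rw [hΓ, hK]; linarith
  have hle : sInf T ≤ K * D := by
    by_contra hlt
    obtain ⟨A, hA, hA'⟩ := exists_lt_of_csInf_lt hne
      (show sInf T < 2 * sInf T - K * D by linarith [not_le.1 hlt])
    linarith [himp A hA]
  obtain ⟨A, hA, hA'⟩ := exists_lt_of_csInf_lt hne (show sInf T < (K + 1) * D by linarith)
  exact ⟨A, hA.1, hA.2.1, hA'.le, hA.2.2.1, hA.2.2.2⟩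

/-- The pointwise bounds at time one. -/
lemma exists_pointwise (κ : ℝ) (hκ : 0 < κ) : ∃ C, 0 < C ∧ ∀ D A₀ : ℝ, ∀ v : ℝ → ℝ, 0 < D →
    0 < A₀ → 2 * A₀ ≤ 1 / 100 → (2 * A₀) ^ 2 ≤ D → Differentiable ℝ v → WeakTests D v →
    (∀ y, |v y| ≤ A₀ * jb y ^ (-1 / 4 : ℝ)) → (∀ y, |deriv v y| ≤ A₀ * jb y ^ (1 / 4 : ℝ)) →
    (∀ y, jb y ^ (1 / 4 : ℝ) * |v y| + jb y ^ (-1 / 4 : ℝ) * |deriv v y| ≤ C * D) ∧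
      ∀ y, κ ≤ y → jb y * |v y| + jb y ^ (1 / 2 : ℝ) * |deriv v y| ≤ C * D * Real.log (jb y) := by
  obtain ⟨C₁, h₁, H₁⟩ := exists_bootstrap
  obtain ⟨C₂, h₂, H₂⟩ := exists_elliptic_log
  -- Between `κ` and `4` the logarithm is bounded below by `l > 0`, so the bound on the whole line
  -- suffices there; this is how the constant comes to depend on `κ`.
  set l := Real.log (jb κ) with hl
  have hl0 : 0 < l := Real.log_pos (Real.lt_sqrt_of_sq_lt (by nlinarith))
  refine ⟨2 * C₁ + 2 * C₂ * (1 + 2 * C₁) + 50 * C₁ / l, by positivity,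
    fun D A₀ v hD hA₀ hA1 hA2 hv hW h0 h0' => ?_⟩
  obtain ⟨A, p0, p1, p2, p3, p4⟩ := H₁ D A₀ v hD hA₀ hA1 hA2 hv hW h0 h0'
  have hsq : (2 * A) ^ 2 ≤ D := (pow_le_pow_left₀ (by positivity) (by linarith) 2).trans hA2
  have hDA : D + 2 * A ≤ (1 + 2 * C₁) * D := by linarith
  have hp1 : 0 ≤ 2 * C₁ * D := by positivity
  have hp2 : 0 ≤ 2 * C₂ * (1 + 2 * C₁) * D := by positivity
  have hp3 : 0 ≤ 50 * C₁ / l * D := by positivity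
  refine ⟨fun y => ?_, fun y hy => ?_⟩
  · have ha : 0 < jb y ^ (1 / 4 : ℝ) := Real.rpow_pos_of_pos (jb_pos y) _
    have e1 := p3 y
    have e2 := p4 y
    rw [jb_rpow_neg, ← div_eq_mul_inv, le_div_iff₀ ha] at e1
    rw [jb_rpow_neg, inv_mul_eq_div]
    rw [← div_le_iff₀ ha] at e2
    linarith
  · have hj := one_le_jb y
    rcases lt_or_ge 4 y with h4 | h4
    · have hlog : 0 ≤ Real.log (jb y) := Real.log_nonneg hj
      have hjp : 0 < jb y ^ (1 / 2 : ℝ) := Real.rpow_pos_of_pos (jb_pos y) _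
      have e1 : |v y| ≤ C₂ * (D + 2 * A) * Real.log (jb y) / jb y := by
        refine abs_le_of_tested hv p0.le hD (B := 4 * y) (by linarith) p3 p4 hW
          (by rw [abs_of_pos (by linarith)]; linarith) fun w hw => ?_
        rw [le_div_iff₀ (jb_pos y), mul_comm]
        exact (H₂ D (2 * A) _ w hD.le (by positivity) (by linarith) (by linarith) hsq hw y h4.le le_rfl).1
      have e2 : |deriv v y| ≤ C₂ * (D + 2 * A) * Real.log (jb y) / jb y ^ (1 / 2 : ℝ) := by
        -- The radius `d = y - 4` keeps the neighbourhood inside `z ≥ 4`; there `z ≤ 2 y - 4`, so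
        -- the window `8 y` is large enough.
        refine abs_deriv_le_of_tested (β := fun y => C₂ * (D + 2 * A) * Real.log (jb y) /
          jb y ^ (1 / 2 : ℝ)) hv p0.le hD (B := 8 * y) (d := y - 4) (by linarith) p3 p4 hW
          (by linarith) (by rw [abs_of_pos (by linarith)]; linarith) ?_ fun w hw z hz => ?_
        · refine ContinuousAt.div (continuousAt_const.mul
            (jb_continuous.continuousAt.log (jb_pos y).ne')) ?_ hjp.ne'
          exact jb_continuous.continuousAt.rpow_const (Or.inr (by norm_num))
        · have hz' := abs_le.1 hz
          exact (H₂ D (2 * A) _ w hD.le (by positivity) (by linarith) (by linarith) hsq hw z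
            (by linarith) (by linarith)).2
      rw [le_div_iff₀ (jb_pos y), mul_comm] at e1
      rw [le_div_iff₀ hjp, mul_comm] at e2
      have e3 : C₂ * (D + 2 * A) * Real.log (jb y) ≤ C₂ * ((1 + 2 * C₁) * D) * Real.log (jb y) := by
        gcongr
      have e4 : 0 ≤ (2 * C₁ * D + 50 * C₁ / l * D) * Real.log (jb y) := by positivity
      linarith
    · have hlog : l ≤ Real.log (jb y) := Real.log_le_log (jb_pos κ)
        (jb_mono (by rw [abs_of_pos hκ, abs_of_pos (by linarith)]; exact hy))
      have hj5 : jb y ≤ 5 := by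
        have := jb_le_abs_add_one y
        rw [abs_of_pos (by linarith)] at this; linarith
      have e1 : |v y| ≤ A := (p3 y).trans (mul_le_of_le_one_right p0.le (jb_rpow_neg_le_one y))
      have e2 : |deriv v y| ≤ A * 5 := (p4 y).trans (mul_le_mul_of_nonneg_left
        ((Real.rpow_le_self_of_one_le hj (by norm_num)).trans hj5) p0.le)
      have e3 : jb y ^ (1 / 2 : ℝ) ≤ 5 := (Real.rpow_le_self_of_one_le hj (by norm_num)).trans hj5
      have e4 : jb y * |v y| + jb y ^ (1 / 2 : ℝ) * |deriv v y| ≤ 5 * A + 5 * (A * 5) := by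
        gcongr
      have e5 : 50 * C₁ / l * D * l = 50 * C₁ * D := by field_simp
      have e6 : 50 * C₁ / l * D * l ≤ 50 * C₁ / l * D * Real.log (jb y) := by gcongr
      have e7 : 0 ≤ (2 * C₁ * D + 2 * C₂ * (1 + 2 * C₁) * D) * Real.log (jb y) :=
        mul_nonneg (by positivity) (by linarith)
      linarith
end

/-! ### Rescaling to time one -/

lemma bracket_eq {t τ : ℝ} (hτ : 0 < τ) (ht : t = τ ^ 3) (x : ℝ) :
    bracket t x = τ * jb (τ⁻¹ * x) := by
  have h1 : |t| ^ (2 / 3 : ℝ) = τ ^ 2 := by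
    rw [ht, abs_of_pos (by positivity), ← Real.rpow_natCast, ← Real.rpow_mul hτ.le]; norm_num
  have h2 : x ^ 2 + τ ^ 2 = τ ^ 2 * ((τ⁻¹ * x) ^ 2 + 1) := by field_simp
  rw [bracket, jb, h1, h2, Real.sqrt_mul (sq_nonneg τ), Real.sqrt_sq hτ.le]

/-- Reduction to time one. -/
lemma weakTests_of_norms {ε t τ K M : ℝ} (hε : 0 < ε) (hτ : 0 < τ) (ht : t = τ ^ 3) (hK : 0 < K)
    (hδ : ε * τ ≤ 1) {u : ℝ → ℝ} (hu : Measurable u)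
    (hM : ∀ x, |u x| ≤ M * (1 + |x|) ^ (-1 / 4 : ℝ))
    (h1 : besovSumNorm ε (toDist fun x => (u x : ℂ)) < ENNReal.ofReal (K * ε))
    (h2 : homSobolevNorm (1 / 2) (LNL t u) < ENNReal.ofReal (K * ε)) :
    WeakTests (K * (Real.sqrt 2 * shellSum + 1) * (ε * τ)) fun y => τ ^ 2 * u (τ * y) := by
  have hs0 := shellSum_nonneg
  have hsτ : 0 < Real.sqrt τ := Real.sqrt_pos.2 hτ
  have hsτ2 : Real.sqrt τ ^ 2 = τ := Real.sq_sqrt hτ.le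
  have hτi : 0 < τ⁻¹ := inv_pos.2 hτ
  have cov : ∀ g : ℝ → ℝ, ∫ x, g (τ⁻¹ * x) = τ * ∫ y, g y := fun g => by
    rw [Measure.integral_comp_mul_left, inv_inv, abs_of_pos hτ, smul_eq_mul]
  have d1 : ∀ φ : ℝ → ℝ, deriv (fun x => φ (τ⁻¹ * x)) = fun x => τ⁻¹ * deriv φ (τ⁻¹ * x) :=
    fun φ => funext fun x => by rw [deriv_comp_mul_left, smul_eq_mul]
  have d3 : ∀ φ : ℝ → ℝ, deriv (deriv (deriv fun x => φ (τ⁻¹ * x)))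
      = fun x => τ⁻¹ ^ 3 * deriv (deriv (deriv φ)) (τ⁻¹ * x) := fun φ => by
    have dc : ∀ ψ : ℝ → ℝ, ∀ c : ℝ, deriv (fun x => c * ψ (τ⁻¹ * x))
        = fun x => c * τ⁻¹ * deriv ψ (τ⁻¹ * x) := fun ψ c => funext fun x => by
      rw [deriv_const_mul_field, d1]; ring
    rw [d1, dc, dc]; funext x; ring
  have prep : ∀ φ : ℝ → ℝ, ContDiff ℝ (⊤ : ℕ∞) φ → HasCompactSupport φ → ∀ a b : ℝ,
      ∫ x, φ x ^ 2 ≤ a ^ 2 → ∫ x, deriv φ x ^ 2 ≤ b ^ 2 →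
      ContDiff ℝ (⊤ : ℕ∞) (fun x => φ (τ⁻¹ * x)) ∧ HasCompactSupport (fun x => φ (τ⁻¹ * x)) ∧
      ∫ x, φ (τ⁻¹ * x) ^ 2 ≤ (Real.sqrt τ * a) ^ 2 ∧
      ∫ x, deriv (fun x => φ (τ⁻¹ * x)) x ^ 2 ≤ (b / Real.sqrt τ) ^ 2 := by
    intro φ hφ hs a b i1 i2
    refine ⟨hφ.comp (contDiff_const.mul contDiff_id),
      hs.comp_isClosedEmbedding (Homeomorph.mulLeft₀ τ⁻¹ hτi.ne').isClosedEmbedding, ?_, ?_⟩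
    · rw [cov fun y => φ y ^ 2, mul_pow, hsτ2]
      exact mul_le_mul_of_nonneg_left i1 hτ.le
    · rw [d1, cov fun y => (τ⁻¹ * deriv φ y) ^ 2, div_pow, hsτ2]
      simp_rw [mul_pow]
      rw [integral_const_mul, ← mul_assoc]
      have : τ * τ⁻¹ ^ 2 = τ⁻¹ := by field_simp
      rw [this, inv_mul_eq_div]
      gcongr
  -- The product of the two norms is scale invariant, so only the prefactor `ε` turns into `ε τ`.
  have hab : ∀ a b : ℝ, Real.sqrt τ * a * (b / Real.sqrt τ) = a * b := fun a b => by
    field_simp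
  have hux : ∀ x, u x = u (τ * (τ⁻¹ * x)) := fun x => by
    rw [mul_inv_cancel_left₀ hτ.ne']
  constructor
  · intro φ hφ hs a b ha hb i1 i2
    obtain ⟨t1, t2, t3, t4⟩ := prep φ hφ hs a b i1 i2
    have key := abs_integral_mul_le_of_sobolev (by positivity) hu hM h2 t1 t2 (by positivity)
      (by positivity) t3 t4
    rw [hab, d3, d1] at key
    have e1 : ∫ x, τ⁻¹ * deriv φ (τ⁻¹ * x) * (x * u x)
        = τ⁻¹ * ∫ y, deriv φ y * (y * (τ ^ 2 * u (τ * y))) := by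
      have := cov fun y => τ⁻¹ * deriv φ y * (τ * y * u (τ * y))
      simp only [mul_inv_cancel_left₀ hτ.ne'] at this
      rw [this, ← integral_const_mul, ← integral_const_mul]
      refine integral_congr_ae (Eventually.of_forall fun y => ?_)
      simp only; field_simp
    have e2 : ∫ x, τ⁻¹ ^ 3 * deriv (deriv (deriv φ)) (τ⁻¹ * x) * u x
        = τ⁻¹ ^ 4 * ∫ y, deriv (deriv (deriv φ)) y * (τ ^ 2 * u (τ * y)) := by
      have := cov fun y => τ⁻¹ ^ 3 * deriv (deriv (deriv φ)) y * u (τ * y)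
      simp only [mul_inv_cancel_left₀ hτ.ne'] at this
      rw [this, ← integral_const_mul, ← integral_const_mul]
      refine integral_congr_ae (Eventually.of_forall fun y => ?_)
      simp only; field_simp
    have e3 : ∫ x, τ⁻¹ * deriv φ (τ⁻¹ * x) * u x ^ 2
        = τ⁻¹ ^ 4 * ∫ y, deriv φ y * (τ ^ 2 * u (τ * y)) ^ 2 := by
      have := cov fun y => τ⁻¹ * deriv φ y * u (τ * y) ^ 2
      simp only [mul_inv_cancel_left₀ hτ.ne'] at this
      rw [this, ← integral_const_mul, ← integral_const_mul]
      refine integral_congr_ae (Eventually.of_forall fun y => ?_)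
      simp only; field_simp
    rw [e1, e2, e3, ht] at key
    set I := ∫ y, deriv φ y * (y * (τ ^ 2 * u (τ * y)))
    set J := ∫ y, deriv (deriv (deriv φ)) y * (τ ^ 2 * u (τ * y))
    set L := ∫ y, deriv φ y * (τ ^ 2 * u (τ * y)) ^ 2
    have e4 : τ⁻¹ * I - 3 * τ ^ 3 * (τ⁻¹ ^ 4 * J) + 9 * τ ^ 3 * (τ⁻¹ ^ 4 * L)
        = τ⁻¹ * (I - 3 * J + 9 * L) := by field_simp
    rw [e4, abs_mul, abs_of_pos hτi, inv_mul_le_iff₀ hτ] at key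
    refine key.trans ?_
    have e5 : τ * (K * ε * Real.sqrt (a * b)) = K * (ε * τ) * Real.sqrt (a * b) := by ring
    rw [e5]
    have : 0 ≤ K * (Real.sqrt 2 * shellSum) * (ε * τ) * Real.sqrt (a * b) := by positivity
    linarith
  · intro φ hφ hs a b ha hb i1 i2
    obtain ⟨t1, t2, t3, t4⟩ := prep φ hφ hs a b i1 i2
    have key := abs_integral_mul_le_of_besov hε (by positivity) hu hM h1 t1 t2 (by positivity)
      (by positivity) t3 t4
    rw [hab] at key
    have e1 : ∫ x, φ (τ⁻¹ * x) * u x = τ⁻¹ * ∫ y, φ y * (τ ^ 2 * u (τ * y)) := by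
      have := cov fun y => φ y * u (τ * y)
      simp only [mul_inv_cancel_left₀ hτ.ne'] at this
      rw [this, ← integral_const_mul, ← integral_const_mul]
      refine integral_congr_ae (Eventually.of_forall fun y => ?_)
      simp only; field_simp
    rw [e1, abs_mul, abs_of_pos hτi, inv_mul_le_iff₀ hτ, ← Real.sqrt_eq_rpow] at key
    refine key.trans ?_
    -- The `L²` part of the sum space is not scale invariant: it carries an extra `√(ε τ)`, which is
    -- at most one in the time range considered.
    have e2 : Real.sqrt ε * Real.sqrt τ ≤ 1 := by
      rw [← Real.sqrt_mul hε.le]; exact Real.sqrt_le_one.2 hδ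
    have e3 : τ * (K * ε * (Real.sqrt 2 * shellSum) * Real.sqrt (a * b)
          + K * ε * Real.sqrt ε * (Real.sqrt τ * a))
        = K * (ε * τ) * ((Real.sqrt 2 * shellSum) * Real.sqrt (a * b)
          + (Real.sqrt ε * Real.sqrt τ) * a) := by ring
    have e4 : (Real.sqrt ε * Real.sqrt τ) * a ≤ 1 * a := mul_le_mul_of_nonneg_right e2 ha.le
    have e5 : (Real.sqrt 2 * shellSum) * Real.sqrt (a * b) + (Real.sqrt ε * Real.sqrt τ) * a
        ≤ (Real.sqrt 2 * shellSum + 1) * (Real.sqrt (a * b) + a) := by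
      have : 0 ≤ Real.sqrt 2 * shellSum * a + Real.sqrt (a * b) := by positivity
      linarith
    rw [e3]
    refine (mul_le_mul_of_nonneg_left e5 (by positivity)).trans_eq (by ring)

end KdV

end

theorem proposition3p4 :
    ∀ K : ℝ, 0 < K → ∀ κ : ℝ, 0 < κ → ∃ C : ℝ, 0 < C ∧ ∀ M : ℝ, 0 < M → ∃ c : ℝ, 0 < c ∧
      ∀ ε t : ℝ, 0 < ε → 0 < t → t ≤ c * (ε ^ 3)⁻¹ →
      ∀ u : ℝ → ℝ, Differentiable ℝ u →
        -- the pointwise bootstrap bounds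
        (∀ x : ℝ, |u x| ≤ M * ε * t ^ (-1 / 4 : ℝ) * KdV.bracket t x ^ (-1 / 4 : ℝ)) →
        (∀ x : ℝ, |deriv u x| ≤ M * ε * t ^ (-3 / 4 : ℝ) * KdV.bracket t x ^ (1 / 4 : ℝ)) →
        -- the energy bounds
        KdV.besovSumNorm ε (KdV.toDist fun x => (u x : ℂ))
            + KdV.homSobolevNorm (1 / 2) (KdV.LNL t u) ≤ ENNReal.ofReal (K * ε) →
        -- the Airy-type pointwise bound on the whole line
        (∀ x : ℝ, t ^ (1 / 4 : ℝ) * KdV.bracket t x ^ (1 / 4 : ℝ) * |u x|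
            + t ^ (3 / 4 : ℝ) * KdV.bracket t x ^ (-1 / 4 : ℝ) * |deriv u x| ≤ C * ε) ∧
        -- the improved bound in the elliptic region
        (∀ x : ℝ, κ * t ^ (1 / 3 : ℝ) ≤ x →
          KdV.bracket t x * |u x|
            + t ^ (1 / 2 : ℝ) * KdV.bracket t x ^ (1 / 2 : ℝ) * |deriv u x|
              ≤ C * ε * Real.log (t ^ (-1 / 3 : ℝ) * KdV.bracket t x)) := by
  intro K hK κ hκ
  obtain ⟨C, hC, H⟩ := KdV.exists_pointwise κ hκ
  have hs0 := KdV.shellSum_nonneg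
  -- The factor `2` makes the energy bounds strict, so that near-optimal representatives can be
  -- extracted from the infima in the norms.
  set C₀ := 2 * K * (Real.sqrt 2 * KdV.shellSum + 1) with hC₀
  have hC₀p : 0 < C₀ := by positivity
  refine ⟨C * C₀, by positivity, fun M hM => ?_⟩
  -- With `A₀ = M ε τ` and `D = C₀ ε τ`, the bound `ε τ ≤ d` gives in turn `ε τ ≤ 1`, `2 A₀ ≤ 1/100`
  -- and `(2 A₀) ^ 2 ≤ D`. Only this smallness depends on `M`.
  set d := min 1 (min (1 / (200 * M)) (C₀ / (4 * M ^ 2))) with hd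
  have hd0 : 0 < d := by positivity
  refine ⟨d ^ 3, by positivity, fun ε t hε ht htc u hu h0 h0' hE => ?_⟩
  obtain ⟨τ, hτ, htτ⟩ : ∃ τ : ℝ, 0 < τ ∧ t = τ ^ 3 := ⟨t ^ (1 / 3 : ℝ), by positivity, by
    rw [← Real.rpow_natCast, ← Real.rpow_mul ht.le]; norm_num⟩
  have hpow : ∀ p q : ℝ, 3 * p = q → t ^ p = τ ^ q := fun p q h => by
    rw [htτ, ← Real.rpow_natCast, ← Real.rpow_mul hτ.le, ← h]; norm_num
  have hδd : ε * τ ≤ d := by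
    refine le_of_pow_le_pow_left₀ (n := 3) (by norm_num) hd0.le ?_
    rw [mul_pow, ← htτ, mul_comm]
    rwa [← div_eq_mul_inv, le_div_iff₀ (by positivity)] at htc
  have hδ0 : 0 < ε * τ := by positivity
  have hδ1 : ε * τ ≤ 1 := hδd.trans (min_le_left _ _)
  have hδ2 : ε * τ ≤ 1 / (200 * M) := hδd.trans ((min_le_right _ _).trans (min_le_left _ _))
  have hδ3 : ε * τ ≤ C₀ / (4 * M ^ 2) := hδd.trans ((min_le_right _ _).trans (min_le_right _ _))
  rw [le_div_iff₀ (by positivity)] at hδ2 hδ3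
  have hj : ∀ y, 0 < KdV.jb y := KdV.jb_pos
  have hbr : ∀ x, KdV.bracket t x = τ * KdV.jb (τ⁻¹ * x) := KdV.bracket_eq hτ htτ
  have hbrp : ∀ (x p : ℝ), KdV.bracket t x ^ p = τ ^ p * KdV.jb (τ⁻¹ * x) ^ p := fun x p => by
    rw [hbr, Real.mul_rpow hτ.le (hj _).le]
  have hcomb : ∀ p q : ℝ, ∀ n : ℤ, p + q = n → τ ^ p * τ ^ q = τ ^ n := fun p q n h => by
    rw [← Real.rpow_add hτ, h, Real.rpow_intCast]
  have hb0 : ∀ x, |u x| ≤ M * ε * τ⁻¹ * KdV.jb (τ⁻¹ * x) ^ (-1 / 4 : ℝ) := fun x => by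
    refine (h0 x).trans_eq ?_
    have := hcomb (-3 / 4) (-1 / 4) (-1) (by norm_num)
    rw [zpow_neg_one] at this
    rw [hbrp, hpow (-1 / 4) (-3 / 4) (by norm_num), ← this]; ring
  have hb1 : ∀ x, |deriv u x| ≤ M * ε * (τ ^ 2)⁻¹ * KdV.jb (τ⁻¹ * x) ^ (1 / 4 : ℝ) := fun x => by
    refine (h0' x).trans_eq ?_
    have := hcomb (-9 / 4) (1 / 4) (-2) (by norm_num)
    rw [zpow_neg, zpow_ofNat] at this
    rw [hbrp, hpow (-3 / 4) (-9 / 4) (by norm_num), ← this]; ring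
  have hlt : ENNReal.ofReal (K * ε) < ENNReal.ofReal (2 * K * ε) := by
    rw [ENNReal.ofReal_lt_ofReal_iff (by positivity)]
    nlinarith [mul_pos hK hε]
  -- This decay constant depends on `τ`, which is harmless: it is used to remove the frequency
  -- cutoff and does not enter the resulting bounds.
  have hW := KdV.weakTests_of_norms (M := M * ε * τ⁻¹ * (1 + τ) ^ (1 / 4 : ℝ)) hε hτ htτ
    (by positivity : 0 < 2 * K) hδ1 hu.continuous.measurable (fun x => by
      refine (hb0 x).trans ?_
      rw [mul_assoc (M * ε * τ⁻¹)]
      refine mul_le_mul_of_nonneg_left ?_ (by positivity)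
      have h1 : (1 + |x|) / (1 + τ) ≤ KdV.jb (τ⁻¹ * x) := by
        rw [div_le_iff₀ (by positivity)]
        have h2 := KdV.abs_le_jb (τ⁻¹ * x)
        rw [abs_mul, abs_of_pos (inv_pos.2 hτ), inv_mul_le_iff₀ hτ] at h2
        linarith [KdV.one_le_jb (τ⁻¹ * x)]
      refine (Real.rpow_le_rpow_of_nonpos (by positivity) h1 (by norm_num)).trans_eq ?_
      rw [Real.div_rpow (by positivity) (by positivity), div_eq_mul_inv, ← Real.rpow_neg (by positivity),
        mul_comm]
      norm_num)
    ((le_self_add.trans hE).trans_lt hlt) ((le_add_self.trans hE).trans_lt hlt)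
  rw [← hC₀] at hW
  have hdv : ∀ y, deriv (fun y => τ ^ 2 * u (τ * y)) y = τ ^ 3 * deriv u (τ * y) := fun y => by
    rw [deriv_const_mul_field, deriv_comp_mul_left, smul_eq_mul]; ring
  have hyy : ∀ y, τ⁻¹ * (τ * y) = y := fun y => inv_mul_cancel_left₀ hτ.ne' y
  obtain ⟨r1, r2⟩ := H (C₀ * (ε * τ)) (M * (ε * τ)) (fun y => τ ^ 2 * u (τ * y)) (by positivity)
    (by positivity) (by linarith) (by nlinarith) (by fun_prop) hW
    (fun y => by
      have := hb0 (τ * y)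
      rw [hyy] at this
      rw [abs_mul, abs_of_pos (by positivity)]
      refine (mul_le_mul_of_nonneg_left this (by positivity)).trans_eq ?_
      field_simp)
    (fun y => by
      have := hb1 (τ * y)
      rw [hyy] at this
      rw [hdv, abs_mul, abs_of_pos (by positivity)]
      refine (mul_le_mul_of_nonneg_left this (by positivity)).trans_eq ?_
      field_simp)
  have hττ : ∀ x, τ * (τ⁻¹ * x) = x := fun x => mul_inv_cancel_left₀ hτ.ne' x
  constructor
  · intro x
    have := r1 (τ⁻¹ * x)
    simp only [hdv, hττ] at this
    rw [abs_mul, abs_mul, abs_of_pos (by positivity : 0 < τ ^ 2),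
      abs_of_pos (by positivity : 0 < τ ^ 3)] at this
    have e1 := hcomb (3 / 4) (1 / 4) 1 (by norm_num)
    have e2 := hcomb (9 / 4) (-1 / 4) 2 (by norm_num)
    rw [zpow_one] at e1
    rw [zpow_ofNat] at e2
    rw [hbrp, hbrp, hpow (1 / 4) (3 / 4) (by norm_num), hpow (3 / 4) (9 / 4) (by norm_num),
      ← mul_assoc, ← mul_assoc (τ ^ (9 / 4 : ℝ)), e1, e2]
    refine le_of_mul_le_mul_left ?_ hτ
    linarith
  · intro x hx
    rw [hpow (1 / 3) 1 (by norm_num), Real.rpow_one] at hx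
    have := r2 (τ⁻¹ * x) (by rw [← div_eq_inv_mul, le_div_iff₀ hτ]; exact hx)
    simp only [hdv, hττ] at this
    rw [abs_mul, abs_mul, abs_of_pos (by positivity : 0 < τ ^ 2),
      abs_of_pos (by positivity : 0 < τ ^ 3)] at this
    have e1 := hcomb (3 / 2) (1 / 2) 2 (by norm_num)
    rw [zpow_ofNat] at e1
    have e2 : t ^ (-1 / 3 : ℝ) * KdV.bracket t x = KdV.jb (τ⁻¹ * x) := by
      rw [hpow (-1 / 3) (-1) (by norm_num), Real.rpow_neg_one, hbr, inv_mul_cancel_left₀ hτ.ne']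
    rw [e2, hbrp, hbr, hpow (1 / 2) (3 / 2) (by norm_num), ← mul_assoc (τ ^ (3 / 2 : ℝ)), e1]
    refine le_of_mul_le_mul_left ?_ hτ
    linarith
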